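/- **Setting.** Let $D\subset\mathbb C$ be a domain containing $[-1,1]$ and let $V:D\to\mathbb C$ be holomorphic. For a piecewise continuous $W:[-1,1]\to\mathbb C$, let $\lim_h\mathrm{Sp}(W)$ be the set of all $E_0\in\mathbb C$ for which there are $h_j>0$, $h_j\to0$, and Dirichlet eigenvalues $E_j$ of $-h_j^2\frac{d^2}{dx^2}+W$ on $L^2([-1,1])$ (domain: $u,u''\in L^2$, $u(\pm1)=0$) with $E_j\to E_0$. For $-1<\beta<\beta'<1$ and $\delta_1,\delta_2\in\mathbb R\setminus\{0\}$ put $$V_{\beta\beta'}=V+i\delta_1H_\beta+i\delta_2H_{\beta'},$$ where $H_\beta$ is the Heaviside function with jump at $\beta$. In $\int\sqrt{W-E}\,dx$ over an interval, $\sqrt{W-E}$ denotes a branch of the square root that is continuous on that (open) interval; the vanishing of the real part does not depend on the sign. The Stokes line issuing from a point $\alpha$ is the set of points of $D$ reached from $\alpha$ along curves in $D$ on which $\mathrm{Re}\int_\alpha(V-E)^{1/2}dt\equiv0$; turning points are the zeros of $V-E$ in $D$; two points belong to the same Stokes region if a path in $D$ joins them without meeting a Stokes line issuing from a turning point. Consider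 the hypotheses * **(H1)** Either every $\Omega\subset\mathbb C$ with $V^{-1}(\Omega)$ bounded is relatively compact, or every relatively compact $\Omega\subset\mathbb C$ has bounded $V^{-1}(\Omega)$. * **(H4)** for $\beta,\beta'$: there are $R$ and $\varepsilon>0$ such that $-1,1,\beta,\beta'$ belong to the same Stokes region whenever $\mathrm{Re}\,E\ge R$ and $|\mathrm{Im}\,E|\le\varepsilon$. **Theorem.** Assume (H1). 1. Let $-1<\beta<\beta'<1$ satisfy (H4), and let $\delta_1,\delta_2$ be nonzero real numbers. Then there is $R$ such that for all $E_0\in\mathbb C$ with $|E_0|\ge R$ the following are equivalent: (a) $\mathrm{Re}\int_{-1}^{\beta}\sqrt{V_{\beta\beta'}-E_0}\,dx=0$, or $\mathrm{Re}\int_{\beta'}^{1}\sqrt{V_{\beta\beta'}-E_0}\,dx=0$, or $\mathrm{Re}\int_{\beta}^{\beta'}\sqrt{V_{\beta\beta'}-E_0}\,dx=0$; (b) $E_0\in\lim_h\mathrm{Sp}(V_{\beta\beta'})$. 2. Let $-1<\beta<\beta'<1$ satisfy (H4), and let $\delta_1\in\mathbb R$. There are $A>0$ and $C$ such that for every real $a\ge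 A$ the equation $$\mathrm{Re}\int_\beta^{\beta'}\sqrt{V(x)+i\delta_1-a-ib}\,dx=0$$ has a unique solution $b=b(a)\in\mathbb R$, and $$\Bigl|\,b(a)-\Bigl(\frac1{\beta'-\beta}\,\mathrm{Im}\int_\beta^{\beta'}V(x)\,dx+\delta_1\Bigr)\Bigr|\le\frac Ca .$$ 3. Assume (H4) for all $-1<\beta<\beta'<1$. Then there is $R$, depending only on $V$, such that: (a) for every $x\in[-1,1]$ and every real $\xi$ with $|\xi|\ge R$, and every $\varepsilon>0$, there is $\eta>0$ such that whenever $-1<\beta<\beta'<1$, $|\beta-x|<\eta$, $|\beta'-x|<\eta$, $0<|\delta_1|<\eta$ and $0<|\delta_2|<\eta$, some $E\in\lim_h\mathrm{Sp}(V_{\beta\beta'})$ satisfies $|E-(\xi^2+i\,\mathrm{Im}\,V(x))|<\varepsilon$; (b) for every $z$ with $|z|\ge R$ in the pseudospectrum $\overline{\{\xi^2+V(x):\ x\in(-1,1),\ \xi\in\mathbb R,\ \mathrm{Im}(\xi V'(x))\ne0\}}$ and every $\varepsilon>0$ there are $-1<\beta<\beta'<1$ with $\beta'-\beta<\varepsilon$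 and $\delta_1,\delta_2\in(0,\varepsilon)$ such that some $E\in\lim_h\mathrm{Sp}(V_{\beta\beta'})$ satisfies $|E-z|<\varepsilon$. -/

import Mathlib

open Set Filter Topology MeasureTheory

noncomputable section

/-- The potential with two jumps `V + i δ₁ H_β + i δ₂ H_β'` on the real line, where `H_β` is the
Heaviside function with jump at `β` (its value at the jump itself is irrelevant). -/
def jumpPotential (V : ℂ → ℂ) (β β' δ₁ δ₂ : ℝ) (x : ℝ) : ℂ :=
  V x + Complex.I * δ₁ * (Ioi β).indicator 1 x + Complex.I * δ₂ * (Ioi β').indicator 1 x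

/-- `u` belongs to the domain `{u, u'' ∈ L²([-1,1]), u(-1) = u(1) = 0}` and `w` is its second
derivative: `u` is continuously differentiable on `[-1,1]`, and its derivative is absolutely
continuous with density `w ∈ L²`. -/
def InDirichletDomain (u w : ℝ → ℂ) : Prop :=
  MemLp w 2 (volume.restrict (Icc (-1) 1)) ∧
  (∃ v : ℝ → ℂ, ∀ x ∈ Icc (-1 : ℝ) 1,
    HasDerivWithinAt u (v x) (Icc (-1) 1) x ∧ v x = v (-1) + ∫ t in (-1 : ℝ)..x, w t) ∧
  u (-1) = 0 ∧ u 1 = 0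

/-- `E` is an eigenvalue of `-h² d²/dx² + W` on `L²([-1,1])` with Dirichlet boundary condition. -/
def IsDirichletEigenvalue (h : ℝ) (W : ℝ → ℂ) (E : ℂ) : Prop :=
  ∃ u w : ℝ → ℂ, InDirichletDomain u w ∧ (∃ x ∈ Icc (-1 : ℝ) 1, u x ≠ 0) ∧
    ∀ᵐ x ∂(volume.restrict (Icc (-1 : ℝ) 1)), -(h : ℂ) ^ 2 * w x + W x * u x = E * u x

/-- The limit spectrum: all limits, as `h → 0`, of sequences of eigenvalues of
`-h² d²/dx² + W`. -/
def limitSpectrum (W : ℝ → ℂ) : Set ℂ :=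
  {E₀ | ∃ (h : ℕ → ℝ) (E : ℕ → ℂ), (∀ n, 0 < h n) ∧ Tendsto h atTop (𝓝 0) ∧
    (∀ n, IsDirichletEigenvalue (h n) W (E n)) ∧ Tendsto E atTop (𝓝 E₀)}

/-- `Re ∫_p^q √(W - E) dx = 0`, for a branch of the square root that is continuous on `(p, q)`.
If `W - E` is continuous and does not vanish there, then there are exactly two such branches,
which differ by a sign, and the condition does not depend on the choice. -/
def ActionVanishes (W : ℝ → ℂ) (E : ℂ) (p q : ℝ) : Prop :=
  ∃ s : ℝ → ℂ, ContinuousOn s (Ioo p q) ∧ (∀ x ∈ Ioo p q, s x ^ 2 = W x - E) ∧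
    (∫ x in p..q, s x).re = 0

/-- The Stokes line issuing from `x`: the points that are reached from `x` along curves in the
domain on which `Re ∫_x (V - E)^{1/2}` is identically zero. -/
def stokesLine (D : Set ℂ) (V : ℂ → ℂ) (E x : ℂ) : Set ℂ :=
  {y | ∃ γ s : ℝ → ℂ, ContDiffOn ℝ 1 γ (Icc 0 1) ∧ ContinuousOn s (Icc 0 1) ∧
    γ 0 = x ∧ γ 1 = y ∧ (∀ t ∈ Icc (0 : ℝ) 1, γ t ∈ D ∧ s t ^ 2 = V (γ t) - E) ∧
    ∀ t ∈ Icc (0 : ℝ) 1, (∫ r in (0 : ℝ)..t, s r * derivWithin γ (Icc 0 1) r).re = 0}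

/-- The turning points of `H - E`. -/
def turningPoints (D : Set ℂ) (V : ℂ → ℂ) (E : ℂ) : Set ℂ :=
  {α ∈ D | V α = E}

/-- `p` and `q` belong to the same Stokes region: some path from `p` to `q` meets no Stokes line
issuing from a turning point. -/
def SameStokesRegion (D : Set ℂ) (V : ℂ → ℂ) (E p q : ℂ) : Prop :=
  JoinedIn (D \ ⋃ α ∈ turningPoints D V E, stokesLine D V E α) p q

/-- Hypothesis (H1), in either of its two readings: sets with bounded preimage are relatively
compact, or relatively compact sets have bounded preimage. -/
def HypothesisH1 (D : Set ℂ) (V : ℂ → ℂ) : Prop :=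
  (∀ Ω : Set ℂ, Bornology.IsBounded (D ∩ V ⁻¹' Ω) → IsCompact (closure Ω)) ∨
  (∀ Ω : Set ℂ, IsCompact (closure Ω) → Bornology.IsBounded (D ∩ V ⁻¹' Ω))

/-- Hypothesis (H4): for `E` large with small imaginary part, the points `-1`, `1`, `β`, `β'`
belong to the same Stokes region. -/
def HypothesisH4 (D : Set ℂ) (V : ℂ → ℂ) (β β' : ℝ) : Prop :=
  ∃ R ε : ℝ, 0 < ε ∧ ∀ E : ℂ, R ≤ E.re → |E.im| ≤ ε →
    SameStokesRegion D V E (-1) 1 ∧ SameStokesRegion D V E (-1) β ∧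
    SameStokesRegion D V E (-1) β'

/-- The semiclassical pseudospectrum of `-h² d²/dx² + V` on `[-1,1]`. -/
def pseudospectrum (V : ℂ → ℂ) : Set ℂ :=
  closure {z | ∃ x ξ : ℝ, x ∈ Ioo (-1 : ℝ) 1 ∧ ((ξ : ℂ) * deriv V x).im ≠ 0 ∧
    z = (ξ : ℂ) ^ 2 + V x}

end

/-! ### The principal square root -/

/-! At high energy `(V + k) / E` is small on a complex neighbourhood of `[-1,1]`, uniformly for
bounded constants `k`. Hence `1 - (V + k) / E` has no zeros there, and WKB is a small perturbation
of the constant-coefficient equation. On each of the three intervals cut out by the jumps, the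
coefficients of the two WKB solutions are multiplied by `exp (± A / h)`, where `A` is the action of
the interval, up to an error `O(h)` times the dominant exponential (`wkb_transfer`,
`exists_wkbBounds`).

The eigenvalues are the zeros of an entire function of `E`: the value at `1` of the solution with
Cauchy data `(0, 1)` at `-1` (`exists_shooting_solution`). Let `Φ(E)` be the sum of the three `|Re
A|`. If no `Re A` vanishes, then on each interval one mode dominates. A jump changes the
characteristic slopes (`jump_ne`), so the mode arriving from the left excites both modes on the
right, including the growing one. Thus the shooting function, normalised by `exp (-Φ / h)`, has
modulus tending to a positive limit (`WKBBounds.shooting_tendsto`), and there are no eigenvalues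
nearby. This gives (b) ⇒ (a).

Conversely let some `Re A` vanish at `E₀`, and suppose that for small `h` there are no eigenvalues
near `E₀`. Then `h log |shooting function|` is harmonic there, bounded above, and converges to `Φ`
on a dense set. By Harnack's inequality the limit `Φ` has the mean value property at `E₀`
(`circleAverage_eq_of_tendsto_on_dense`). But each `|Re A|` is subharmonic, strictly so at its
zeros, which is a contradiction (`WKBBounds.exists_shooting_eq_zero`).

On the vertical line `Re E = a` the action condition reads `∫ Im √(a + ib - f) = 0`, whose left side
is strictly increasing in `b`. This gives existence and uniqueness, places `b` between the bounds of
`Im f`, and a first order expansion in `1 / a` identifies it with the mean of `Im f`. On a short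
interval `[β, β']` near `x` with small jumps, the resulting `b` is close to `Im V(x)`. Together with
the description of the limit spectrum this yields the third statement. -/

theorem csqrt_sq (a : ℂ) : a.sqrt ^ 2 = a := by
  simp only [Complex.sqrt]
  exact Complex.cpow_ofNat_inv_pow a 2

theorem re_csqrt_nonneg (a : ℂ) : 0 ≤ a.sqrt.re := by
  simp only [Complex.sqrt, Complex.cpow_inv_two_re]
  positivity

theorem re_csqrt_pos {a : ℂ} (ha : a ∈ Complex.slitPlane) : 0 < a.sqrt.re := by
  simp only [Complex.sqrt, Complex.cpow_inv_two_re]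
  apply Real.sqrt_pos_of_pos
  have h1 := Complex.abs_re_le_norm a
  have h2 := neg_abs_le a.re
  rcases ha with h | h
  · have := norm_nonneg a
    linarith
  · have : |a.re| < ‖a‖ := Complex.abs_re_lt_norm.2 h
    linarith

theorem csqrt_ne_zero {a : ℂ} (ha : a ≠ 0) : a.sqrt ≠ 0 := by
  intro h
  have := csqrt_sq a
  rw [h] at this
  exact ha (by simpa using this.symm)

theorem one_le_norm_add_one {z : ℂ} (hz : 0 ≤ z.re) : 1 ≤ ‖z + 1‖ := by
  have := Complex.re_le_norm (z + 1)
  simp at this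
  linarith

/-- Since `Re √a ≥ 0`, the factor `√a + 1` of `a - 1` has modulus at least one. No smallness of `a -
1` is needed. -/
theorem norm_csqrt_sub_one_le (a : ℂ) : ‖a.sqrt - 1‖ ≤ ‖a - 1‖ := by
  have h1 : (a.sqrt - 1) * (a.sqrt + 1) = a - 1 := by
    linear_combination csqrt_sq a
  rw [← h1, norm_mul]
  exact le_mul_of_one_le_right (norm_nonneg _) (one_le_norm_add_one (re_csqrt_nonneg a))

theorem norm_csqrt_one_add_sub_le (w : ℂ) :
    ‖(1 + w).sqrt - 1 - w / 2‖ ≤ ‖w‖ ^ 2 / 2 := by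
  have h1 : (1 + w).sqrt - 1 - w / 2 = -((1 + w).sqrt - 1) ^ 2 / 2 := by
    linear_combination (1 / 2) * csqrt_sq (1 + w)
  have h2 := norm_csqrt_sub_one_le (1 + w)
  rw [h1, norm_div, norm_neg, norm_pow]
  simp only [Complex.norm_ofNat]
  have h3 : ‖(1 + w).sqrt - 1‖ ≤ ‖w‖ := by simpa using h2
  gcongr

/-! ### Vanishing of the action -/

theorem ActionVanishes.congr {W W' : ℝ → ℂ} {E : ℂ} {p q : ℝ}
    (h : ∀ x ∈ Ioo p q, W x = W' x) (hW : ActionVanishes W E p q) : ActionVanishes W' E p q := by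
  obtain ⟨s, hs, hs2, hs3⟩ := hW
  exact ⟨s, hs, fun x hx => by rw [hs2 x hx, h x hx], hs3⟩

theorem actionVanishes_congr {W W' : ℝ → ℂ} {E : ℂ} {p q : ℝ}
    (h : ∀ x ∈ Ioo p q, W x = W' x) : ActionVanishes W E p q ↔ ActionVanishes W' E p q :=
  ⟨fun h' => h'.congr h, fun h' => h'.congr fun x hx => (h x hx).symm⟩

theorem intervalIntegral_congr_Ioo {f g : ℝ → ℂ} {p q : ℝ} (hpq : p ≤ q)
    (h : ∀ x ∈ Ioo p q, f x = g x) : ∫ x in p..q, f x = ∫ x in p..q, g x := by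
  rw [intervalIntegral.integral_of_le hpq, intervalIntegral.integral_of_le hpq,
    integral_Ioc_eq_integral_Ioo, integral_Ioc_eq_integral_Ioo]
  exact setIntegral_congr_fun measurableSet_Ioo h

/-- On a connected interval two continuous roots of a nonvanishing function agree up to one global
sign, so a single explicit branch decides the condition. -/
theorem actionVanishes_iff {W s : ℝ → ℂ} {E : ℂ} {p q : ℝ} (hpq : p ≤ q)
    (hs : ContinuousOn s (Ioo p q)) (hsq : ∀ x ∈ Ioo p q, s x ^ 2 = W x - E)
    (hne : ∀ x ∈ Ioo p q, s x ≠ 0) :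
    ActionVanishes W E p q ↔ (∫ x in p..q, s x).re = 0 := by
  refine ⟨?_, fun h => ⟨s, hs, hsq, h⟩⟩
  rintro ⟨t, ht, htsq, h0⟩
  have hpre : IsPreconnected (Ioo p q) := isPreconnected_Ioo
  rcases hpre.eq_or_eq_neg_of_sq_eq ht hs
    (fun x hx => by simp [htsq x hx, hsq x hx]) (fun {x} hx => hne x hx) with h | h
  · rwa [← intervalIntegral_congr_Ioo hpq h]
  · rw [intervalIntegral_congr_Ioo hpq h] at h0
    simpa using h0

/-! ### Vanishing action at prescribed real part of the energy -/

section VerticalLine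

variable {f : ℝ → ℂ} {p q a : ℝ}

theorem continuousOn_csqrt_sub (hf : ContinuousOn f (Icc p q))
    (ha : ∀ x ∈ Icc p q, (f x).re < a) (b : ℝ) :
    ContinuousOn (fun x => (a + b * Complex.I - f x).sqrt) (Icc p q) := by
  apply Complex.continuousOn_sqrt.comp (by fun_prop)
  intro x hx
  left
  simpa using ha x hx

/-- Multiplying the principal root of `E - f`, continuous because `Re (E - f) > 0`, by `i` gives a
branch of `√(f - E)`; the factor `i` turns the real part of the action into minus an imaginary part.
-/
theorem actionVanishes_vertical_iff (hpq : p ≤ q) (hf : ContinuousOn f (Icc p q))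
    (ha : ∀ x ∈ Icc p q, (f x).re < a) (b : ℝ) :
    ActionVanishes f (a + b * Complex.I) p q ↔
      ∫ x in p..q, (a + b * Complex.I - f x).sqrt.im = 0 := by
  have hc := continuousOn_csqrt_sub hf ha b
  have hint : IntervalIntegrable (fun x => (a + b * Complex.I - f x).sqrt) volume p q :=
    ContinuousOn.intervalIntegrable (by rwa [uIcc_of_le hpq])
  rw [actionVanishes_iff (s := fun x => Complex.I * (a + b * Complex.I - f x).sqrt) hpq
    ((continuousOn_const.mul hc).mono Ioo_subset_Icc_self)]
  · rw [intervalIntegral.integral_const_mul]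
    have : (∫ x in p..q, (a + b * Complex.I - f x).sqrt).im =
        ∫ x in p..q, (a + b * Complex.I - f x).sqrt.im :=
      (Complex.imCLM.intervalIntegral_comp_comm hint).symm
    simp [this]
  · intro x _
    rw [mul_pow, csqrt_sq, Complex.I_sq]
    ring
  · intro x hx
    refine mul_ne_zero Complex.I_ne_zero (csqrt_ne_zero fun h => ?_)
    have h1 := ha x (Ioo_subset_Icc_self hx)
    have h2 := congrArg Complex.re h
    simp at h2
    linarith

theorem csqrt_im_nonneg {z : ℂ} (hz : 0 ≤ z.im) : 0 ≤ z.sqrt.im := by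
  simp only [Complex.sqrt, Complex.cpow_inv_two_im_eq_sqrt hz]
  positivity

theorem csqrt_im_nonpos {z : ℂ} (hr : 0 < z.re) (hz : z.im ≤ 0) : z.sqrt.im ≤ 0 := by
  have h1 := congrArg Complex.im (csqrt_sq z)
  have h2 : 0 < z.sqrt.re := re_csqrt_pos (Or.inl hr)
  rw [pow_two, Complex.mul_im] at h1
  by_contra! h
  nlinarith

/-- The roots `x + iy` of numbers with fixed real part `c > 0` lie on the hyperbola branch `x² - y²
= c`, `x > 0`, where the imaginary part `2xy = 2y√(c + y²)` of the square increases with `y`. -/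
theorem csqrt_im_strictMono {z w : ℂ} (hz : 0 < z.re) (hre : z.re = w.re) (him : z.im < w.im) :
    z.sqrt.im < w.sqrt.im := by
  have hz' : 0 < z.sqrt.re := re_csqrt_pos (Or.inl hz)
  have hw' : 0 < w.sqrt.re := re_csqrt_pos (Or.inl (hre ▸ hz))
  have h1 := congrArg Complex.im (csqrt_sq z)
  have h2 := congrArg Complex.im (csqrt_sq w)
  have h3 := congrArg Complex.re (csqrt_sq z)
  have h4 := congrArg Complex.re (csqrt_sq w)
  simp only [pow_two, Complex.mul_im, Complex.mul_re] at h1 h2 h3 h4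
  by_contra! h
  rcases le_or_gt 0 w.sqrt.im with h5 | h5
  · have : w.sqrt.re ≤ z.sqrt.re := by
      by_contra! h6
      nlinarith
    nlinarith
  · rcases le_or_gt 0 z.sqrt.im with h6 | h6
    · nlinarith [mul_nonneg hz'.le h6, mul_neg_of_pos_of_neg hw' h5]
    · have : z.sqrt.re ≤ w.sqrt.re := by
        by_contra! h6
        nlinarith
      nlinarith

theorem strictMono_integral_csqrt_im (hpq : p < q) (hf : ContinuousOn f (Icc p q))
    (ha : ∀ x ∈ Icc p q, (f x).re < a) :
    StrictMono fun b : ℝ => ∫ x in p..q, (a + b * Complex.I - f x).sqrt.im := by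
  intro b b' hb
  refine intervalIntegral.integral_lt_integral_of_continuousOn_of_le_of_exists_lt hpq
    (Complex.continuous_im.comp_continuousOn (continuousOn_csqrt_sub hf ha b))
    (Complex.continuous_im.comp_continuousOn (continuousOn_csqrt_sub hf ha b')) ?_
    ⟨p, left_mem_Icc.2 hpq.le, ?_⟩
  · intro x hx
    refine (csqrt_im_strictMono ?_ (by simp) (by simpa using hb)).le
    simpa using ha x (Ioc_subset_Icc_self hx)
  · refine csqrt_im_strictMono ?_ (by simp) (by simpa using hb)
    simpa using ha p (left_mem_Icc.2 hpq.le)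

theorem continuous_integral_csqrt_im (hpq : p ≤ q) (hf : ContinuousOn f (Icc p q))
    (ha : ∀ x ∈ Icc p q, (f x).re < a) :
    Continuous fun b : ℝ => ∫ x in p..q, (a + b * Complex.I - f x).sqrt.im := by
  -- The extension by constants keeps continuity and `Re < a` on the whole line, as the lemma on
  -- parametric integrals requires.
  set g : ℝ → ℂ := IccExtend hpq ((Icc p q).domRestrict f) with hg
  have hgc : Continuous g := (continuousOn_iff_continuous_domRestrict.1 hf).Icc_extend'
  have hga : ∀ x, (g x).re < a := fun x => ha _ (projIcc p q hpq x).2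
  have hfg : ∀ b : ℝ, ∫ x in p..q, (a + b * Complex.I - f x).sqrt.im =
      ∫ x in p..q, (a + b * Complex.I - g x).sqrt.im := by
    intro b
    refine intervalIntegral.integral_congr fun x hx => ?_
    rw [uIcc_of_le hpq] at hx
    simp only [hg, IccExtend_of_mem hpq _ hx, domRestrict_apply]
  simp_rw [hfg]
  refine intervalIntegral.continuous_parametric_intervalIntegral_of_continuous' ?_ _ _
  refine Complex.continuous_im.comp ?_
  refine continuous_iff_continuousAt.2 fun y => ?_
  refine ContinuousAt.comp (g := Complex.sqrt) ?_ (by fun_prop)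
  refine Complex.continuousAt_sqrt (Or.inl ?_)
  simpa using (hga y.2).le

/-- At `b = m` the integrand is nonpositive and at `b = M` it is nonnegative. The location of `b` in
`[m, M]` is what later forces limit eigenvalues to be close to `Im V`. -/
theorem exists_actionVanishes_vertical (hpq : p ≤ q) (hf : ContinuousOn f (Icc p q))
    (ha : ∀ x ∈ Icc p q, (f x).re < a) {m M : ℝ} (hmM : m ≤ M)
    (hm : ∀ x ∈ Icc p q, m ≤ (f x).im) (hM : ∀ x ∈ Icc p q, (f x).im ≤ M) :
    ∃ b ∈ Icc m M, ActionVanishes f (a + b * Complex.I) p q := by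
  have hc := continuous_integral_csqrt_im hpq hf ha
  have h0 : (0 : ℝ) ∈ Icc (∫ x in p..q, (a + m * Complex.I - f x).sqrt.im)
      (∫ x in p..q, (a + M * Complex.I - f x).sqrt.im) := by
    constructor
    · have : (0 : ℝ) ≤ -∫ x in p..q, (a + m * Complex.I - f x).sqrt.im := by
        rw [← intervalIntegral.integral_neg]
        refine intervalIntegral.integral_nonneg hpq fun x hx => ?_
        have := csqrt_im_nonpos (z := a + m * Complex.I - f x)
          (by simpa using ha x hx) (by simpa using hm x hx)
        linarith
      linarith
    · refine intervalIntegral.integral_nonneg hpq fun x hx => ?_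
      exact csqrt_im_nonneg (by simpa using hM x hx)
  obtain ⟨b, hb, hb'⟩ := intermediate_value_Icc hmM hc.continuousOn h0
  exact ⟨b, hb, (actionVanishes_vertical_iff hpq hf ha b).2 hb'⟩

theorem existsUnique_actionVanishes_vertical (hpq : p < q) (hf : ContinuousOn f (Icc p q))
    (ha : ∀ x ∈ Icc p q, (f x).re < a) :
    ∃! b : ℝ, ActionVanishes f (a + b * Complex.I) p q := by
  obtain ⟨K, hK⟩ := isCompact_Icc.exists_bound_of_continuousOn hf
  have h1 : ∀ x ∈ Icc p q, -K ≤ (f x).im ∧ (f x).im ≤ K := fun x hx =>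
    abs_le.1 ((Complex.abs_im_le_norm _).trans (hK x hx))
  have hK0 : -K ≤ K := (h1 p (left_mem_Icc.2 hpq.le)).1.trans (h1 p (left_mem_Icc.2 hpq.le)).2
  obtain ⟨b, -, hb⟩ := exists_actionVanishes_vertical hpq.le hf ha hK0
    (fun x hx => (h1 x hx).1) (fun x hx => (h1 x hx).2)
  refine ⟨b, hb, fun b' hb' => (strictMono_integral_csqrt_im hpq hf ha).injective ?_⟩
  rw [(actionVanishes_vertical_iff hpq.le hf ha _).1 hb,
    (actionVanishes_vertical_iff hpq.le hf ha _).1 hb']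

theorem csqrt_smul_of_pos {a : ℝ} (ha : 0 < a) {z : ℂ} (hz : 0 < z.re) :
    ((a : ℂ) * z).sqrt = Real.sqrt a * z.sqrt := by
  have h1 : ((a : ℂ) * z).sqrt ^ 2 = (Real.sqrt a * z.sqrt) ^ 2 := by
    rw [csqrt_sq, mul_pow, csqrt_sq, ← Complex.ofReal_pow, Real.sq_sqrt ha.le]
  rcases sq_eq_sq_iff_eq_or_eq_neg.1 h1 with h | h
  · exact h
  · have h2 : 0 < ((a : ℂ) * z).sqrt.re := re_csqrt_pos (Or.inl (by simpa using mul_pos ha hz))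
    have h3 : 0 < z.sqrt.re := re_csqrt_pos (Or.inl hz)
    have h4 := Real.sqrt_pos.2 ha
    rw [h] at h2
    simp at h2
    nlinarith

/-- Write `a + ib - f = a (1 + w)` with `w = (ib - f) / a` and expand `√(1 + w) = 1 + w / 2 +
O(w²)`. The imaginary part of the integrated linear term is `b (q - p) - Im ∫ f`, divided by `2a`;
since `‖w‖ ≤ 2K / a`, the remainder contributes `4K² / a` after rescaling. -/
theorem abs_sub_average_le_of_actionVanishes (hpq : p < q) (hf : ContinuousOn f (Icc p q))
    {K : ℝ} (hK : ∀ x ∈ Icc p q, ‖f x‖ ≤ K) (ha : K < a) {b : ℝ}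
    (hb : ActionVanishes f (a + b * Complex.I) p q) :
    |b - (∫ x in p..q, f x).im / (q - p)| ≤ 4 * K ^ 2 / a := by
  have hK0 : 0 ≤ K := (norm_nonneg _).trans (hK p (left_mem_Icc.2 hpq.le))
  have ha0 : 0 < a := hK0.trans_lt ha
  have hare : ∀ x ∈ Icc p q, (f x).re < a := fun x hx =>
    ((Complex.re_le_norm _).trans (hK x hx)).trans_lt ha
  have h1 : ∀ x ∈ Icc p q, -K ≤ (f x).im ∧ (f x).im ≤ K := fun x hx =>
    abs_le.1 ((Complex.abs_im_le_norm _).trans (hK x hx))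
  obtain ⟨b', hb'm, hb'⟩ := exists_actionVanishes_vertical hpq.le hf hare (by linarith)
    (fun x hx => (h1 x hx).1) (fun x hx => (h1 x hx).2)
  -- Uniqueness transfers the a priori bound `|b| ≤ K` of the constructed solution to the given one.
  obtain rfl : b' = b := (existsUnique_actionVanishes_vertical hpq hf hare).unique hb' hb
  have hbK : |b'| ≤ K := abs_le.2 hb'm
  set w : ℝ → ℂ := fun x => (b' * Complex.I - f x) / a with hw
  have haC : (a : ℂ) ≠ 0 := by exact_mod_cast ha0.ne'
  have hwc : ContinuousOn w (Icc p q) := by fun_prop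
  have hwn : ∀ x ∈ Icc p q, ‖w x‖ ≤ 2 * K / a := by
    intro x hx
    rw [hw]
    simp only [norm_div, Complex.norm_real, Real.norm_eq_abs, abs_of_pos ha0]
    gcongr
    calc ‖b' * Complex.I - f x‖ ≤ ‖b' * Complex.I‖ + ‖f x‖ := norm_sub_le _ _
      _ ≤ K + K := by
        gcongr
        · simpa using hbK
        · exact hK x hx
      _ = 2 * K := by ring
  have hfac : ∀ x ∈ Icc p q, (a + b' * Complex.I - f x).sqrt = Real.sqrt a * (1 + w x).sqrt := by
    intro x hx
    have h2 : (a + b' * Complex.I - f x) = a * (1 + w x) := by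
      simp only [hw]
      field_simp
      ring
    rw [h2, csqrt_smul_of_pos ha0]
    have h3 := hare x hx
    have : 0 < a * (1 + w x).re := by
      have := congrArg Complex.re h2
      rw [Complex.re_ofReal_mul] at this
      rw [← this]
      simpa using h3
    exact pos_of_mul_pos_right this ha0.le
  have hmc : ContinuousOn (fun x => (1 + w x).sqrt) (Icc p q) := by
    have h5 : ContinuousOn (fun x => ((Real.sqrt a : ℝ) : ℂ)⁻¹ * (a + b' * Complex.I - f x).sqrt)
        (Icc p q) := continuousOn_const.mul (continuousOn_csqrt_sub hf hare b')
    refine h5.congr fun x hx => ?_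
    have : ((Real.sqrt a : ℝ) : ℂ) ≠ 0 := by exact_mod_cast (Real.sqrt_pos.2 ha0).ne'
    simp only
    rw [hfac x hx]
    field_simp
  have hii : ∀ {g : ℝ → ℂ}, ContinuousOn g (Icc p q) → IntervalIntegrable g volume p q :=
    fun hg => ContinuousOn.intervalIntegrable (by rwa [uIcc_of_le hpq.le])
  have h0 : (∫ x in p..q, (1 + w x).sqrt).im = 0 := by
    have h6 := (actionVanishes_vertical_iff hpq.le hf hare b').1 hb'
    have h7 : (∫ x in p..q, (a + b' * Complex.I - f x).sqrt.im) =
        (∫ x in p..q, (a + b' * Complex.I - f x).sqrt).im :=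
      (Complex.imCLM.intervalIntegral_comp_comm (hii (continuousOn_csqrt_sub hf hare b')))
    rw [h7, intervalIntegral_congr_Ioo hpq.le
      fun x hx => hfac x (Ioo_subset_Icc_self hx), intervalIntegral.integral_const_mul,
      Complex.im_ofReal_mul] at h6
    exact (mul_eq_zero.1 h6).resolve_left (Real.sqrt_pos.2 ha0).ne'
  have hrem : ‖∫ x in p..q, ((1 + w x).sqrt - 1 - w x / 2)‖ ≤ (2 * K / a) ^ 2 / 2 * |q - p| := by
    refine intervalIntegral.norm_integral_le_of_norm_le_const fun x hx => ?_
    rw [uIoc_of_le hpq.le] at hx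
    refine (norm_csqrt_one_add_sub_le _).trans ?_
    have := hwn x (Ioc_subset_Icc_self hx)
    gcongr
  have hsplit : ∫ x in p..q, ((1 + w x).sqrt - 1 - w x / 2) =
      (∫ x in p..q, (1 + w x).sqrt) - (q - p : ℝ) -
        (b' * Complex.I * (q - p : ℝ) - ∫ x in p..q, f x) / a / 2 := by
    rw [intervalIntegral.integral_sub, intervalIntegral.integral_sub,
      intervalIntegral.integral_div, hw, intervalIntegral.integral_div,
      intervalIntegral.integral_sub]
    · simp
      ring
    · simp
    · exact hii hf
    · exact hii hmc
    · simp
    · exact hii (hmc.sub continuousOn_const)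
    · exact hii (hwc.div_const _)
  have him := (Complex.abs_im_le_norm _).trans hrem
  rw [hsplit] at him
  simp only [Complex.sub_im, h0, Complex.ofReal_im, Complex.div_ofNat_im, Complex.div_ofReal_im,
    Complex.mul_im, Complex.mul_re, Complex.I_re, Complex.I_im, Complex.ofReal_re] at him
  rw [abs_of_pos (sub_pos.2 hpq)] at him
  have hqp := sub_pos.2 hpq
  have e1 : |b' - (∫ x in p..q, f x).im / (q - p)| =
      |b' * (q - p) - (∫ x in p..q, f x).im| / (q - p) := by
    rw [← abs_of_pos hqp, ← abs_div, abs_of_pos hqp]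
    congr 1
    field_simp
  rw [e1, div_le_iff₀ hqp]
  have e2 : |b' * (q - p) - (∫ x in p..q, f x).im| / a / 2 ≤ (2 * K / a) ^ 2 / 2 * (q - p) := by
    refine le_trans (le_of_eq ?_) him
    rw [← abs_of_pos ha0, ← abs_div, ← abs_two, ← abs_div, ← abs_neg, abs_of_pos ha0, abs_two]
    congr 1
    ring
  rw [div_div, div_le_iff₀ (by positivity)] at e2
  refine e2.trans (le_of_eq ?_)
  field_simp
  ring

end VerticalLine

/-! ### The shooting function of the Dirichlet problem -/

/-- `1 - T` is a commuting factor of the unit `1 - T ^ n`. This is the form suited to Volterra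
operators, whose powers become small although their norm need not be. -/
theorem isUnit_one_sub_of_norm_pow_lt {R : Type*} [NormedRing R] [HasSummableGeomSeries R]
    {T : R} {n : ℕ} (h : ‖T ^ n‖ < 1) : IsUnit (1 - T) := by
  have h1 : IsUnit (1 - T ^ n) := isUnit_one_sub_of_norm_lt_one h
  rw [← mul_neg_geom_sum T n] at h1
  have hc : Commute (1 - T) (∑ i ∈ Finset.range n, T ^ i) := by
    exact Commute.sum_right _ _ _ fun i _ =>
      (Commute.one_left _).sub_left (Commute.pow_right (Commute.refl T) i)
  exact (hc.isUnit_mul_iff.1 h1).1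

theorem differentiable_inverse_one_sub_apply {X : Type*} [NormedAddCommGroup X] [NormedSpace ℂ X]
    [CompleteSpace X] (A B C : X →L[ℂ] X) (c : ℂ)
    (h : ∀ E : ℂ, IsUnit (1 - A * (B - (E / c) • C))) (x : X) :
    Differentiable ℂ fun E : ℂ => Ring.inverse (1 - A * (B - (E / c) • C)) x := by
  have h1 : Differentiable ℂ fun E : ℂ => 1 - A * (B - (E / c) • C) := by
    have h0 : Differentiable ℂ fun E : ℂ => B - (E / c) • C :=
      (differentiable_const _).sub ((differentiable_id.div_const _).smul_const C)
    exact (h0.const_mul A).const_sub 1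
  intro E
  have h2 : DifferentiableAt ℂ (fun E : ℂ => Ring.inverse (1 - A * (B - (E / c) • C))) E :=
    DifferentiableAt.comp (g := Ring.inverse) E (differentiableAt_inverse (h E)) (h1 E)
  exact h2.clm_apply (differentiableAt_const x)

/-- Continuous functions on `[-1,1]`, extended to the line by constants. -/
noncomputable def extendUnit (u : C(Icc (-1 : ℝ) 1, ℂ)) : ℝ → ℂ :=
  IccExtend (by norm_num : (-1 : ℝ) ≤ 1) u

theorem continuous_extendUnit (u : C(Icc (-1 : ℝ) 1, ℂ)) : Continuous (extendUnit u) :=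
  u.continuous.Icc_extend'

theorem extendUnit_apply (u : C(Icc (-1 : ℝ) 1, ℂ)) (x : Icc (-1 : ℝ) 1) :
    extendUnit u x = u x := IccExtend_val _ _ _

theorem extendUnit_of_mem (u : C(Icc (-1 : ℝ) 1, ℂ)) {x : ℝ} (hx : x ∈ Icc (-1 : ℝ) 1) :
    extendUnit u x = u ⟨x, hx⟩ := IccExtend_of_mem _ _ hx

theorem norm_extendUnit_le (u : C(Icc (-1 : ℝ) 1, ℂ)) (x : ℝ) : ‖extendUnit u x‖ ≤ ‖u‖ :=
  u.norm_coe_le_norm _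

/-! ### Volterra operators on the continuous functions on `[-1,1]` -/

section Volterra

variable {Q : ℝ → ℂ} {K : ℝ}

theorem intervalIntegrable_mul_of_bounded
    (hQ : AEStronglyMeasurable Q (volume.restrict (Icc (-1 : ℝ) 1)))
    (hK : ∀ x ∈ Icc (-1 : ℝ) 1, ‖Q x‖ ≤ K) {g : ℝ → ℂ} (hg : ContinuousOn g (Icc (-1 : ℝ) 1))
    {p q : ℝ} (hp : p ∈ Icc (-1 : ℝ) 1) (hq : q ∈ Icc (-1 : ℝ) 1) :
    IntervalIntegrable (fun s => Q s * g s) volume p q := by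
  have h1 : IntegrableOn (fun s => Q s * g s) (Icc (-1 : ℝ) 1) :=
    Integrable.bdd_mul (hg.integrableOn_Icc) hQ
      ((ae_restrict_iff' measurableSet_Icc).2 (Eventually.of_forall hK))
  refine (intervalIntegrable_iff.2 (h1.mono_set ?_))
  exact uIoc_subset_uIcc.trans (uIcc_subset_Icc hp hq)

theorem neg_one_mem_unit : (-1 : ℝ) ∈ Icc (-1 : ℝ) 1 := by constructor <;> norm_num

theorem one_mem_unit : (1 : ℝ) ∈ Icc (-1 : ℝ) 1 := by constructor <;> norm_num

theorem norm_integral_mul_le (hK : ∀ x ∈ Icc (-1 : ℝ) 1, ‖Q x‖ ≤ K) {g : ℝ → ℂ} {c : ℝ} {n : ℕ}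
    (hg : ∀ x ∈ Icc (-1 : ℝ) 1, ‖g x‖ ≤ c * (x + 1) ^ n) {x : ℝ} (hx : x ∈ Icc (-1 : ℝ) 1) :
    ‖∫ s in (-1 : ℝ)..x, Q s * g s‖ ≤ c * K / (n + 1) * (x + 1) ^ (n + 1) := by
  have h1 : ‖∫ s in (-1 : ℝ)..x, Q s * g s‖ ≤ ∫ s in (-1 : ℝ)..x, K * (c * (s + 1) ^ n) := by
    refine intervalIntegral.norm_integral_le_of_norm_le hx.1 ?_ ?_
    · refine Eventually.of_forall fun s hs => ?_
      have hs' : s ∈ Icc (-1 : ℝ) 1 := ⟨hs.1.le, hs.2.trans hx.2⟩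
      rw [norm_mul]
      exact mul_le_mul (hK s hs') (hg s hs') (norm_nonneg _) ((norm_nonneg _).trans (hK s hs'))
    · exact Continuous.intervalIntegrable (by fun_prop) _ _
  refine h1.trans (le_of_eq ?_)
  rw [intervalIntegral.integral_const_mul, intervalIntegral.integral_const_mul,
    intervalIntegral.integral_comp_add_right (fun s => s ^ n), integral_pow]
  simp
  ring

/-- Used twice: `Q = 1` gives plain integration `J`, and `Q = W / h²` gives the potential term. With
these, the initial value problem is a fixed point equation in the Banach space `C([-1,1])`. -/
theorem exists_primitive_operator
    (hQ : AEStronglyMeasurable Q (volume.restrict (Icc (-1 : ℝ) 1)))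
    (hK : ∀ x ∈ Icc (-1 : ℝ) 1, ‖Q x‖ ≤ K) :
    ∃ T : C(Icc (-1 : ℝ) 1, ℂ) →L[ℂ] C(Icc (-1 : ℝ) 1, ℂ),
      ∀ u x, T u x = ∫ s in (-1 : ℝ)..x, Q s * extendUnit u s := by
  have hint : ∀ (u : C(Icc (-1 : ℝ) 1, ℂ)) (x : Icc (-1 : ℝ) 1),
      IntervalIntegrable (fun s => Q s * extendUnit u s) volume (-1) x := fun u x =>
    intervalIntegrable_mul_of_bounded hQ hK (continuous_extendUnit u).continuousOn
      neg_one_mem_unit x.2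
  have hcont : ∀ u : C(Icc (-1 : ℝ) 1, ℂ), Continuous fun x : Icc (-1 : ℝ) 1 =>
      ∫ s in (-1 : ℝ)..x, Q s * extendUnit u s := by
    intro u
    have h1 : IntegrableOn (fun s => Q s * extendUnit u s) (uIcc (-1 : ℝ) 1) := by
      have := hint u ⟨1, one_mem_unit⟩
      exact (intervalIntegrable_iff' (by exact enorm_ne_top)).1 this
    have h2 := intervalIntegral.continuousOn_primitive_interval h1
    rw [uIcc_of_le (by norm_num)] at h2
    exact continuousOn_iff_continuous_domRestrict.1 h2
  refine ⟨LinearMap.mkContinuous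
    { toFun := fun u => ⟨_, hcont u⟩
      map_add' := ?_
      map_smul' := ?_ } (2 * K) ?_, fun u x => rfl⟩
  · intro u v
    ext x
    simp only [ContinuousMap.coe_mk, ContinuousMap.add_apply]
    rw [← intervalIntegral.integral_add (hint u x) (hint v x)]
    refine intervalIntegral.integral_congr fun s _ => ?_
    simp [extendUnit, IccExtend, mul_add]
  · intro c u
    ext x
    simp only [ContinuousMap.coe_mk, ContinuousMap.smul_apply, RingHom.id_apply, smul_eq_mul]
    rw [← intervalIntegral.integral_const_mul]
    refine intervalIntegral.integral_congr fun s _ => ?_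
    simp [extendUnit, IccExtend]
    ring
  · intro u
    have hK0 : 0 ≤ K := (norm_nonneg _).trans (hK _ one_mem_unit)
    rw [ContinuousMap.norm_le _ (by positivity)]
    intro x
    have h := norm_integral_mul_le (n := 0) (c := ‖u‖) hK
      (fun s _ => by simpa using norm_extendUnit_le u s) x.2
    refine h.trans ?_
    have h2 := x.2.2
    have h3 := x.2.1
    have h4 : 0 ≤ K * ‖u‖ := by positivity
    norm_num
    nlinarith

/-- Each application of `J * T` integrates twice, so the `n`-th power is bounded by `Kⁿ (x + 1)²ⁿ /
(2n)!`. On `[-1,1]` this is at most `(4K)ⁿ / n!`, which tends to zero. -/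
theorem isUnit_one_sub_volterra {J T : C(Icc (-1 : ℝ) 1, ℂ) →L[ℂ] C(Icc (-1 : ℝ) 1, ℂ)}
    (hK : ∀ x ∈ Icc (-1 : ℝ) 1, ‖Q x‖ ≤ K)
    (hJ : ∀ u x, J u x = ∫ s in (-1 : ℝ)..x, extendUnit u s)
    (hT : ∀ u x, T u x = ∫ s in (-1 : ℝ)..x, Q s * extendUnit u s) :
    IsUnit (1 - J * T) := by
  have hK0 : 0 ≤ K := (norm_nonneg _).trans (hK _ one_mem_unit)
  have key : ∀ (n : ℕ) (u : C(Icc (-1 : ℝ) 1, ℂ)) (x : ℝ), x ∈ Icc (-1 : ℝ) 1 →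
      ‖extendUnit (((J * T) ^ n) u) x‖ ≤ (‖u‖ * K ^ n / (2 * n).factorial) * (x + 1) ^ (2 * n) := by
    intro n
    induction n with
    | zero => intro u x _; simpa using norm_extendUnit_le u x
    | succ n ih =>
      intro u x hx
      rw [pow_succ', mul_apply_eq_comp, mul_apply_eq_comp,
        extendUnit_of_mem _ hx, hJ]
      have h1 : ∀ y ∈ Icc (-1 : ℝ) 1, ‖extendUnit (T (((J * T) ^ n) u)) y‖ ≤
          (‖u‖ * K ^ n / (2 * n).factorial) * K / ((2 * n : ℕ) + 1) * (y + 1) ^ (2 * n + 1) := by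
        intro y hy
        rw [extendUnit_of_mem _ hy, hT]
        exact norm_integral_mul_le hK (ih u) hy
      have h2 := norm_integral_mul_le (Q := fun _ => 1) (K := 1) (by simp) h1 hx
      simp only [one_mul] at h2
      refine h2.trans (le_of_eq ?_)
      have e : (2 * (n + 1)).factorial = (2 * n + 2) * ((2 * n + 1) * (2 * n).factorial) := by
        rw [show 2 * (n + 1) = (2 * n + 1) + 1 by ring, Nat.factorial_succ, Nat.factorial_succ]
      rw [e]
      have : ((2 * n).factorial : ℝ) ≠ 0 := by positivity
      push_cast
      field_simp
      ring
  have hlim := FloorSemiring.tendsto_pow_div_factorial_atTop (4 * K)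
  obtain ⟨n, hn⟩ := (hlim.eventually (gt_mem_nhds one_pos)).exists
  refine isUnit_one_sub_of_norm_pow_lt (T := J * T) (n := n) (lt_of_le_of_lt ?_ hn)
  refine ContinuousLinearMap.opNorm_le_bound _ (by positivity) fun u => ?_
  rw [ContinuousMap.norm_le _ (by positivity)]
  intro x
  rw [← extendUnit_apply]
  refine (key n u x x.2).trans ?_
  have h0 : 0 ≤ (x : ℝ) + 1 := by linarith [x.2.1]
  have h1 : (x : ℝ) + 1 ≤ 2 := by linarith [x.2.2]
  have h2 : ((x : ℝ) + 1) ^ (2 * n) ≤ 4 ^ n := by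
    rw [pow_mul]
    exact pow_le_pow_left₀ (by positivity) (by nlinarith) n
  have h3 : ((n.factorial : ℕ) : ℝ) ≤ (2 * n).factorial := by
    exact_mod_cast Nat.factorial_le (by omega)
  calc ‖u‖ * K ^ n / (2 * n).factorial * ((x : ℝ) + 1) ^ (2 * n)
      ≤ ‖u‖ * K ^ n / n.factorial * 4 ^ n := by gcongr
    _ = (4 * K) ^ n / n.factorial * ‖u‖ := by rw [mul_pow]; ring

end Volterra

/-- Solutions of `-h² u'' + W u = E u` with `u(-1) = 0`, `u'(-1) = 1` depend holomorphically on the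
energy, and the eigenvalues are the energies where they vanish at the right end point. -/
theorem exists_shooting_solution {W : ℝ → ℂ} {M : ℝ}
    (hW : AEStronglyMeasurable W (volume.restrict (Icc (-1 : ℝ) 1)))
    (hM : ∀ x ∈ Icc (-1 : ℝ) 1, ‖W x‖ ≤ M) {h : ℝ} (hh : h ≠ 0) :
    ∃ u v : ℂ → ℝ → ℂ, (∀ E, ContinuousOn (u E) (Icc (-1) 1)) ∧
      (∀ E, ContinuousOn (v E) (Icc (-1) 1)) ∧
      (∀ E, ∀ x ∈ Icc (-1 : ℝ) 1, u E x = ∫ s in (-1 : ℝ)..x, v E s) ∧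
      (∀ E, ∀ x ∈ Icc (-1 : ℝ) 1,
        v E x = 1 + ∫ s in (-1 : ℝ)..x, (W s - E) / (h : ℂ) ^ 2 * u E s) ∧
      Differentiable ℂ (fun E => u E 1) ∧
      ∀ E, IsDirichletEigenvalue h W E ↔ u E 1 = 0 := by
  have hhC : (h : ℂ) ≠ 0 := by exact_mod_cast hh
  set Q : ℂ → ℝ → ℂ := fun E s => (W s - E) / (h : ℂ) ^ 2 with hQdef
  have hQm : ∀ E, AEStronglyMeasurable (Q E) (volume.restrict (Icc (-1 : ℝ) 1)) := fun E =>
    by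
    simp only [hQdef, div_eq_mul_inv]
    exact (hW.sub aestronglyMeasurable_const).mul_const _
  have hQb : ∀ E, ∀ x ∈ Icc (-1 : ℝ) 1, ‖Q E x‖ ≤ (M + ‖E‖) / h ^ 2 := by
    intro E x hx
    simp only [hQdef, norm_div, norm_pow, Complex.norm_real, Real.norm_eq_abs, sq_abs]
    gcongr
    exact (norm_sub_le _ _).trans (by gcongr; exact hM x hx)
  obtain ⟨J, hJ⟩ := exists_primitive_operator (Q := fun _ => 1) (K := 1)
    aestronglyMeasurable_const (by simp)
  simp only [one_mul] at hJ
  obtain ⟨T₀, hT₀⟩ := exists_primitive_operator (hQm 0) (hQb 0)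
  set T : ℂ → C(Icc (-1 : ℝ) 1, ℂ) →L[ℂ] C(Icc (-1 : ℝ) 1, ℂ) :=
    fun E => T₀ - (E / (h : ℂ) ^ 2) • J with hTdef
  have hT : ∀ E u x, T E u x = ∫ s in (-1 : ℝ)..x, Q E s * extendUnit u s := by
    intro E u x
    simp only [hTdef, _root_.sub_apply, _root_.smul_apply,
      ContinuousMap.sub_apply, ContinuousMap.smul_apply, hT₀, hJ, smul_eq_mul]
    rw [← intervalIntegral.integral_const_mul, ← intervalIntegral.integral_sub]
    · refine intervalIntegral.integral_congr fun s _ => ?_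
      simp only [hQdef]
      ring
    · exact intervalIntegrable_mul_of_bounded (hQm 0) (hQb 0)
        (continuous_extendUnit u).continuousOn neg_one_mem_unit x.2
    · exact (continuous_const.mul (continuous_extendUnit u)).intervalIntegrable _ _
  have hunit : ∀ E, IsUnit (1 - J * T E) := fun E => isUnit_one_sub_volterra (hQb E) hJ (hT E)
  -- `ℓ(x) = x + 1` solves the free equation with data `(0, 1)`, and `y E` solves the integral
  -- equation `y = ℓ + J (T E y)`. Its holomorphy in `E` comes from that of the operator inverse, `T
  -- E` being affine in `E`.
  set ℓ : C(Icc (-1 : ℝ) 1, ℂ) := J 1 with hℓ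
  set y : ℂ → C(Icc (-1 : ℝ) 1, ℂ) := fun E => Ring.inverse (1 - J * T E) ℓ with hy
  have hyeq : ∀ E, y E = ℓ + J (T E (y E)) := by
    intro E
    have h1 : (1 - J * T E) * Ring.inverse (1 - J * T E) = 1 := Ring.mul_inverse_cancel _ (hunit E)
    have h2 := congrArg (fun A => A ℓ) h1
    simp only [mul_apply_eq_comp, _root_.sub_apply,
      one_apply_eq_self] at h2
    rw [← h2]
    simp [hy]
  have huniq : ∀ (E c : ℂ) (z : C(Icc (-1 : ℝ) 1, ℂ)), z = c • ℓ + J (T E z) → z = c • y E := by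
    intro E c z hz
    have h1 : Ring.inverse (1 - J * T E) * (1 - J * T E) = 1 := Ring.inverse_mul_cancel _ (hunit E)
    have h2 := congrArg (fun A => A z) h1
    simp only [mul_apply_eq_comp, _root_.sub_apply,
      one_apply_eq_self] at h2
    rw [← h2]
    have h3 : z - J (T E z) = c • ℓ := by rw [sub_eq_iff_eq_add]; exact hz
    rw [h3, map_smul]
  have hJ1 : ∀ x, ℓ x = ∫ s in (-1 : ℝ)..x, (1 : ℂ) := by
    intro x
    rw [hℓ, hJ]
    rfl
  have hvint : ∀ E (x : Icc (-1 : ℝ) 1), y E x = ∫ s in (-1 : ℝ)..x,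
      (1 + extendUnit (T E (y E)) s) := by
    intro E x
    rw [intervalIntegral.integral_add (by simp)
      ((continuous_extendUnit _).intervalIntegrable _ _), ← hJ1, ← hJ]
    conv_lhs => rw [hyeq E]
    rfl
  refine ⟨fun E => extendUnit (y E), fun E x => 1 + extendUnit (T E (y E)) x,
    fun E => (continuous_extendUnit _).continuousOn,
    fun E => (continuous_const.add (continuous_extendUnit _)).continuousOn, ?_, ?_, ?_, ?_⟩
  · intro E x hx
    simp only
    rw [extendUnit_of_mem _ hx]
    exact hvint E ⟨x, hx⟩
  · intro E x hx
    simp only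
    rw [extendUnit_of_mem _ hx, hT]
  · have h3 : Differentiable ℂ y :=
      differentiable_inverse_one_sub_apply J T₀ J ((h : ℂ) ^ 2) hunit ℓ
    have h4 : (fun E => extendUnit (y E) 1) =
        fun E => ContinuousMap.evalCLM ℂ (⟨1, one_mem_unit⟩ : Icc (-1 : ℝ) 1) (y E) := by
      ext E
      rw [extendUnit_of_mem _ one_mem_unit]
      rfl
    rw [h4]
    exact (ContinuousLinearMap.differentiable _).comp h3
  · intro E
    constructor
    · rintro ⟨u, w, ⟨-, ⟨v, hv⟩, hu0, hu1⟩, ⟨x₀, hx₀, hne⟩, hae⟩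
      have huc : ContinuousOn u (Icc (-1) 1) := fun x hx => (hv x hx).1.continuousWithinAt
      set z : C(Icc (-1 : ℝ) 1, ℂ) := ⟨_, continuousOn_iff_continuous_domRestrict.1 huc⟩ with hz
      have hzu : ∀ x ∈ Icc (-1 : ℝ) 1, extendUnit z x = u x := fun x hx => by
        rw [extendUnit_of_mem _ hx]; rfl
      have hv2 : ∀ x ∈ Icc (-1 : ℝ) 1, v x = v (-1) + extendUnit (T E z) x := by
        intro x hx
        rw [(hv x hx).2, extendUnit_of_mem _ hx, hT]
        congr 1
        refine intervalIntegral.integral_congr_ae ?_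
        have h5 := (ae_restrict_iff' measurableSet_Icc).1 hae
        filter_upwards [h5] with s hs hs'
        rw [uIoc_of_le hx.1] at hs'
        have hs1 : s ∈ Icc (-1 : ℝ) 1 := ⟨hs'.1.le, hs'.2.trans hx.2⟩
        rw [hzu s hs1, hQdef]
        have := hs hs1
        field_simp
        linear_combination -this
      -- Integrating twice from `-1`, an eigenfunction satisfies the integral equation with source
      -- `v (-1) • ℓ`, hence equals `v (-1) • y E`; being nonzero it has `v (-1) ≠ 0`, so `y E`
      -- vanishes at `1`.
      have hz2 : z = v (-1) • ℓ + J (T E z) := by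
        ext x
        have h6 : u x = ∫ s in (-1 : ℝ)..x, v s := by
          have hsub : Icc (-1 : ℝ) x ⊆ Icc (-1) 1 := Icc_subset_Icc_right x.2.2
          have hvc : ContinuousOn v (Icc (-1) 1) :=
            (continuous_const.add (continuous_extendUnit (T E z))).continuousOn.congr hv2
          rw [intervalIntegral.integral_eq_sub_of_hasDerivAt_of_le x.2.1 (huc.mono hsub) _
            (ContinuousOn.intervalIntegrable (by rw [uIcc_of_le x.2.1]; exact hvc.mono hsub)),
            hu0, sub_zero]
          intro s hs
          exact (hv s ⟨hs.1.le, hs.2.le.trans x.2.2⟩).1.hasDerivAt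
            (Icc_mem_nhds hs.1 (hs.2.trans_le x.2.2))
        have h7 : z x = u x := rfl
        rw [h7, h6]
        simp only [ContinuousMap.add_apply, ContinuousMap.smul_apply, hJ1, hJ, smul_eq_mul]
        rw [← intervalIntegral.integral_const_mul, ← intervalIntegral.integral_add (by simp)
          ((continuous_extendUnit _).intervalIntegrable _ _)]
        refine intervalIntegral.integral_congr fun s hs => ?_
        rw [uIcc_of_le x.2.1] at hs
        simp [hv2 s ⟨hs.1, hs.2.trans x.2.2⟩]
      have hz3 := huniq E _ z hz2
      have hc : v (-1) ≠ 0 := by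
        intro h0
        rw [h0, zero_smul ℂ (y E)] at hz3
        apply hne
        rw [← hzu x₀ hx₀, hz3, extendUnit_of_mem _ hx₀]
        rfl
      have h8 : z ⟨1, one_mem_unit⟩ = 0 := hu1
      rw [hz3] at h8
      simp only
      rw [extendUnit_of_mem _ one_mem_unit]
      exact (mul_eq_zero.1 h8).resolve_left hc
    · intro h1
      -- If `y E` were zero, the integral equation would give `ℓ = 0`, but `ℓ(1) = 2`.
      have hy0 : y E ≠ 0 := by
        intro h0
        have h2 := hyeq E
        rw [h0, map_zero, map_zero, add_zero] at h2
        have h3 := congrArg (fun z => z ⟨1, one_mem_unit⟩) h2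
        simp only [hJ1] at h3
        norm_num at h3
      obtain ⟨x₀, hx₀⟩ : ∃ x, y E x ≠ 0 := by
        by_contra! h2
        exact hy0 (ContinuousMap.ext h2)
      refine ⟨extendUnit (y E), fun s => Q E s * extendUnit (y E) s, ⟨?_, ⟨fun x =>
        1 + extendUnit (T E (y E)) x, fun x hx => ⟨?_, ?_⟩⟩, ?_, h1⟩, ⟨x₀, x₀.2, ?_⟩, ?_⟩
      · refine MemLp.of_bound ((hQm E).mul (continuous_extendUnit _).aestronglyMeasurable)
          ((M + ‖E‖) / h ^ 2 * ‖y E‖) ((ae_restrict_iff' measurableSet_Icc).2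
            (Eventually.of_forall fun x hx => ?_))
        rw [norm_mul]
        exact mul_le_mul (hQb E x hx) (norm_extendUnit_le _ _) (norm_nonneg _)
          ((norm_nonneg _).trans (hQb E x hx))
      · have hcv : Continuous fun x => 1 + extendUnit (T E (y E)) x :=
          continuous_const.add (continuous_extendUnit _)
        have h4 : HasDerivAt (fun x => ∫ s in (-1 : ℝ)..x, (1 + extendUnit (T E (y E)) s))
            (1 + extendUnit (T E (y E)) x) x := hcv.integral_hasStrictDerivAt _ _ |>.hasDerivAt
        refine h4.hasDerivWithinAt.congr (fun s hs => ?_) ?_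
        · rw [extendUnit_of_mem _ hs]; exact hvint E ⟨s, hs⟩
        · rw [extendUnit_of_mem _ hx]; exact hvint E ⟨x, hx⟩
      · simp only
        rw [extendUnit_of_mem _ hx, extendUnit_of_mem _ neg_one_mem_unit, hT, hT]
        simp
      · rw [extendUnit_of_mem _ neg_one_mem_unit, hvint]
        simp
      · rwa [extendUnit_apply]
      · refine Eventually.of_forall fun x => ?_
        simp only [hQdef]
        field_simp
        ring

/-! ### Linear differential equations on convex domains -/

/-- Along the segment from `p` to `z` the derivative is dominated by that of an explicit power. The
gain `1 / (n + 1)` produces the factorials in the Picard iteration. -/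
theorem norm_primitive_le {F : Type*} [NormedAddCommGroup F] [NormedSpace ℂ F]
    {N : Set ℂ} (hN : Convex ℝ N) {p : ℂ} (hp : p ∈ N) {f g : ℂ → F} (hgp : g p = 0)
    (hg : ∀ z ∈ N, HasDerivAt g (f z) z) {c : ℝ} {n : ℕ}
    (hf : ∀ z ∈ N, ‖f z‖ ≤ c * ‖z - p‖ ^ n) {z : ℂ} (hz : z ∈ N) :
    ‖g z‖ ≤ c / (n + 1) * ‖z - p‖ ^ (n + 1) := by
  let _ : NormedSpace ℝ F := .restrictScalars ℝ ℂ F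
  set γ : ℝ → ℂ := fun t => p + t * (z - p) with hγ
  have hγN : ∀ t ∈ Icc (0 : ℝ) 1, γ t ∈ N := by
    intro t ht
    have := hN hp hz (sub_nonneg.2 ht.2) ht.1 (by ring)
    convert this using 1
    simp only [hγ, Complex.real_smul]
    push_cast
    ring
  have hγd : ∀ t, HasDerivAt γ (z - p) t := fun t => by
    have := ((Complex.ofRealCLM.hasDerivAt (x := t)).mul_const (z - p)).const_add p
    simpa [hγ] using this
  have hd : ∀ t ∈ Icc (0 : ℝ) 1, HasDerivAt (g ∘ γ) ((z - p) • f (γ t)) t := fun t ht =>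
    (hg _ (hγN t ht)).scomp t (hγd t)
  have key := image_norm_le_of_norm_deriv_right_le_deriv_boundary (f := g ∘ γ)
    (f' := fun t => (z - p) • f (γ t)) (a := 0) (b := 1)
    (B := fun t => c * ‖z - p‖ ^ (n + 1) * (t ^ (n + 1) / (n + 1)))
    (B' := fun t => c * ‖z - p‖ ^ (n + 1) * t ^ n)
    (fun t ht => (hd t ht).continuousAt.continuousWithinAt)
    (fun t ht => (hd t ⟨ht.1, ht.2.le⟩).hasDerivWithinAt) (by simp [hγ, hgp])
    (fun t => by
      have := ((hasDerivAt_pow (n + 1) t).div_const ((n : ℝ) + 1)).const_mul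
        (c * ‖z - p‖ ^ (n + 1))
      refine this.congr_deriv ?_
      have : (n : ℝ) + 1 ≠ 0 := by positivity
      push_cast
      field_simp)
    (fun t ht => by
      rw [norm_smul]
      have h1 := hf _ (hγN t ⟨ht.1, ht.2.le⟩)
      have h2 : ‖γ t - p‖ = t * ‖z - p‖ := by
        simp [hγ, abs_of_nonneg ht.1]
      rw [h2] at h1
      calc ‖z - p‖ * ‖f (γ t)‖ ≤ ‖z - p‖ * (c * (t * ‖z - p‖) ^ n) := by gcongr
        _ = _ := by rw [mul_pow]; ring)
    (right_mem_Icc.2 zero_le_one)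
  have e : γ 1 = z := by simp [hγ]
  simp only [Function.comp, e, one_pow] at key
  refine key.trans (le_of_eq ?_)
  ring

/-- Picard iteration for the first order system in `(F, G)`: primitives exist because `N` is convex,
and the iterates are bounded by `C (K' L)ⁿ / n!`, so the series can be differentiated termwise. -/
theorem exists_holomorphic_solution {N : Set ℂ} (hN : Convex ℝ N) (hNo : IsOpen N) {p : ℂ}
    (hp : p ∈ N) {Q : ℂ → ℂ} (hQ : DifferentiableOn ℂ Q N) {K L : ℝ} (hK : ∀ z ∈ N, ‖Q z‖ ≤ K)
    (hL : ∀ z ∈ N, ‖z - p‖ ≤ L) (u₀ v₀ : ℂ) :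
    ∃ F G : ℂ → ℂ, F p = u₀ ∧ G p = v₀ ∧
      ∀ z ∈ N, HasDerivAt F (G z) z ∧ HasDerivAt G (Q z * F z) z := by
  set B : ℂ → ℂ × ℂ →L[ℂ] ℂ × ℂ := fun z =>
    (ContinuousLinearMap.snd ℂ ℂ ℂ).prod (Q z • ContinuousLinearMap.fst ℂ ℂ ℂ) with hB
  set K' := max 1 K with hK'
  have hK'0 : 0 ≤ K' := zero_le_one.trans (le_max_left _ _)
  have hL0 : 0 ≤ L := (norm_nonneg _).trans (hL p hp)
  have hBn : ∀ z ∈ N, ∀ y, ‖B z y‖ ≤ K' * ‖y‖ := by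
    intro z hz y
    have h1 : B z y = (y.2, Q z * y.1) := rfl
    rw [h1, Prod.norm_def, max_le_iff]
    constructor
    · calc ‖y.2‖ ≤ 1 * ‖y‖ := by rw [one_mul]; exact norm_snd_le y
        _ ≤ K' * ‖y‖ := by gcongr; exact le_max_left _ _
    · rw [norm_mul]
      exact mul_le_mul ((hK z hz).trans (le_max_right _ _)) (norm_fst_le y) (norm_nonneg _) hK'0
  have hprim : ∀ f : {f : ℂ → ℂ × ℂ // DifferentiableOn ℂ f N},
      ∃ g : {f : ℂ → ℂ × ℂ // DifferentiableOn ℂ f N}, g.1 p = 0 ∧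
        ∀ z ∈ N, HasDerivAt g.1 (B z (f.1 z)) z := by
    rintro ⟨f, hf⟩
    have hBf : DifferentiableOn ℂ (fun z => B z (f z)) N :=
      hf.snd.prodMk (hQ.mul hf.fst)
    obtain ⟨g, hg⟩ := hN.exists_forall_hasDerivWithinAt hBf
    have hg' : ∀ z ∈ N, HasDerivAt (fun z => g z - g p) (B z (f z)) z := fun z hz =>
      ((hg z hz).hasDerivAt (hNo.mem_nhds hz)).sub_const _
    exact ⟨⟨fun z => g z - g p, fun z hz => (hg' z hz).differentiableAt.differentiableWithinAt⟩,
      by simp, hg'⟩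
  choose I hI0 hI using hprim
  set Y : ℕ → {f : ℂ → ℂ × ℂ // DifferentiableOn ℂ f N} := fun n =>
    n.rec ⟨fun _ => (u₀, v₀), differentiableOn_const _⟩ (fun _ f => I f) with hY
  have hYs : ∀ n, Y (n + 1) = I (Y n) := fun n => rfl
  set C := ‖((u₀, v₀) : ℂ × ℂ)‖ with hC
  have hbound : ∀ n, ∀ z ∈ N, ‖(Y n).1 z‖ ≤ C * K' ^ n / n.factorial * ‖z - p‖ ^ n := by
    intro n
    induction n with
    | zero => intro z _; simp [hY, hC]
    | succ n ih =>
      intro z hz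
      rw [hYs]
      have h1 := norm_primitive_le hN hp (hI0 (Y n)) (hI (Y n))
        (c := K' * (C * K' ^ n / n.factorial)) (n := n) (fun w hw => by
          refine (hBn w hw _).trans ?_
          rw [mul_assoc]
          gcongr
          exact ih w hw) hz
      refine h1.trans (le_of_eq ?_)
      rw [Nat.factorial_succ, pow_succ K']
      have : (n.factorial : ℝ) ≠ 0 := by positivity
      push_cast
      field_simp
  have hboundL : ∀ n, ∀ z ∈ N, ‖(Y n).1 z‖ ≤ C * ((K' * L) ^ n / n.factorial) := by
    intro n z hz
    refine (hbound n z hz).trans ?_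
    calc C * K' ^ n / n.factorial * ‖z - p‖ ^ n ≤ C * K' ^ n / n.factorial * L ^ n := by
          gcongr
          exact hL z hz
      _ = _ := by rw [mul_pow]; ring
  have hsum : Summable fun n : ℕ => C * ((K' * L) ^ n / n.factorial) :=
    (Real.summable_pow_div_factorial _).mul_left _
  have hYsum : ∀ z ∈ N, Summable fun n => (Y n).1 z := fun z hz =>
    Summable.of_norm_bounded hsum fun n => hboundL n z hz
  -- Splitting off the constant zeroth iterate makes the derivative of the remaining series `∑ B (Y
  -- n)`, that is, `B` applied to the full sum.
  set S : ℂ → ℂ × ℂ := fun z => (u₀, v₀) + ∑' n, (Y (n + 1)).1 z with hS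
  have hSY : ∀ z ∈ N, S z = ∑' n, (Y n).1 z := fun z hz =>
    ((hYsum z hz).tsum_eq_zero_add).symm
  have hSd : ∀ z ∈ N, HasDerivAt S (B z (S z)) z := by
    intro z hz
    have h1 := hasDerivAt_tsum_of_isPreconnected (g := fun n => (Y (n + 1)).1)
      (g' := fun n z => B z ((Y n).1 z)) (u := fun n => K' * (C * ((K' * L) ^ n / n.factorial)))
      (hsum.mul_left _) hNo hN.isPreconnected (fun n y hy => by rw [hYs]; exact hI (Y n) y hy)
      (fun n y hy => (hBn y hy _).trans (by gcongr; exact hboundL n y hy)) hp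
      (by simp only [hYs, hI0]; exact summable_zero) hz
    rw [hSY z hz, (B z).map_tsum (hYsum z hz)]
    exact h1.const_add _
  have hSp : S p = (u₀, v₀) := by
    simp only [hS, hYs, hI0, tsum_zero, add_zero]
  refine ⟨fun z => (S z).1, fun z => (S z).2, by simp only [hSp], by simp only [hSp], fun z hz => ⟨?_, ?_⟩⟩
  · exact (hSd z hz).fst
  · exact (hSd z hz).snd

/-! ### Exact WKB transfer along a canonical curve -/

/-- Variation of constants: `exp (-κ t) φ` has derivative `exp (-κ t) e`, bounded by `η exp ((μ - Re
κ) τ)` because `Re κ ≤ μ`. -/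
theorem norm_sub_exp_mul_le {φ e : ℝ → ℂ} {κ : ℂ} {μ η τ : ℝ} (hκ : |κ.re| ≤ μ) (hη : 0 ≤ η)
    (hτ : 0 ≤ τ) (hφ : ∀ t ∈ Icc 0 τ, HasDerivAt φ (κ * φ t + e t) t)
    (he : ∀ t ∈ Icc 0 τ, ‖e t‖ ≤ η * Real.exp (μ * t)) :
    ‖φ τ - Complex.exp (κ * τ) * φ 0‖ ≤ η * Real.exp (μ * τ) * τ := by
  set ψ : ℝ → ℂ := fun t => Complex.exp (-κ * t) * φ t with hψ
  have hexp : ∀ t : ℝ, HasDerivAt (fun t : ℝ => Complex.exp (-κ * t))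
      (Complex.exp (-κ * t) * (-κ)) t := fun t => by
    have h1 : HasDerivAt (fun t : ℝ => -κ * (t : ℂ)) (-κ) t := by
      simpa using (Complex.ofRealCLM.hasDerivAt (x := t)).const_mul (-κ)
    exact h1.cexp
  have hd : ∀ t ∈ Icc 0 τ, HasDerivAt ψ (Complex.exp (-κ * t) * e t) t := fun t ht =>
    ((hexp t).mul (hφ t ht)).congr_deriv (by ring)
  have hk : κ.re ≤ μ := (le_abs_self _).trans hκ
  have h1 := norm_image_sub_le_of_norm_deriv_le_segment' (f := ψ) (a := 0) (b := τ)
    (C := η * Real.exp ((μ - κ.re) * τ)) (fun t ht => (hd t ht).hasDerivWithinAt)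
    (fun t ht => by
      rw [norm_mul, Complex.norm_exp]
      have h2 := he t ⟨ht.1, ht.2.le⟩
      have h3 : (-κ * (t : ℂ)).re = -κ.re * t := by simp
      rw [h3]
      calc Real.exp (-κ.re * t) * ‖e t‖ ≤ Real.exp (-κ.re * t) * (η * Real.exp (μ * t)) := by gcongr
        _ = η * Real.exp ((μ - κ.re) * t) := by
          rw [mul_left_comm, ← Real.exp_add]
          ring_nf
        _ ≤ η * Real.exp ((μ - κ.re) * τ) := by
          have : 0 ≤ μ - κ.re := sub_nonneg.2 hk
          have := ht.2.le
          gcongr) τ ⟨hτ, le_rfl⟩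
  have h4 : φ τ - Complex.exp (κ * τ) * φ 0 = Complex.exp (κ * τ) * (ψ τ - ψ 0) := by
    simp only [hψ, mul_sub, ← mul_assoc, ← Complex.exp_add]
    simp
  have h5 : (κ * (τ : ℂ)).re = κ.re * τ := by simp
  rw [h4, norm_mul, Complex.norm_exp, h5]
  calc Real.exp (κ.re * τ) * ‖ψ τ - ψ 0‖
      ≤ Real.exp (κ.re * τ) * (η * Real.exp ((μ - κ.re) * τ) * (τ - 0)) := by gcongr
    _ = η * (Real.exp (κ.re * τ) * Real.exp ((μ - κ.re) * τ)) * τ := by ring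
    _ = η * Real.exp (μ * τ) * τ := by
      rw [← Real.exp_add]
      ring_nf

/-- Neither mode grows faster than `exp (|Re κ| t)`. Let `m` be the maximum of the total amplitude
weighted by the inverse of this factor; variation of constants at the maximum point gives `m ≤ ‖α 0‖
+ ‖β 0‖ + 2 ε m`, and `ε ≤ 1 / 4` absorbs the last term. -/
theorem norm_sub_exp_mul_le_of_coupled {α β e : ℝ → ℂ} {κ : ℂ} {ε : ℝ} (hε : 0 ≤ ε)
    (hε' : ε ≤ 1 / 4)
    (hα : ∀ t ∈ Icc (0 : ℝ) 1, HasDerivAt α (κ * α t + e t) t)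
    (hβ : ∀ t ∈ Icc (0 : ℝ) 1, HasDerivAt β (-κ * β t + -e t) t)
    (he : ∀ t ∈ Icc (0 : ℝ) 1, ‖e t‖ ≤ ε * (‖α t‖ + ‖β t‖)) :
    ‖α 1 - Complex.exp κ * α 0‖ ≤ 2 * ε * Real.exp |κ.re| * (‖α 0‖ + ‖β 0‖) ∧
    ‖β 1 - Complex.exp (-κ) * β 0‖ ≤ 2 * ε * Real.exp |κ.re| * (‖α 0‖ + ‖β 0‖) := by
  set μ := |κ.re| with hμ
  set y : ℝ → ℝ := fun t => Real.exp (-μ * t) * (‖α t‖ + ‖β t‖) with hy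
  have hαc : ContinuousOn α (Icc 0 1) := fun t ht => (hα t ht).continuousAt.continuousWithinAt
  have hβc : ContinuousOn β (Icc 0 1) := fun t ht => (hβ t ht).continuousAt.continuousWithinAt
  have hyc : ContinuousOn y (Icc 0 1) := by fun_prop
  obtain ⟨τ, hτ, hmax⟩ := isCompact_Icc.exists_isMaxOn (nonempty_Icc.2 zero_le_one) hyc
  set m := y τ with hm
  have hm0 : 0 ≤ m := by positivity
  have hyle : ∀ t ∈ Icc (0 : ℝ) 1, ‖α t‖ + ‖β t‖ ≤ m * Real.exp (μ * t) := by
    intro t ht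
    have h1 : y t ≤ m := hmax ht
    have h2 : ‖α t‖ + ‖β t‖ = y t * Real.exp (μ * t) := by
      simp only [hy]
      rw [mul_right_comm, ← Real.exp_add]
      simp
    rw [h2]
    gcongr
  have he' : ∀ t ∈ Icc (0 : ℝ) 1, ‖e t‖ ≤ ε * m * Real.exp (μ * t) := by
    intro t ht
    rw [mul_assoc]
    exact (he t ht).trans (by gcongr; exact hyle t ht)
  have key : ∀ t ∈ Icc (0 : ℝ) 1,
      ‖α t - Complex.exp (κ * t) * α 0‖ ≤ ε * m * Real.exp (μ * t) ∧
      ‖β t - Complex.exp (-κ * t) * β 0‖ ≤ ε * m * Real.exp (μ * t) := by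
    intro t ht
    have hsub : ∀ s ∈ Icc 0 t, s ∈ Icc (0 : ℝ) 1 := fun s hs => ⟨hs.1, hs.2.trans ht.2⟩
    have hpos : 0 ≤ ε * m * Real.exp (μ * t) := by positivity
    constructor
    · exact (norm_sub_exp_mul_le (le_of_eq hμ.symm) (by positivity) ht.1
        (fun s hs => hα s (hsub s hs)) (fun s hs => he' s (hsub s hs))).trans
        (mul_le_of_le_one_right hpos ht.2)
    · exact (norm_sub_exp_mul_le (μ := μ) (e := fun t => -e t) (by simp [hμ])
        (by positivity) ht.1 (fun s hs => hβ s (hsub s hs))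
        (fun s hs => by rw [norm_neg]; exact he' s (hsub s hs))).trans
        (mul_le_of_le_one_right hpos ht.2)
  have hmle : m ≤ 2 * (‖α 0‖ + ‖β 0‖) := by
    obtain ⟨h1, h2⟩ := key τ hτ
    have hb : ∀ k : ℂ, |k.re| ≤ μ → ‖Complex.exp (k * τ)‖ ≤ Real.exp (μ * τ) := by
      intro k hk
      rw [Complex.norm_exp]
      have : (k * (τ : ℂ)).re = k.re * τ := by simp
      rw [this]
      have := (le_abs_self _).trans hk
      have := hτ.1
      gcongr
    have h3 : ‖α τ‖ ≤ Real.exp (μ * τ) * ‖α 0‖ + ε * m * Real.exp (μ * τ) := by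
      calc ‖α τ‖ = ‖Complex.exp (κ * τ) * α 0 + (α τ - Complex.exp (κ * τ) * α 0)‖ := by
            congr 1; ring
        _ ≤ _ := (norm_add_le _ _).trans (by
            rw [norm_mul]
            gcongr
            exact hb κ le_rfl)
    have h4 : ‖β τ‖ ≤ Real.exp (μ * τ) * ‖β 0‖ + ε * m * Real.exp (μ * τ) := by
      calc ‖β τ‖ = ‖Complex.exp (-κ * τ) * β 0 + (β τ - Complex.exp (-κ * τ) * β 0)‖ := by
            congr 1; ring
        _ ≤ _ := (norm_add_le _ _).trans (by
            rw [norm_mul]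
            gcongr
            exact hb (-κ) (by simp [hμ]))
    have h5 : m ≤ (‖α 0‖ + ‖β 0‖) + 2 * ε * m := by
      have e1 : Real.exp (-μ * τ) * Real.exp (μ * τ) = 1 := by rw [← Real.exp_add]; simp
      calc m = Real.exp (-μ * τ) * (‖α τ‖ + ‖β τ‖) := rfl
        _ ≤ Real.exp (-μ * τ) * ((Real.exp (μ * τ) * ‖α 0‖ + ε * m * Real.exp (μ * τ)) +
            (Real.exp (μ * τ) * ‖β 0‖ + ε * m * Real.exp (μ * τ))) := by gcongr
        _ = (Real.exp (-μ * τ) * Real.exp (μ * τ)) * ((‖α 0‖ + ‖β 0‖) + 2 * ε * m) := by ring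
        _ = _ := by rw [e1, one_mul]
    nlinarith
  obtain ⟨h1, h2⟩ := key 1 (right_mem_Icc.2 zero_le_one)
  simp only [Complex.ofReal_one, mul_one] at h1 h2
  have h3 : ε * m * Real.exp μ ≤ 2 * ε * Real.exp μ * (‖α 0‖ + ‖β 0‖) := by
    calc ε * m * Real.exp μ ≤ ε * (2 * (‖α 0‖ + ‖β 0‖)) * Real.exp μ := by gcongr
      _ = _ := by ring
  exact ⟨h1.trans h3, h2.trans h3⟩

/-- A curve along which a function close to the identity moves on a straight line. -/
theorem exists_path_of_deriv_near_one {N : Set ℂ} (hN : Convex ℝ N) (hNo : IsOpen N) {f g : ℂ → ℂ}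
    (hf : ∀ z ∈ N, HasDerivAt f (g z) z) {θ : ℝ} (hθ0 : 0 ≤ θ) (hθ : θ ≤ 1 / 2)
    (hg : ∀ z ∈ N, ‖g z - 1‖ ≤ θ) {p q : ℂ} {ρ : ℝ} (hρ : 0 ≤ ρ)
    (hball : ∀ t ∈ Icc (0 : ℝ) 1, Metric.closedBall (p + t * (q - p)) ρ ⊆ N)
    (hθρ : 4 * θ * ‖q - p‖ ≤ ρ) (hfp : f p = 0) :
    ∃ z : ℝ → ℂ, z 0 = p ∧ z 1 = q ∧
      ∀ t ∈ Icc (0 : ℝ) 1, z t ∈ N ∧ HasDerivAt z (f q / g (z t)) t := by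
  lift θ to NNReal using hθ0
  have hmem : ∀ t ∈ Icc (0 : ℝ) 1, p + t * (q - p) ∈ N := fun t ht =>
    hball t ht (Metric.mem_closedBall_self hρ)
  have hp : p ∈ N := by simpa using hmem 0 (left_mem_Icc.2 zero_le_one)
  have hq : q ∈ N := by simpa using hmem 1 (right_mem_Icc.2 zero_le_one)
  have hlip : ∀ x ∈ N, ∀ y ∈ N, ‖f x - f y - (x - y)‖ ≤ θ * ‖x - y‖ := by
    intro x hx y hy
    have h1 := hN.norm_image_sub_le_of_norm_hasDerivWithin_le (f := fun z => f z - z)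
      (f' := fun z => g z - 1) (C := θ)
      (fun z hz => ((hf z hz).sub (hasDerivAt_id z)).hasDerivWithinAt) hg hy hx
    rwa [show f x - f y - (x - y) = f x - x - (f y - y) by ring]
  have happ : ApproximatesLinearOn f
      ((ContinuousLinearEquiv.refl ℂ ℂ : ℂ ≃L[ℂ] ℂ) : ℂ →L[ℂ] ℂ) N θ := fun x hx y hy =>
    hlip x hx y hy
  have hN1 : ‖((ContinuousLinearEquiv.refl ℂ ℂ : ℂ ≃L[ℂ] ℂ).symm : ℂ →L[ℂ] ℂ)‖₊ = 1 := by
    have : ((ContinuousLinearEquiv.refl ℂ ℂ : ℂ ≃L[ℂ] ℂ).symm : ℂ →L[ℂ] ℂ) =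
        ContinuousLinearMap.id ℂ ℂ := rfl
    rw [this]
    exact ContinuousLinearMap.nnnorm_id
  have hθ1 : θ < 1 := by
    rw [← NNReal.coe_lt_coe]
    push_cast
    linarith
  have hc : Subsingleton ℂ ∨
      θ < ‖((ContinuousLinearEquiv.refl ℂ ℂ : ℂ ≃L[ℂ] ℂ).symm : ℂ →L[ℂ] ℂ)‖₊⁻¹ := by
    right
    rwa [hN1, inv_one]
  -- As `f - id` is a contraction, `f` is invertible onto an open set; the curve is the preimage of
  -- the segment from `0` to `f q`.
  set e := happ.toOpenPartialHomeomorph f N hc hNo with he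
  have hsymm : ∀ x ∈ N, e.symm (f x) = x := fun x hx => e.left_inv hx
  have htarget : ∀ t ∈ Icc (0 : ℝ) 1, (t : ℂ) * f q ∈ e.target := by
    intro t ht
    -- The image of the `ρ`-ball about `p + t (q - p)` contains a ball of radius `(1 - θ) ρ ≥ ρ / 2`
    -- about its image. The point `t f(q)` is within `2 θ ‖q - p‖ ≤ ρ / 2` of that centre.
    refine happ.closedBall_subset_target hc hNo hρ (hball t ht) ?_
    rw [hN1, inv_one, Metric.mem_closedBall, dist_eq_norm]
    have h1 := hlip _ (hmem t ht) p hp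
    have h2 := hlip q hq p hp
    rw [hfp, sub_zero] at h1 h2
    have e1 : (t : ℂ) * f q - f (p + t * (q - p)) =
        t * (f q - (q - p)) - (f (p + t * (q - p)) - (p + t * (q - p) - p)) := by ring
    have e2 : ‖p + t * (q - p) - p‖ = t * ‖q - p‖ := by
      simp [abs_of_nonneg ht.1]
    rw [e2] at h1
    have hnn : 0 ≤ θ * ‖q - p‖ := by positivity
    have h3 : ‖(t : ℂ) * (f q - (q - p))‖ ≤ θ * ‖q - p‖ := by
      rw [norm_mul, Complex.norm_real, Real.norm_eq_abs, abs_of_nonneg ht.1]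
      exact (mul_le_of_le_one_left (norm_nonneg _) ht.2).trans h2
    have h4 : ‖f (p + t * (q - p)) - (p + t * (q - p) - p)‖ ≤ θ * ‖q - p‖ :=
      h1.trans (by gcongr; exact mul_le_of_le_one_left (norm_nonneg _) ht.2)
    rw [e1]
    refine (norm_sub_le _ _).trans ((add_le_add h3 h4).trans ?_)
    simp only [NNReal.coe_one]
    nlinarith
  refine ⟨fun t => e.symm (t * f q), ?_, ?_, fun t ht => ⟨e.map_target (htarget t ht), ?_⟩⟩
  · simp only [Complex.ofReal_zero, zero_mul]
    rw [← hfp, hsymm p hp]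
  · simp only [Complex.ofReal_one, one_mul]
    exact hsymm q hq
  · have hz : e.symm (t * f q) ∈ N := e.map_target (htarget t ht)
    have hg0 : g (e.symm (t * f q)) ≠ 0 := by
      intro h0
      have := hg _ hz
      rw [h0] at this
      simp at this
      have h2 : (1 : ℝ) ≤ θ := by exact_mod_cast this
      linarith
    have h1 := e.hasDerivAt_symm (htarget t ht) hg0 (hf _ hz)
    have h2 : HasDerivAt (fun t : ℝ => (t : ℂ) * f q) (f q) t := by
      simpa using (Complex.ofRealCLM.hasDerivAt (x := t)).mul_const (f q)
    have h3 := h1.scomp t h2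
    refine h3.congr_deriv ?_
    rw [smul_eq_mul, div_eq_mul_inv]

/-- The coefficient of the growing WKB solution `r⁻¹ e^{l ∫ r²}` in the solution with Cauchy data
`(u, v)`, where `r'` is the derivative of `r`. -/
noncomputable def wkbPlus (l r r' u v : ℂ) : ℂ := (r * u + (r' * u / r ^ 2 + v / r) / l) / 2

/-- The coefficient of the WKB solution `r⁻¹ e^{-l ∫ r²}` in the solution with Cauchy data
`(u, v)`. -/
noncomputable def wkbMinus (l r r' u v : ℂ) : ℂ := (r * u - (r' * u / r ^ 2 + v / r) / l) / 2

/-- Gronwall uniqueness. It identifies a solution given on a real interval with the restriction of a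
holomorphic one, so that the path between the end points can be deformed. -/
theorem eqOn_of_linear_ode {p q K : ℝ} {Q u v F G : ℝ → ℂ} (hK : ∀ x ∈ Icc p q, ‖Q x‖ ≤ K)
    (hu : ∀ x ∈ Icc p q, HasDerivWithinAt u (v x) (Icc p q) x)
    (hv : ∀ x ∈ Icc p q, HasDerivWithinAt v (Q x * u x) (Icc p q) x)
    (hF : ∀ x ∈ Icc p q, HasDerivWithinAt F (G x) (Icc p q) x)
    (hG : ∀ x ∈ Icc p q, HasDerivWithinAt G (Q x * F x) (Icc p q) x)
    (h0 : u p = F p) (h1 : v p = G p) : ∀ x ∈ Icc p q, u x = F x ∧ v x = G x := by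
  set f : ℝ → ℂ × ℂ := fun x => (u x - F x, v x - G x) with hf
  have hd : ∀ x ∈ Icc p q, HasDerivWithinAt f (v x - G x, Q x * u x - Q x * F x) (Icc p q) x :=
    fun x hx => ((hu x hx).sub (hF x hx)).prodMk ((hv x hx).sub (hG x hx))
  intro x hx
  have hpq : p ≤ q := hx.1.trans hx.2
  have hK0 : 0 ≤ K := (norm_nonneg _).trans (hK x hx)
  have key := norm_le_gronwallBound_of_norm_deriv_right_le (f := f)
    (f' := fun x => (v x - G x, Q x * u x - Q x * F x)) (δ := 0) (K := max 1 K) (ε := 0)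
    (a := p) (b := q) (fun x hx => (hd x hx).continuousWithinAt)
    (fun x hx => (hd x ⟨hx.1, hx.2.le⟩).mono_of_mem_nhdsWithin
      (Icc_mem_nhdsGE_of_mem hx)) (by simp [hf, h0, h1])
    (fun x hx => by
      rw [add_zero, Prod.norm_def, max_le_iff]
      constructor
      · calc ‖v x - G x‖ ≤ 1 * ‖f x‖ := by rw [one_mul]; exact norm_snd_le (f x)
          _ ≤ _ := by gcongr; exact le_max_left _ _
      · rw [← mul_sub, norm_mul]
        exact mul_le_mul ((hK x ⟨hx.1, hx.2.le⟩).trans (le_max_right _ _)) (norm_fst_le (f x))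
          (norm_nonneg _) (hK0.trans (le_max_right _ _))) x hx
  rw [gronwallBound_ε0_δ0, norm_le_zero_iff] at key
  have h2 := congrArg Prod.fst key
  have h3 := congrArg Prod.snd key
  exact ⟨sub_eq_zero.1 h2, sub_eq_zero.1 h3⟩

/-- Exact WKB transfer of a solution of `u'' = l² r⁴ u` from `p` to `q`. -/
theorem wkb_transfer {N : Set ℂ} (hN : Convex ℝ N) (hNo : IsOpen N) {r r₁ r₂ : ℂ → ℂ}
    (hr : ∀ z ∈ N, HasDerivAt r (r₁ z) z) (hr₁ : ∀ z ∈ N, HasDerivAt r₁ (r₂ z) z)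
    {p q ρ θ B L T : ℝ} (hpq : p ≤ q) (hρ : 0 ≤ ρ)
    (hball : ∀ x ∈ Icc p q, Metric.closedBall (x : ℂ) ρ ⊆ N) (hL : ∀ z ∈ N, ‖z - p‖ ≤ L)
    (hθ0 : 0 ≤ θ) (hθ : θ ≤ 1 / 2) (hθρ : 4 * θ * (q - p) ≤ ρ)
    (hrθ : ∀ z ∈ N, ‖r z ^ 2 - 1‖ ≤ θ) (hB : ∀ z ∈ N, ‖r z‖ ≤ B)
    (hT : ∀ z ∈ N, ‖r₂ z / r z ^ 5 - 2 * r₁ z ^ 2 / r z ^ 6‖ ≤ T)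
    {l : ℂ} (hl : l ≠ 0) {c : ℂ} (hc : c = ∫ x in p..q, r x ^ 2) {ε : ℝ}
    (hε : ‖c‖ * T / (2 * ‖l‖) ≤ ε) (hε' : ε ≤ 1 / 4) {u v : ℝ → ℂ}
    (hu : ∀ x ∈ Icc p q, HasDerivWithinAt u (v x) (Icc p q) x)
    (hv : ∀ x ∈ Icc p q, HasDerivWithinAt v (l ^ 2 * r x ^ 4 * u x) (Icc p q) x) :
    ‖wkbPlus l (r q) (r₁ q) (u q) (v q) -
        Complex.exp (l * c) * wkbPlus l (r p) (r₁ p) (u p) (v p)‖ ≤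
      2 * ε * Real.exp |(l * c).re| *
        (‖wkbPlus l (r p) (r₁ p) (u p) (v p)‖ + ‖wkbMinus l (r p) (r₁ p) (u p) (v p)‖) ∧
    ‖wkbMinus l (r q) (r₁ q) (u q) (v q) -
        Complex.exp (-(l * c)) * wkbMinus l (r p) (r₁ p) (u p) (v p)‖ ≤
      2 * ε * Real.exp |(l * c).re| *
        (‖wkbPlus l (r p) (r₁ p) (u p) (v p)‖ + ‖wkbMinus l (r p) (r₁ p) (u p) (v p)‖) := by
  have hxN : ∀ x ∈ Icc p q, (x : ℂ) ∈ N := fun x hx => hball x hx (Metric.mem_closedBall_self hρ)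
  have hpN := hxN p (left_mem_Icc.2 hpq)
  have hr0 : ∀ z ∈ N, r z ≠ 0 := by
    intro z hz h0
    have := hrθ z hz
    rw [h0] at this
    norm_num at this
    linarith
  have hB0 : 0 ≤ B := (norm_nonneg _).trans (hB p hpN)
  have hT0 : 0 ≤ T := (norm_nonneg _).trans (hT p hpN)
  have hε0 : 0 ≤ ε := le_trans (by positivity) hε
  have hrd : DifferentiableOn ℂ r N := fun z hz => (hr z hz).differentiableAt.differentiableWithinAt
  have hQb : ∀ z ∈ N, ‖l ^ 2 * r z ^ 4‖ ≤ ‖l‖ ^ 2 * B ^ 4 := by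
    intro z hz
    rw [norm_mul, norm_pow, norm_pow]
    gcongr
    exact hB z hz
  obtain ⟨F, G, hFp, hGp, hFG⟩ := exists_holomorphic_solution hN hNo hpN
    (Q := fun z => l ^ 2 * r z ^ 4) ((hrd.pow 4).const_mul _) hQb hL (u p) (v p)
  have heq := eqOn_of_linear_ode (F := fun x : ℝ => F x) (G := fun x : ℝ => G x)
    (Q := fun x : ℝ => l ^ 2 * r x ^ 4)
    (fun x hx => hQb x (hxN x hx)) hu hv
    (fun x hx => (hFG x (hxN x hx)).1.comp_ofReal.hasDerivWithinAt)
    (fun x hx => (hFG x (hxN x hx)).2.comp_ofReal.hasDerivWithinAt) hFp.symm hGp.symm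
  obtain ⟨huq, hvq⟩ := heq q (right_mem_Icc.2 hpq)
  obtain ⟨f₀, hf₀⟩ := hN.exists_forall_hasDerivWithinAt (hrd.pow 2)
  set f : ℂ → ℂ := fun z => f₀ z - f₀ p with hf
  have hfd : ∀ z ∈ N, HasDerivAt f (r z ^ 2) z := fun z hz =>
    ((hf₀ z hz).hasDerivAt (hNo.mem_nhds hz)).sub_const _
  have hfp : f p = 0 := sub_self _
  have hfq : f q = c := by
    rw [hc, intervalIntegral.integral_eq_sub_of_hasDerivAt_of_le hpq
      (f := fun x : ℝ => f x) (f' := fun x : ℝ => r x ^ 2)]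
    · simp [hfp]
    · exact fun x hx => (hfd x (hxN x hx)).comp_ofReal.continuousAt.continuousWithinAt
    · exact fun x hx => (hfd x (hxN x (Ioo_subset_Icc_self hx))).comp_ofReal
    · refine ContinuousOn.intervalIntegrable ?_
      rw [uIcc_of_le hpq]
      exact fun x hx => ((hr x (hxN x hx)).comp_ofReal.continuousAt.pow 2).continuousWithinAt
  -- On the real interval `Re (l ∫ r²)` need not be monotone. Along this curve `∫ r²` equals `t c`,
  -- so the leading system has constant coefficients.
  obtain ⟨z, hz0, hz1, hz⟩ := exists_path_of_deriv_near_one hN hNo hfd hθ0 hθ hrθ hρ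
    (p := p) (q := q) (fun t ht => by
      have h1 := hball (p + t * (q - p)) ⟨by nlinarith [ht.1], by nlinarith [ht.2]⟩
      push_cast at h1
      exact h1) (by
      rw [← Complex.ofReal_sub, Complex.norm_real, Real.norm_eq_abs,
        abs_of_nonneg (sub_nonneg.2 hpq)]
      exact hθρ) hfp
  rw [hfq] at hz
  -- With `a = r F` and `b = a' / (l r²)` the equation becomes `a' = l r² b`, `b' = l r² a + r² S a
  -- / l`. The half sum and half difference are the WKB coefficients, coupled only through the term
  -- of size `1 / l` containing `S`.
  set a : ℂ → ℂ := fun z => r z * F z with ha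
  set b : ℂ → ℂ := fun z => (r₁ z * F z / r z ^ 2 + G z / r z) / l with hb
  set S : ℂ → ℂ := fun z => r₂ z / r z ^ 5 - 2 * r₁ z ^ 2 / r z ^ 6 with hS
  have had : ∀ z ∈ N, HasDerivAt a (l * r z ^ 2 * b z) z := by
    intro z hz
    refine ((hr z hz).mul (hFG z hz).1).congr_deriv ?_
    have := hr0 z hz
    simp only [hb]
    field_simp
  have hbd : ∀ z ∈ N, HasDerivAt b (l * r z ^ 2 * a z + r z ^ 2 * S z * a z / l) z := by
    intro z hz
    have h0 := hr0 z hz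
    refine (((((hr₁ z hz).mul (hFG z hz).1).div ((hr z hz).pow 2) (pow_ne_zero 2 h0)).add
      ((hFG z hz).2.div (hr z hz) h0)).div_const l).congr_deriv ?_
    simp only [ha, hS, Pi.pow_apply, Pi.mul_apply]
    field_simp
    push_cast
    ring
  have hat : ∀ t ∈ Icc (0 : ℝ) 1, HasDerivAt (fun t => a (z t)) (l * c * b (z t)) t := by
    intro t ht
    refine ((had _ (hz t ht).1).scomp t (hz t ht).2).congr_deriv ?_
    have := hr0 _ (hz t ht).1
    rw [smul_eq_mul]
    field_simp
  have hbt : ∀ t ∈ Icc (0 : ℝ) 1,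
      HasDerivAt (fun t => b (z t)) (l * c * a (z t) + c * S (z t) * a (z t) / l) t := by
    intro t ht
    refine ((hbd _ (hz t ht).1).scomp t (hz t ht).2).congr_deriv ?_
    have := hr0 _ (hz t ht).1
    rw [smul_eq_mul]
    field_simp
  have key := norm_sub_exp_mul_le_of_coupled (κ := l * c) hε0 hε'
    (α := fun t => (a (z t) + b (z t)) / 2) (β := fun t => (a (z t) - b (z t)) / 2)
    (e := fun t => c * S (z t) * a (z t) / (2 * l))
    (fun t ht => (((hat t ht).add (hbt t ht)).div_const 2).congr_deriv (by field_simp; ring))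
    (fun t ht => (((hat t ht).sub (hbt t ht)).div_const 2).congr_deriv (by field_simp; ring))
    (fun t ht => by
      have e1 : a (z t) = (a (z t) + b (z t)) / 2 + (a (z t) - b (z t)) / 2 := by ring
      have h1 : ‖a (z t)‖ ≤ ‖(a (z t) + b (z t)) / 2‖ + ‖(a (z t) - b (z t)) / 2‖ := by
        conv_lhs => rw [e1]
        exact norm_add_le _ _
      simp only [norm_div, norm_mul, Complex.norm_ofNat] at h1 ⊢
      calc ‖c‖ * ‖S (z t)‖ * ‖a (z t)‖ / (2 * ‖l‖) ≤ ‖c‖ * T * ‖a (z t)‖ / (2 * ‖l‖) := by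
            gcongr
            exact hT _ (hz t ht).1
        _ = ‖c‖ * T / (2 * ‖l‖) * ‖a (z t)‖ := by ring
        _ ≤ ε * (‖a (z t) + b (z t)‖ / 2 + ‖a (z t) - b (z t)‖ / 2) := by gcongr)
  simp only [hz0, hz1, ha, hb, hFp, hGp, ← huq, ← hvq] at key
  exact key

/-! ### Uniform WKB bounds at high energy -/

/-- The WKB amplitude `(1 - (V + k) / E)^{1/4}`. -/
noncomputable def wkbAmp (V : ℂ → ℂ) (k E z : ℂ) : ℂ := (1 - (V z + k) / E).sqrt.sqrt

/-- The normalized phase `∫ (1 - (V + k) / E)^{1/2}` over `[p, q]`. -/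
noncomputable def wkbPhase (V : ℂ → ℂ) (k : ℂ) (p q : ℝ) (E : ℂ) : ℂ :=
  ∫ x in p..q, (1 - (V x + k) / E).sqrt

theorem wkbAmp_sq (V : ℂ → ℂ) (k E z : ℂ) : wkbAmp V k E z ^ 2 = (1 - (V z + k) / E).sqrt :=
  csqrt_sq _

theorem wkbAmp_pow_four (V : ℂ → ℂ) (k E z : ℂ) : wkbAmp V k E z ^ 4 = 1 - (V z + k) / E := by
  rw [show 4 = 2 * 2 by norm_num, pow_mul, wkbAmp_sq, csqrt_sq]

theorem norm_wkbAmp_sub_one_le (V : ℂ → ℂ) (k E z : ℂ) :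
    ‖wkbAmp V k E z - 1‖ ≤ ‖(V z + k) / E‖ := by
  refine (norm_csqrt_sub_one_le _).trans ((norm_csqrt_sub_one_le _).trans (le_of_eq ?_))
  rw [sub_sub_cancel_left, norm_neg]

theorem norm_wkbAmp_sq_sub_one_le (V : ℂ → ℂ) (k E z : ℂ) :
    ‖wkbAmp V k E z ^ 2 - 1‖ ≤ ‖(V z + k) / E‖ := by
  rw [wkbAmp_sq]
  refine (norm_csqrt_sub_one_le _).trans (le_of_eq ?_)
  rw [sub_sub_cancel_left, norm_neg]

theorem one_sub_mem_slitPlane {w : ℂ} (hw : ‖w‖ < 1) : 1 - w ∈ Complex.slitPlane := by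
  left
  have := Complex.re_le_norm w
  simp
  linarith

theorem csqrt_mem_slitPlane {a : ℂ} (ha : a ∈ Complex.slitPlane) : a.sqrt ∈ Complex.slitPlane :=
  Or.inl (re_csqrt_pos ha)

/-- Bounds and transfer estimates for `-h² u'' + (V + k) u = E u`, uniform for `‖k‖ ≤ Δ` and
`R ≤ ‖E‖`. -/
structure WKBBounds (V : ℂ → ℂ) (Δ R C : ℝ) : Prop where
  R_pos : 0 < R
  C_pos : 0 < C
  norm_le : ∀ k : ℂ, ‖k‖ ≤ Δ → ∀ E : ℂ, R ≤ ‖E‖ → ∀ x ∈ Icc (-1 : ℝ) 1, ‖(V x + k) / E‖ ≤ 1 / 8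
  deriv_le : ∀ k : ℂ, ‖k‖ ≤ Δ → ∀ E : ℂ, R ≤ ‖E‖ → ∀ x ∈ Icc (-1 : ℝ) 1,
    ‖deriv (wkbAmp V k E) x‖ ≤ C
  transfer : ∀ k : ℂ, ‖k‖ ≤ Δ → ∀ E : ℂ, R ≤ ‖E‖ → ∀ l : ℂ, l ≠ 0 → C / ‖l‖ ≤ 1 / 2 →
    ∀ p q : ℝ, -1 ≤ p → p ≤ q → q ≤ 1 → ∀ u v : ℝ → ℂ,
    (∀ x ∈ Icc p q, HasDerivWithinAt u (v x) (Icc p q) x) →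
    (∀ x ∈ Icc p q, HasDerivWithinAt v (l ^ 2 * (1 - (V x + k) / E) * u x) (Icc p q) x) →
    ‖wkbPlus l (wkbAmp V k E q) (deriv (wkbAmp V k E) q) (u q) (v q) -
        Complex.exp (l * wkbPhase V k p q E) *
          wkbPlus l (wkbAmp V k E p) (deriv (wkbAmp V k E) p) (u p) (v p)‖ ≤
      C / ‖l‖ * Real.exp |(l * wkbPhase V k p q E).re| *
        (‖wkbPlus l (wkbAmp V k E p) (deriv (wkbAmp V k E) p) (u p) (v p)‖ +
          ‖wkbMinus l (wkbAmp V k E p) (deriv (wkbAmp V k E) p) (u p) (v p)‖) ∧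
    ‖wkbMinus l (wkbAmp V k E q) (deriv (wkbAmp V k E) q) (u q) (v q) -
        Complex.exp (-(l * wkbPhase V k p q E)) *
          wkbMinus l (wkbAmp V k E p) (deriv (wkbAmp V k E) p) (u p) (v p)‖ ≤
      C / ‖l‖ * Real.exp |(l * wkbPhase V k p q E).re| *
        (‖wkbPlus l (wkbAmp V k E p) (deriv (wkbAmp V k E) p) (u p) (v p)‖ +
          ‖wkbMinus l (wkbAmp V k E p) (deriv (wkbAmp V k E) p) (u p) (v p)‖)

/-- Cauchy's estimate on a disk of radius `ρ / 2`. -/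
theorem norm_deriv_le_of_thickening {I : Set ℂ} {s ρ B : ℝ} (hρ : 0 < ρ) {f : ℂ → ℂ}
    (hf : DifferentiableOn ℂ f (Metric.thickening (s + ρ) I))
    (hB : ∀ z ∈ Metric.thickening (s + ρ) I, ‖f z‖ ≤ B) {z : ℂ} (hz : z ∈ Metric.thickening s I) :
    ‖deriv f z‖ ≤ B / (ρ / 2) := by
  have hsub : Metric.closedBall z (ρ / 2) ⊆ Metric.thickening (s + ρ) I := by
    intro w hw
    rw [Metric.mem_thickening_iff] at hz ⊢
    obtain ⟨y, hy, hzy⟩ := hz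
    refine ⟨y, hy, ?_⟩
    have h1 := dist_triangle w z y
    have h2 := Metric.mem_closedBall.1 hw
    linarith
  refine Complex.norm_deriv_le_of_forall_mem_sphere_norm_le (by positivity) ?_ ?_
  · refine DifferentiableOn.diffContOnCl ?_
    exact hf.mono ((Metric.closure_ball_subset_closedBall).trans hsub)
  · exact fun w hw => hB w (hsub (Metric.sphere_subset_closedBall hw))

/-- Three nested neighbourhoods of `[-1,1]` of widths `3ρ`, `2ρ`, `ρ` carry the bounds on the
amplitude and, by two Cauchy estimates, on its first and second derivatives. All constants depend on
`V` and `Δ` only. -/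
theorem exists_wkbBounds {D : Set ℂ} (hD : IsOpen D) (hI : ∀ x ∈ Icc (-1 : ℝ) 1, (x : ℂ) ∈ D)
    {V : ℂ → ℂ} (hV : DifferentiableOn ℂ V D) (Δ : ℝ) :
    ∃ R C, WKBBounds V Δ R C := by
  set I : Set ℂ := (fun x : ℝ => (x : ℂ)) '' Icc (-1) 1 with hIdef
  have hIc : IsCompact I := isCompact_Icc.image Complex.continuous_ofReal
  have hIconv : Convex ℝ I := (convex_Icc (-1 : ℝ) 1).linear_image Complex.ofRealLI.toLinearMap
  have hID : I ⊆ D := by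
    rintro _ ⟨x, hx, rfl⟩
    exact hI x hx
  obtain ⟨δ, hδ, hδD⟩ := hIc.exists_cthickening_subset_open hD hID
  obtain ⟨M, hM⟩ := hIc.cthickening (r := δ) |>.exists_bound_of_continuousOn
    (hV.continuousOn.mono hδD)
  set ρ := δ / 3 with hρdef
  have hρ : 0 < ρ := by positivity
  have hδρ : ρ + ρ + ρ = δ := by rw [hρdef]; ring
  have hsub3 : Metric.thickening (ρ + ρ + ρ) I ⊆ Metric.cthickening δ I := by
    rw [hδρ]; exact Metric.thickening_subset_cthickening _ _
  have hsub23 : Metric.thickening (ρ + ρ) I ⊆ Metric.thickening (ρ + ρ + ρ) I :=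
    Metric.thickening_mono (by linarith) _
  have hsub12 : Metric.thickening ρ I ⊆ Metric.thickening (ρ + ρ) I :=
    Metric.thickening_mono (by linarith) _
  have hxN : ∀ x ∈ Icc (-1 : ℝ) 1, Metric.closedBall (x : ℂ) (ρ / 2) ⊆ Metric.thickening ρ I := by
    intro x hx w hw
    rw [Metric.mem_thickening_iff]
    refine ⟨x, ⟨x, hx, rfl⟩, ?_⟩
    have := Metric.mem_closedBall.1 hw
    linarith
  have hxN' : ∀ x ∈ Icc (-1 : ℝ) 1, (x : ℂ) ∈ Metric.thickening ρ I := fun x hx =>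
    hxN x hx (Metric.mem_closedBall_self (by positivity))
  have hM0 : 0 ≤ M := (norm_nonneg _).trans
    (hM _ (hsub3 (hsub23 (hsub12 (hxN' 0 (by constructor <;> norm_num))))))
  -- The bound `1 / 8` keeps the amplitude between `1 / 2` and `2`; the bound `ρ / 16` gives `4 θ (q
  -- - p) ≤ ρ / 2`, the room needed for the canonical curve, as `q - p ≤ 2`.
  set θ := min (1 / 8) (ρ / 16) with hθ
  have hθ0 : 0 < θ := by positivity
  set R := (M + |Δ|) / θ + 1 with hR
  have hR0 : 0 < R := by positivity
  -- From `‖r''‖ ≤ 8 / ρ²`, `‖r'‖ ≤ 4 / ρ` and `‖r‖ ≥ 1 / 2`: `2⁵ · 8 + 2 · 2⁶ · 16 = 2304`. In `C`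
  -- the term `4 * T` covers the phase bound `4`, and `4 / ρ` the derivative of the amplitude.
  set T := 2304 / ρ ^ 2 with hT
  set C := 4 * T + 4 / ρ with hC
  have hw : ∀ k : ℂ, ‖k‖ ≤ Δ → ∀ E : ℂ, R ≤ ‖E‖ →
      ∀ z ∈ Metric.thickening (ρ + ρ + ρ) I, ‖(V z + k) / E‖ ≤ θ := by
    intro k hk E hE z hz
    rw [norm_div, div_le_iff₀ (hR0.trans_le hE)]
    calc ‖V z + k‖ ≤ M + |Δ| := (norm_add_le _ _).trans
          (add_le_add (hM z (hsub3 hz)) (hk.trans (le_abs_self _)))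
      _ = θ * ((M + |Δ|) / θ) := by field_simp
      _ ≤ θ * ‖E‖ := by
        gcongr
        linarith
  have hθ8 : θ ≤ 1 / 8 := min_le_left _ _
  have hamp : ∀ k : ℂ, ‖k‖ ≤ Δ → ∀ E : ℂ, R ≤ ‖E‖ →
      DifferentiableOn ℂ (wkbAmp V k E) (Metric.thickening (ρ + ρ + ρ) I) := by
    intro k hk E hE z hz
    have h1 : 1 - (V z + k) / E ∈ Complex.slitPlane :=
      one_sub_mem_slitPlane (by linarith [hw k hk E hE z hz])
    have h2 : DifferentiableWithinAt ℂ V (Metric.thickening (ρ + ρ + ρ) I) z :=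
      (hV z (hδD (hsub3 hz))).mono (hsub3.trans hδD)
    have h3 : DifferentiableWithinAt ℂ (fun z => 1 - (V z + k) / E)
        (Metric.thickening (ρ + ρ + ρ) I) z := ((h2.add_const k).div_const E).const_sub 1
    have h4 := (Complex.differentiableAt_sqrt h1).comp_differentiableWithinAt z h3
    exact (Complex.differentiableAt_sqrt (csqrt_mem_slitPlane h1)).comp_differentiableWithinAt z h4
  have hamp2 : ∀ k : ℂ, ‖k‖ ≤ Δ → ∀ E : ℂ, R ≤ ‖E‖ →
      ∀ z ∈ Metric.thickening (ρ + ρ + ρ) I, ‖wkbAmp V k E z‖ ≤ 2 := by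
    intro k hk E hE z hz
    have h1 := (norm_wkbAmp_sub_one_le V k E z).trans (hw k hk E hE z hz)
    have h2 := norm_le_norm_add_norm_sub' (wkbAmp V k E z) 1
    rw [norm_one] at h2
    linarith
  have hamp3 : ∀ k : ℂ, ‖k‖ ≤ Δ → ∀ E : ℂ, R ≤ ‖E‖ →
      ∀ z ∈ Metric.thickening (ρ + ρ + ρ) I, 1 / 2 ≤ ‖wkbAmp V k E z‖ := by
    intro k hk E hE z hz
    have h1 := (norm_wkbAmp_sub_one_le V k E z).trans (hw k hk E hE z hz)
    have h2 := norm_le_norm_add_norm_sub' 1 (wkbAmp V k E z)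
    rw [norm_one, norm_sub_rev] at h2
    linarith
  have hd1 : ∀ k : ℂ, ‖k‖ ≤ Δ → ∀ E : ℂ, R ≤ ‖E‖ →
      ∀ z ∈ Metric.thickening (ρ + ρ) I, ‖deriv (wkbAmp V k E) z‖ ≤ 4 / ρ := by
    intro k hk E hE z hz
    refine (norm_deriv_le_of_thickening hρ (hamp k hk E hE) (hamp2 k hk E hE) hz).trans
      (le_of_eq ?_)
    field_simp
    norm_num
  have hdd : ∀ k : ℂ, ‖k‖ ≤ Δ → ∀ E : ℂ, R ≤ ‖E‖ →
      DifferentiableOn ℂ (deriv (wkbAmp V k E)) (Metric.thickening (ρ + ρ) I) := by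
    intro k hk E hE
    exact ((hamp k hk E hE).deriv Metric.isOpen_thickening).mono hsub23
  have hd2 : ∀ k : ℂ, ‖k‖ ≤ Δ → ∀ E : ℂ, R ≤ ‖E‖ →
      ∀ z ∈ Metric.thickening ρ I, ‖deriv (deriv (wkbAmp V k E)) z‖ ≤ 8 / ρ ^ 2 := by
    intro k hk E hE z hz
    refine (norm_deriv_le_of_thickening hρ (hdd k hk E hE) (hd1 k hk E hE) hz).trans
      (le_of_eq ?_)
    field_simp
    norm_num
  have hC4 : 4 * T ≤ C := by
    rw [hC]
    have : 0 ≤ 4 / ρ := by positivity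
    linarith
  have hTpos : 0 < T := by positivity
  refine ⟨R, C, hR0, by positivity, ?_, ?_, ?_⟩
  · intro k hk E hE x hx
    exact (hw k hk E hE x (hsub23 (hsub12 (hxN' x hx)))).trans hθ8
  · intro k hk E hE x hx
    refine (hd1 k hk E hE x (hsub12 (hxN' x hx))).trans ?_
    rw [hC]
    linarith
  · intro k hk E hE l hl hCl p q hp hpq hq u v hu hv
    have hmem : ∀ x ∈ Icc p q, x ∈ Icc (-1 : ℝ) 1 := fun x hx => ⟨hp.trans hx.1, hx.2.trans hq⟩
    have hphase : wkbPhase V k p q E = ∫ x in p..q, wkbAmp V k E x ^ 2 := by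
      simp only [wkbPhase, wkbAmp_sq]
    have hphase4 : ‖wkbPhase V k p q E‖ ≤ 4 := by
      rw [hphase]
      have h1 : ‖∫ x in p..q, wkbAmp V k E x ^ 2‖ ≤ 2 * |q - p| := by
        refine intervalIntegral.norm_integral_le_of_norm_le_const fun x hx => ?_
        rw [uIoc_of_le hpq] at hx
        have h2 := (norm_wkbAmp_sq_sub_one_le V k E x).trans
          (hw k hk E hE x (hsub23 (hsub12 (hxN' x (hmem x (Ioc_subset_Icc_self hx))))))
        have h3 := norm_le_norm_add_norm_sub' (wkbAmp V k E x ^ 2) 1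
        rw [norm_one] at h3
        linarith
      rw [abs_of_nonneg (by linarith)] at h1
      linarith
    have hlpos : 0 < ‖l‖ := norm_pos_iff.2 hl
    have key := wkb_transfer (hIconv.thickening ρ) Metric.isOpen_thickening
      (r := wkbAmp V k E) (r₁ := deriv (wkbAmp V k E)) (r₂ := deriv (deriv (wkbAmp V k E)))
      (fun z hz => ((hamp k hk E hE).differentiableAt
        (Metric.isOpen_thickening.mem_nhds (hsub23 (hsub12 hz)))).hasDerivAt)
      (fun z hz => ((hdd k hk E hE).differentiableAt
        (Metric.isOpen_thickening.mem_nhds (hsub12 hz))).hasDerivAt)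
      (θ := θ) (B := 2) (L := ρ + 2) (T := T) (ρ := ρ / 2) (ε := C / ‖l‖ / 2) hpq (by positivity)
      (fun x hx => hxN x (hmem x hx))
      (fun z hz => by
        obtain ⟨y, ⟨y', hy', rfl⟩, hzy⟩ := Metric.mem_thickening_iff.1 hz
        have h1 : ‖z - p‖ ≤ ‖z - y'‖ + ‖(y' : ℂ) - p‖ := norm_sub_le_norm_sub_add_norm_sub _ _ _
        have h2 : ‖(y' : ℂ) - p‖ ≤ 2 := by
          rw [← Complex.ofReal_sub, Complex.norm_real, Real.norm_eq_abs, abs_le]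
          constructor <;> linarith [hy'.1, hy'.2]
        rw [dist_eq_norm] at hzy
        linarith)
      hθ0.le (by linarith) (by
        have : θ ≤ ρ / 16 := min_le_right _ _
        nlinarith)
      (fun z hz => (norm_wkbAmp_sq_sub_one_le V k E z).trans
        (hw k hk E hE z (hsub23 (hsub12 hz))))
      (fun z hz => hamp2 k hk E hE z (hsub23 (hsub12 hz)))
      (fun z hz => by
        have h0 := hamp3 k hk E hE z (hsub23 (hsub12 hz))
        have h1 := hd1 k hk E hE z (hsub12 hz)
        have h2 := hd2 k hk E hE z hz
        refine (norm_sub_le _ _).trans ?_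
        rw [norm_div, norm_div, norm_mul, norm_pow, norm_pow, norm_pow, Complex.norm_ofNat]
        calc _ ≤ (8 / ρ ^ 2) / (1 / 2) ^ 5 + 2 * (4 / ρ) ^ 2 / (1 / 2) ^ 6 := by gcongr
          _ = T := by rw [hT]; field_simp; norm_num)
      hl hphase (by
        rw [div_div, div_le_div_iff₀ (by positivity) (by positivity)]
        have : ‖wkbPhase V k p q E‖ * T ≤ 4 * T := by gcongr
        nlinarith) (by linarith) hu
      (fun x hx => by
        rw [wkbAmp_pow_four]
        exact hv x hx)
    convert key using 3 <;> ring

/-! ### Asymptotics of families of solutions -/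

theorem eq_of_wkbPlus_wkbMinus {l r r' u v : ℂ} (hl : l ≠ 0) (hr : r ≠ 0) :
    u = (wkbPlus l r r' u v + wkbMinus l r r' u v) / r ∧
    v / l = r * (wkbPlus l r r' u v - wkbMinus l r r' u v) - r' * u / (r * l) := by
  constructor
  · simp only [wkbPlus, wkbMinus]
    field_simp
    ring
  · simp only [wkbPlus, wkbMinus]
    field_simp
    ring

/-- With the reverse estimate below it: WKB coefficients and the data `(u, v / l)` are comparable
uniformly in `l`. At a jump the amplitudes change but the Cauchy data do not, so bounds are handed
over in terms of the latter. -/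
theorem norm_add_norm_wkb_le {l r r' u v : ℂ} {C : ℝ} (hl : 1 ≤ ‖l‖)
    (hr : 1 / 2 ≤ ‖r‖) (hr2 : ‖r‖ ≤ 2) (hr' : ‖r'‖ ≤ C) :
    ‖wkbPlus l r r' u v‖ + ‖wkbMinus l r r' u v‖ ≤ (2 + 4 * C) * (‖u‖ + ‖v / l‖) := by
  have hC : 0 ≤ C := (norm_nonneg _).trans hr'
  have h1 : ‖r * u‖ ≤ 2 * ‖u‖ := by rw [norm_mul]; gcongr
  have h2 : ‖(r' * u / r ^ 2 + v / r) / l‖ ≤ 4 * C * ‖u‖ + 2 * ‖v / l‖ := by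
    have e : (r' * u / r ^ 2 + v / r) / l = r' * u / r ^ 2 / l + v / l / r := by ring
    rw [e]
    refine (norm_add_le _ _).trans (add_le_add ?_ ?_)
    · simp only [norm_div, norm_mul, norm_pow]
      calc ‖r'‖ * ‖u‖ / ‖r‖ ^ 2 / ‖l‖ ≤ C * ‖u‖ / (1 / 2) ^ 2 / 1 := by gcongr
        _ = 4 * C * ‖u‖ := by ring
    · rw [norm_div (v / l)]
      calc ‖v / l‖ / ‖r‖ ≤ ‖v / l‖ / (1 / 2) := by gcongr
        _ = 2 * ‖v / l‖ := by ring
  have h3 : ‖wkbPlus l r r' u v‖ ≤ (2 * ‖u‖ + (4 * C * ‖u‖ + 2 * ‖v / l‖)) / 2 := by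
    rw [wkbPlus, norm_div, Complex.norm_ofNat]
    gcongr
    exact (norm_add_le _ _).trans (add_le_add h1 h2)
  have h4 : ‖wkbMinus l r r' u v‖ ≤ (2 * ‖u‖ + (4 * C * ‖u‖ + 2 * ‖v / l‖)) / 2 := by
    rw [wkbMinus, norm_div, Complex.norm_ofNat]
    gcongr
    exact (norm_sub_le _ _).trans (add_le_add h1 h2)
  have h5 : 0 ≤ C * ‖v / l‖ := by positivity
  nlinarith

theorem norm_add_norm_le_wkb {l r r' u v : ℂ} {C : ℝ} (hl : 1 ≤ ‖l‖)
    (hr : 1 / 2 ≤ ‖r‖) (hr2 : ‖r‖ ≤ 2) (hr' : ‖r'‖ ≤ C) :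
    ‖u‖ + ‖v / l‖ ≤ (4 + 4 * C) * (‖wkbPlus l r r' u v‖ + ‖wkbMinus l r r' u v‖) := by
  have hC : 0 ≤ C := (norm_nonneg _).trans hr'
  have hr0 : r ≠ 0 := by
    rintro rfl
    norm_num at hr
  have hl0 : l ≠ 0 := by
    rintro rfl
    norm_num at hl
  obtain ⟨h1, h2⟩ := eq_of_wkbPlus_wkbMinus (r' := r') (u := u) (v := v) hl0 hr0
  set a := wkbPlus l r r' u v
  set b := wkbMinus l r r' u v
  have h3 : ‖u‖ ≤ 2 * (‖a‖ + ‖b‖) := by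
    rw [h1, norm_div]
    calc ‖a + b‖ / ‖r‖ ≤ (‖a‖ + ‖b‖) / (1 / 2) := by
          gcongr
          exact norm_add_le _ _
      _ = _ := by ring
  have h4 : ‖v / l‖ ≤ 2 * (‖a‖ + ‖b‖) + 4 * C * (‖a‖ + ‖b‖) := by
    rw [h2]
    refine (norm_sub_le _ _).trans (add_le_add ?_ ?_)
    · rw [norm_mul]
      gcongr
      exact norm_sub_le _ _
    · simp only [norm_div, norm_mul]
      calc ‖r'‖ * ‖u‖ / (‖r‖ * ‖l‖) ≤ C * (2 * (‖a‖ + ‖b‖)) / (1 / 2 * 1) := by gcongr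
        _ = _ := by ring
  linarith

/-! ### Propagation of a family of solutions across one interval -/

section Families

variable {ι : Type*} {𝓕 : Filter ι} {a b a' b' κ s : ι → ℂ} {η : ι → ℝ}

/-- After rescaling by `exp (-κ)` the growing coefficient keeps its limit, while the other becomes
`exp (-2κ) b` plus an error of size `η`, both negligible. -/
theorem tendsto_transfer (hη : Tendsto η 𝓕 (𝓝 0))
    (ha : ∀ᶠ i in 𝓕, ‖a' i - Complex.exp (κ i) * a i‖ ≤
      η i * Real.exp |(κ i).re| * (‖a i‖ + ‖b i‖))
    (hb : ∀ᶠ i in 𝓕, ‖b' i - Complex.exp (-κ i) * b i‖ ≤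
      η i * Real.exp |(κ i).re| * (‖a i‖ + ‖b i‖))
    (hκ : Tendsto (fun i => (κ i).re) 𝓕 atTop) {x y : ℂ}
    (hx : Tendsto (fun i => s i * a i) 𝓕 (𝓝 x)) (hy : Tendsto (fun i => s i * b i) 𝓕 (𝓝 y)) :
    Tendsto (fun i => s i * Complex.exp (-κ i) * a' i) 𝓕 (𝓝 x) ∧
    Tendsto (fun i => s i * Complex.exp (-κ i) * b' i) 𝓕 (𝓝 0) := by
  have hsmall : Tendsto (fun i => η i * (‖s i * a i‖ + ‖s i * b i‖)) 𝓕 (𝓝 0) := by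
    simpa using hη.mul (hx.norm.add hy.norm)
  have hpos : ∀ᶠ i in 𝓕, |(κ i).re| = (κ i).re := by
    filter_upwards [hκ.eventually_ge_atTop 0] with i hi using abs_of_nonneg hi
  have hnorm : ∀ᶠ i in 𝓕, ∀ z : ℂ, ‖z‖ ≤ η i * Real.exp |(κ i).re| * (‖a i‖ + ‖b i‖) →
      ‖s i * Complex.exp (-κ i) * z‖ ≤ η i * (‖s i * a i‖ + ‖s i * b i‖) := by
    filter_upwards [hpos] with i hi z hz
    rw [hi] at hz
    rw [norm_mul, norm_mul, Complex.norm_exp, Complex.neg_re]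
    calc ‖s i‖ * Real.exp (-(κ i).re) * ‖z‖
        ≤ ‖s i‖ * Real.exp (-(κ i).re) * (η i * Real.exp (κ i).re * (‖a i‖ + ‖b i‖)) := by gcongr
      _ = (Real.exp (-(κ i).re) * Real.exp (κ i).re) * (η i * (‖s i * a i‖ + ‖s i * b i‖)) := by
          rw [norm_mul, norm_mul]; ring
      _ = _ := by rw [← Real.exp_add]; simp
  have h1 : Tendsto (fun i => s i * Complex.exp (-κ i) * (a' i - Complex.exp (κ i) * a i)) 𝓕
      (𝓝 0) := by
    refine squeeze_zero_norm' ?_ hsmall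
    filter_upwards [ha, hnorm] with i h1 h2 using h2 _ h1
  have h2 : Tendsto (fun i => s i * Complex.exp (-κ i) * (b' i - Complex.exp (-κ i) * b i)) 𝓕
      (𝓝 0) := by
    refine squeeze_zero_norm' ?_ hsmall
    filter_upwards [hb, hnorm] with i h1 h2 using h2 _ h1
  constructor
  · have h3 := h1.add hx
    rw [zero_add] at h3
    refine h3.congr fun i => ?_
    have : Complex.exp (-κ i) * Complex.exp (κ i) = 1 := by rw [← Complex.exp_add]; simp
    linear_combination (-(s i * a i)) * this
  · have h4 : Tendsto (fun i => Complex.exp (-κ i) * Complex.exp (-κ i)) 𝓕 (𝓝 0) := by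
      have h5 : Tendsto (fun i => Complex.exp (-κ i)) 𝓕 (𝓝 0) := by
        rw [tendsto_zero_iff_norm_tendsto_zero]
        simp only [Complex.norm_exp, Complex.neg_re]
        exact Real.tendsto_exp_neg_atTop_nhds_zero.comp hκ
      simpa using h5.mul h5
    have h6 := h2.add (h4.mul hy)
    rw [zero_mul, zero_add] at h6
    refine h6.congr fun i => ?_
    ring

variable {V : ℂ → ℂ} {Δ R C : ℝ} {k : ℂ} {l E : ι → ℂ} {u v : ι → ℝ → ℂ} {p q : ℝ} {Ψ : ι → ℝ}

theorem WKBBounds.norm_wkbAmp_le (wb : WKBBounds V Δ R C) (hk : ‖k‖ ≤ Δ) {E : ℂ} (hE : R ≤ ‖E‖)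
    {x : ℝ} (hx : x ∈ Icc (-1 : ℝ) 1) :
    1 / 2 ≤ ‖wkbAmp V k E x‖ ∧ ‖wkbAmp V k E x‖ ≤ 2 := by
  have h1 := (norm_wkbAmp_sub_one_le V k E x).trans (wb.norm_le k hk E hE x hx)
  have h2 := norm_le_norm_add_norm_sub' (wkbAmp V k E x) 1
  have h3 := norm_le_norm_add_norm_sub' 1 (wkbAmp V k E x)
  rw [norm_one] at h2 h3
  rw [norm_sub_rev] at h3
  constructor <;> linarith

/-- Upper bound without any condition on the phase: crossing an interval costs at most a constant
times `exp |Re κ|`, even where `Re κ` vanishes. -/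
theorem WKBBounds.bounded_step (wb : WKBBounds V Δ R C) (hk : ‖k‖ ≤ Δ) (hp : -1 ≤ p)
    (hpq : p ≤ q) (hq : q ≤ 1) (hl : Tendsto (fun i => ‖l i‖) 𝓕 atTop)
    (hE : ∀ᶠ i in 𝓕, R ≤ ‖E i‖)
    (hu : ∀ᶠ i in 𝓕, ∀ x ∈ Icc p q, HasDerivWithinAt (u i) (v i x) (Icc p q) x)
    (hv : ∀ᶠ i in 𝓕, ∀ x ∈ Icc p q,
      HasDerivWithinAt (v i) (l i ^ 2 * (1 - (V x + k) / E i) * u i x) (Icc p q) x)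
    (h0 : ∃ K, ∀ᶠ i in 𝓕, ‖u i p‖ + ‖v i p / l i‖ ≤ K * Real.exp (Ψ i)) :
    ∃ K, ∀ᶠ i in 𝓕, ‖u i q‖ + ‖v i q / l i‖ ≤
      K * Real.exp (Ψ i + |(l i * wkbPhase V k p q (E i)).re|) := by
  obtain ⟨K, hK⟩ := h0
  have hC := wb.C_pos
  refine ⟨(4 + 4 * C) * (4 * ((2 + 4 * C) * K)), ?_⟩
  filter_upwards [hK, hE, hu, hv, hl.eventually_ge_atTop 1, hl.eventually_ge_atTop (2 * C)]
    with i hKi hEi hui hvi hl1 hl2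
  have hl0 : l i ≠ 0 := by
    intro h
    rw [h] at hl1
    norm_num at hl1
  have hCl : C / ‖l i‖ ≤ 1 / 2 := by
    rw [div_le_iff₀ (by linarith)]
    linarith
  obtain ⟨t1, t2⟩ := wb.transfer k hk (E i) hEi (l i) hl0 hCl p q hp hpq hq (u i) (v i) hui hvi
  have hpI : p ∈ Icc (-1 : ℝ) 1 := ⟨hp, hpq.trans hq⟩
  have hqI : q ∈ Icc (-1 : ℝ) 1 := ⟨hp.trans hpq, hq⟩
  obtain ⟨b1, b2⟩ := wb.norm_wkbAmp_le hk hEi hpI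
  obtain ⟨b3, b4⟩ := wb.norm_wkbAmp_le hk hEi hqI
  have hin := norm_add_norm_wkb_le (u := u i p) (v := v i p) hl1 b1 b2
    (wb.deriv_le k hk (E i) hEi p hpI)
  refine (norm_add_norm_le_wkb hl1 b3 b4 (wb.deriv_le k hk (E i) hEi q hqI)).trans ?_
  set A := wkbPlus (l i) (wkbAmp V k (E i) p) (deriv (wkbAmp V k (E i)) p) (u i p) (v i p)
  set B := wkbMinus (l i) (wkbAmp V k (E i) p) (deriv (wkbAmp V k (E i)) p) (u i p) (v i p)
  set A' := wkbPlus (l i) (wkbAmp V k (E i) q) (deriv (wkbAmp V k (E i)) q) (u i q) (v i q)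
  set B' := wkbMinus (l i) (wkbAmp V k (E i) q) (deriv (wkbAmp V k (E i)) q) (u i q) (v i q)
  set κ := l i * wkbPhase V k p q (E i)
  have hS : ‖A‖ + ‖B‖ ≤ (2 + 4 * C) * K * Real.exp (Ψ i) := by
    rw [mul_assoc]
    exact hin.trans (by gcongr)
  have hmain : ∀ (X X' : ℂ) (κ' : ℂ), κ'.re ≤ |κ.re| → ‖X‖ ≤ ‖A‖ + ‖B‖ →
      ‖X' - Complex.exp κ' * X‖ ≤ C / ‖l i‖ * Real.exp |κ.re| * (‖A‖ + ‖B‖) →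
      ‖X'‖ ≤ 2 * (Real.exp |κ.re| * ((2 + 4 * C) * K * Real.exp (Ψ i))) := by
    intro X X' κ' hκ' hX hX'
    have e : X' = Complex.exp κ' * X + (X' - Complex.exp κ' * X) := by ring
    rw [e]
    refine (norm_add_le _ _).trans ?_
    rw [norm_mul, Complex.norm_exp]
    have h1 : Real.exp κ'.re * ‖X‖ ≤ Real.exp |κ.re| * (‖A‖ + ‖B‖) := by gcongr
    have h2 : C / ‖l i‖ * Real.exp |κ.re| * (‖A‖ + ‖B‖) ≤ Real.exp |κ.re| * (‖A‖ + ‖B‖) := by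
      rw [mul_assoc]
      exact mul_le_of_le_one_left (by positivity) (by linarith)
    have h3 : Real.exp |κ.re| * (‖A‖ + ‖B‖) ≤
      Real.exp |κ.re| * ((2 + 4 * C) * K * Real.exp (Ψ i)) := by gcongr
    linarith
  have h1 := hmain A A' κ (le_abs_self _) (by linarith [norm_nonneg B]) t1
  have h2 := hmain B B' (-κ) (by rw [Complex.neg_re]; exact neg_le_abs _)
    (by linarith [norm_nonneg A]) t2
  rw [add_comm (Ψ i), Real.exp_add]
  calc (4 + 4 * C) * (‖A'‖ + ‖B'‖)
      ≤ (4 + 4 * C) * (2 * (Real.exp |κ.re| * ((2 + 4 * C) * K * Real.exp (Ψ i))) +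
        2 * (Real.exp |κ.re| * ((2 + 4 * C) * K * Real.exp (Ψ i)))) := by gcongr
    _ = _ := by ring

theorem WKBBounds.continuousAt_wkbAmp (wb : WKBBounds V Δ R C) (hk : ‖k‖ ≤ Δ) {E₁ : ℂ}
    (hE : R ≤ ‖E₁‖) {x : ℝ} (hx : x ∈ Icc (-1 : ℝ) 1) :
    ContinuousAt (fun E => wkbAmp V k E x) E₁ := by
  have h1 : 1 - (V x + k) / E₁ ∈ Complex.slitPlane :=
    one_sub_mem_slitPlane ((wb.norm_le k hk E₁ hE x hx).trans_lt (by norm_num))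
  have hE0 : E₁ ≠ 0 := norm_pos_iff.1 (wb.R_pos.trans_le hE)
  have h2 : ContinuousAt (fun E => 1 - (V x + k) / E) E₁ := by fun_prop (disch := assumption)
  have h3 : ContinuousAt (fun E => (1 - (V x + k) / E).sqrt) E₁ :=
    ContinuousAt.comp (g := Complex.sqrt) (Complex.differentiableAt_sqrt h1).continuousAt h2
  exact ContinuousAt.comp (g := Complex.sqrt)
    (Complex.differentiableAt_sqrt (csqrt_mem_slitPlane h1)).continuousAt h3

/-- `U` and `W` are limits of normalised Cauchy data. The inequality at `p` says that both limiting
WKB coefficients are nonzero, so whichever mode grows is excited; at `q` only that mode survives,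
which is the equation `W² = r⁴ U²` with `U ≠ 0`. -/
theorem WKBBounds.tendsto_step (wb : WKBBounds V Δ R C) (hk : ‖k‖ ≤ Δ) (hp : -1 ≤ p)
    (hpq : p ≤ q) (hq : q ≤ 1) (hl : Tendsto (fun i => ‖l i‖) 𝓕 atTop) {E₁ : ℂ}
    (hE₁ : R < ‖E₁‖) (hE : Tendsto E 𝓕 (𝓝 E₁))
    (hκ : Tendsto (fun i => (l i * wkbPhase V k p q (E i)).re) 𝓕 atTop ∨
      Tendsto (fun i => (l i * wkbPhase V k p q (E i)).re) 𝓕 atBot)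
    (hu : ∀ᶠ i in 𝓕, ∀ x ∈ Icc p q, HasDerivWithinAt (u i) (v i x) (Icc p q) x)
    (hv : ∀ᶠ i in 𝓕, ∀ x ∈ Icc p q,
      HasDerivWithinAt (v i) (l i ^ 2 * (1 - (V x + k) / E i) * u i x) (Icc p q) x)
    (h0 : ∃ (s : ι → ℂ) (U W : ℂ), (∀ᶠ i in 𝓕, ‖s i‖ = Real.exp (-Ψ i)) ∧
      Tendsto (fun i => s i * u i p) 𝓕 (𝓝 U) ∧ Tendsto (fun i => s i * (v i p / l i)) 𝓕 (𝓝 W) ∧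
      W ^ 2 ≠ (1 - (V p + k) / E₁) * U ^ 2) :
    ∃ (s : ι → ℂ) (U W : ℂ),
      (∀ᶠ i in 𝓕, ‖s i‖ = Real.exp (-(Ψ i + |(l i * wkbPhase V k p q (E i)).re|))) ∧
      Tendsto (fun i => s i * u i q) 𝓕 (𝓝 U) ∧ Tendsto (fun i => s i * (v i q / l i)) 𝓕 (𝓝 W) ∧
      W ^ 2 = (1 - (V q + k) / E₁) * U ^ 2 ∧ U ≠ 0 := by
  obtain ⟨s, U, W, hs, hU, hW, hne⟩ := h0
  have hC := wb.C_pos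
  have hpI : p ∈ Icc (-1 : ℝ) 1 := ⟨hp, hpq.trans hq⟩
  have hqI : q ∈ Icc (-1 : ℝ) 1 := ⟨hp.trans hpq, hq⟩
  have hER : ∀ᶠ i in 𝓕, R ≤ ‖E i‖ := (hE.norm.eventually (lt_mem_nhds hE₁)).mono fun i hi => hi.le
  have hl1 : ∀ᶠ i in 𝓕, 1 ≤ ‖l i‖ := hl.eventually_ge_atTop 1
  have hl0 : ∀ᶠ i in 𝓕, l i ≠ 0 := hl1.mono fun i hi h => by
    rw [h] at hi
    norm_num at hi
  have hinv : Tendsto (fun i => ‖l i‖⁻¹) 𝓕 (𝓝 0) := tendsto_inv_atTop_zero.comp hl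
  have hder : ∀ x ∈ Icc (-1 : ℝ) 1,
      Tendsto (fun i => deriv (wkbAmp V k (E i)) x / l i) 𝓕 (𝓝 0) := by
    intro x hx
    refine squeeze_zero_norm' (a := fun i => C * ‖l i‖⁻¹) ?_ (by simpa using hinv.const_mul C)
    filter_upwards [hER] with i hi
    rw [norm_div, div_eq_mul_inv]
    gcongr
    exact wb.deriv_le k hk (E i) hi x hx
  have hramp : ∀ x ∈ Icc (-1 : ℝ) 1,
      Tendsto (fun i => wkbAmp V k (E i) x) 𝓕 (𝓝 (wkbAmp V k E₁ x)) := fun x hx =>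
    (wb.continuousAt_wkbAmp hk hE₁.le hx).tendsto.comp hE
  have hr0 : ∀ x ∈ Icc (-1 : ℝ) 1, ∀ E', R ≤ ‖E'‖ → wkbAmp V k E' x ≠ 0 := by
    intro x hx E' hE' h
    have := (wb.norm_wkbAmp_le hk hE' hx).1
    rw [h] at this
    norm_num at this
  have hrp := hramp p hpI
  have hrq := hramp q hqI
  have hrp0 := hr0 p hpI E₁ hE₁.le
  have hrq0 := hr0 q hqI E₁ hE₁.le
  set rp := wkbAmp V k E₁ p with hrpdef
  set rq := wkbAmp V k E₁ q with hrqdef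
  set A : ι → ℂ := fun i =>
    wkbPlus (l i) (wkbAmp V k (E i) p) (deriv (wkbAmp V k (E i)) p) (u i p) (v i p) with hA
  set B : ι → ℂ := fun i =>
    wkbMinus (l i) (wkbAmp V k (E i) p) (deriv (wkbAmp V k (E i)) p) (u i p) (v i p) with hB
  set A' : ι → ℂ := fun i =>
    wkbPlus (l i) (wkbAmp V k (E i) q) (deriv (wkbAmp V k (E i)) q) (u i q) (v i q) with hA'
  set B' : ι → ℂ := fun i =>
    wkbMinus (l i) (wkbAmp V k (E i) q) (deriv (wkbAmp V k (E i)) q) (u i q) (v i q) with hB'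
  set κ : ι → ℂ := fun i => l i * wkbPhase V k p q (E i) with hκdef
  have hsum : Tendsto (fun i => s i * (A i + B i)) 𝓕 (𝓝 (rp * U)) := by
    refine (hrp.mul hU).congr fun i => ?_
    simp only [hA, hB, wkbPlus, wkbMinus]
    ring
  have hdiff : Tendsto (fun i => s i * (A i - B i)) 𝓕 (𝓝 (W / rp)) := by
    have h1 := (((hder p hpI).mul hU).div (hrp.pow 2) (pow_ne_zero 2 hrp0)).add (hW.div hrp hrp0)
    rw [zero_mul, zero_div, zero_add] at h1
    refine h1.congr fun i => ?_
    simp only [hA, hB, wkbPlus, wkbMinus, Pi.div_apply]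
    ring
  have hAx : Tendsto (fun i => s i * A i) 𝓕 (𝓝 ((rp * U + W / rp) / 2)) := by
    refine ((hsum.add hdiff).div_const 2).congr fun i => ?_
    ring
  have hBx : Tendsto (fun i => s i * B i) 𝓕 (𝓝 ((rp * U - W / rp) / 2)) := by
    refine ((hsum.sub hdiff).div_const 2).congr fun i => ?_
    ring
  have hr4 : rp ^ 4 = 1 - (V p + k) / E₁ := wkbAmp_pow_four V k E₁ p
  -- The product of the two limiting coefficients is a nonzero multiple of `rp⁴ U² - W²`.
  have hprod : (rp * U + W / rp) * (rp * U - W / rp) ≠ 0 := by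
    intro h
    apply hne
    rw [← hr4]
    field_simp at h
    linear_combination -h
  have hev : ∀ᶠ i in 𝓕,
      ‖A' i - Complex.exp (κ i) * A i‖ ≤ C / ‖l i‖ * Real.exp |(κ i).re| * (‖A i‖ + ‖B i‖) ∧
      ‖B' i - Complex.exp (-κ i) * B i‖ ≤ C / ‖l i‖ * Real.exp |(κ i).re| * (‖A i‖ + ‖B i‖) := by
    filter_upwards [hER, hu, hv, hl1, hl0, hl.eventually_ge_atTop (2 * C)]
      with i hEi hui hvi hl1 hl0 hl2
    refine wb.transfer k hk (E i) hEi (l i) hl0 ?_ p q hp hpq hq (u i) (v i) hui hvi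
    rw [div_le_iff₀ (by linarith)]
    linarith
  have hη : Tendsto (fun i => C / ‖l i‖) 𝓕 (𝓝 0) := by
    simpa [div_eq_mul_inv] using hinv.const_mul C
  -- The identity `(x - y)² = (x + y)²` records `x y = 0` without naming the surviving mode. If `Re
  -- κ → -∞`, the two modes exchange their roles.
  have hout : ∃ (s' : ι → ℂ) (x y : ℂ), (∀ᶠ i in 𝓕, ‖s' i‖ = Real.exp (-(Ψ i + |(κ i).re|))) ∧
      Tendsto (fun i => s' i * A' i) 𝓕 (𝓝 x) ∧ Tendsto (fun i => s' i * B' i) 𝓕 (𝓝 y) ∧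
      (x - y) ^ 2 = (x + y) ^ 2 ∧ x + y ≠ 0 := by
    rcases hκ with hκ | hκ
    · obtain ⟨t1, t2⟩ := tendsto_transfer hη (hev.mono fun i h => h.1) (hev.mono fun i h => h.2) hκ
        hAx hBx
      refine ⟨_, _, _, ?_, t1, t2, by ring, ?_⟩
      · filter_upwards [hs, hκ.eventually_ge_atTop 0] with i h1 h2
        rw [norm_mul, h1, Complex.norm_exp, ← Real.exp_add, abs_of_nonneg h2, Complex.neg_re]
        simp only [hκdef]
        ring_nf
      · rw [add_zero]
        exact div_ne_zero (left_ne_zero_of_mul hprod) two_ne_zero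
    · have hκ' : Tendsto (fun i => (-κ i).re) 𝓕 atTop := by
        simp only [Complex.neg_re]
        exact tendsto_neg_atBot_atTop.comp hκ
      obtain ⟨t1, t2⟩ := tendsto_transfer (κ := fun i => -κ i) (a := B) (b := A) (a' := B')
        (b' := A') hη
        (hev.mono fun i h => by
          rw [Complex.neg_re, abs_neg, add_comm]
          exact h.2)
        (hev.mono fun i h => by
          rw [Complex.neg_re, abs_neg, add_comm, neg_neg]
          exact h.1) hκ' hBx hAx
      refine ⟨_, _, _, ?_, t2, t1, by ring, ?_⟩
      · filter_upwards [hs, hκ.eventually_le_atBot 0] with i h1 h2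
        rw [norm_mul, h1, Complex.norm_exp, ← Real.exp_add, abs_of_nonpos h2, neg_neg]
        simp only [hκdef]
        ring_nf
      · rw [zero_add]
        exact div_ne_zero (right_ne_zero_of_mul hprod) two_ne_zero
  obtain ⟨s', x, y, hs', hx, hy, hxy, hxy0⟩ := hout
  have hUq : Tendsto (fun i => s' i * u i q) 𝓕 (𝓝 ((x + y) / rq)) := by
    refine ((hx.add hy).div hrq hrq0).congr' ?_
    filter_upwards [hER, hl0] with i hEi hli
    conv_rhs => rw [(eq_of_wkbPlus_wkbMinus (r' := deriv (wkbAmp V k (E i)) q) (u := u i q)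
      (v := v i q) hli (hr0 q hqI (E i) hEi)).1]
    simp only [hA', hB', Pi.div_apply]
    ring
  have hWq : Tendsto (fun i => s' i * (v i q / l i)) 𝓕 (𝓝 (rq * (x - y))) := by
    have h1 := (hrq.mul (hx.sub hy)).sub (((hder q hqI).mul hUq).div hrq hrq0)
    rw [zero_mul, zero_div, sub_zero] at h1
    refine h1.congr' ?_
    filter_upwards [hER, hl0] with i hEi hli
    rw [(eq_of_wkbPlus_wkbMinus (r' := deriv (wkbAmp V k (E i)) q) (u := u i q)
      (v := v i q) hli (hr0 q hqI (E i) hEi)).2]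
    simp only [hA', hB', Pi.div_apply]
    ring
  refine ⟨s', _, _, hs', hUq, hWq, ?_, div_ne_zero hxy0 hrq0⟩
  have hr4q : rq ^ 4 = 1 - (V q + k) / E₁ := wkbAmp_pow_four V k E₁ q
  rw [← hr4q]
  field_simp
  linear_combination hxy

end Families

/-! ### The actions as functions of the energy -/

theorem hasDerivAt_csqrt {z : ℂ} (hz : z ∈ Complex.slitPlane) :
    HasDerivAt Complex.sqrt (1 / (2 * z.sqrt)) z := by
  refine (Complex.hasDerivAt_sqrt hz).congr_deriv ?_
  have h1 : z ^ (-1 / 2 : ℂ) = (z.sqrt)⁻¹ := by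
    rw [Complex.sqrt, ← Complex.cpow_neg]
    norm_num
  rw [h1]
  ring

section Phase

variable {V : ℂ → ℂ} {Δ R C : ℝ} {k : ℂ} {p q : ℝ}

theorem WKBBounds.continuousOn_csqrt (wb : WKBBounds V Δ R C) (hk : ‖k‖ ≤ Δ)
    (hV : ContinuousOn (fun x : ℝ => V x) (Icc (-1) 1)) {E : ℂ} (hE : R ≤ ‖E‖) :
    ContinuousOn (fun x : ℝ => (1 - (V x + k) / E).sqrt) (Icc (-1) 1) := by
  refine Complex.continuousOn_sqrt.comp
    (continuousOn_const.sub ((hV.add continuousOn_const).div_const E)) fun x hx => ?_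
  exact one_sub_mem_slitPlane ((wb.norm_le k hk E hE x hx).trans_lt (by norm_num))

theorem WKBBounds.norm_csqrt_sub_one_le (wb : WKBBounds V Δ R C) (hk : ‖k‖ ≤ Δ) {E : ℂ}
    (hE : R ≤ ‖E‖) {x : ℝ} (hx : x ∈ Icc (-1 : ℝ) 1) :
    ‖(1 - (V x + k) / E).sqrt - 1‖ ≤ 1 / 8 := by
  rw [← wkbAmp_sq]
  exact (norm_wkbAmp_sq_sub_one_le V k E x).trans (wb.norm_le k hk E hE x hx)

theorem WKBBounds.differentiableAt_wkbPhase (wb : WKBBounds V Δ R C) (hk : ‖k‖ ≤ Δ)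
    (hV : ContinuousOn (fun x : ℝ => V x) (Icc (-1) 1)) (hp : -1 ≤ p) (hpq : p ≤ q) (hq : q ≤ 1)
    {E₁ : ℂ} (hE : R < ‖E₁‖) : DifferentiableAt ℂ (wkbPhase V k p q) E₁ := by
  have hR := wb.R_pos
  have hsub : Icc p q ⊆ Icc (-1 : ℝ) 1 := Icc_subset_Icc hp hq
  have hioc : ∀ x, x ∈ uIoc p q → x ∈ Icc (-1 : ℝ) 1 := fun x hx => by
    rw [uIoc_of_le hpq] at hx
    exact hsub (Ioc_subset_Icc_self hx)
  have hball : ∀ E ∈ Metric.ball E₁ (‖E₁‖ - R), R ≤ ‖E‖ := by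
    intro E hE'
    have h1 := norm_le_norm_add_norm_sub' E₁ E
    rw [Metric.mem_ball, dist_eq_norm, norm_sub_rev] at hE'
    linarith
  have hint : ∀ E, R ≤ ‖E‖ →
      IntervalIntegrable (fun x : ℝ => (1 - (V x + k) / E).sqrt) volume p q := fun E hE =>
    ContinuousOn.intervalIntegrable (by
      rw [uIcc_of_le hpq]
      exact (wb.continuousOn_csqrt hk hV hE).mono hsub)
  have hne : ∀ E, R ≤ ‖E‖ → ∀ x ∈ Icc (-1 : ℝ) 1, 1 / 2 ≤ ‖(1 - (V x + k) / E).sqrt‖ := by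
    intro E hE x hx
    have h1 := wb.norm_csqrt_sub_one_le hk hE hx
    have h2 := norm_le_norm_add_norm_sub' 1 ((1 - (V x + k) / E).sqrt)
    rw [norm_one, norm_sub_rev] at h2
    linarith
  have key := intervalIntegral.hasDerivAt_integral_of_dominated_loc_of_deriv_le (𝕜 := ℂ)
    (μ := volume) (a := p) (b := q) (F := fun E (x : ℝ) => (1 - (V x + k) / E).sqrt)
    (F' := fun E (x : ℝ) => 1 / (2 * (1 - (V x + k) / E).sqrt) * ((V x + k) / E / E))
    (x₀ := E₁) (s := Metric.ball E₁ (‖E₁‖ - R)) (bound := fun _ => 1 / R)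
    (Metric.ball_mem_nhds _ (sub_pos.2 hE))
    (by
      filter_upwards [Metric.ball_mem_nhds E₁ (sub_pos.2 hE)] with E hE'
      exact (intervalIntegrable_iff.1 (hint E (hball E hE'))).aestronglyMeasurable)
    (hint E₁ hE.le)
    (by
      have h1 : ContinuousOn (fun x : ℝ =>
          1 / (2 * (1 - (V x + k) / E₁).sqrt) * ((V x + k) / E₁ / E₁)) (Icc (-1) 1) := by
        have h2 := wb.continuousOn_csqrt hk hV hE.le
        refine ContinuousOn.mul (continuousOn_const.div (continuousOn_const.mul h2) ?_)
          (((hV.add continuousOn_const).div_const E₁).div_const E₁)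
        intro x hx h0
        have h3 := hne E₁ hE.le x hx
        rw [(mul_eq_zero.1 h0).resolve_left two_ne_zero] at h3
        norm_num at h3
      exact (h1.mono fun x hx => hioc x hx).aestronglyMeasurable measurableSet_uIoc)
    (Eventually.of_forall fun x hx E hE' => by
      have hER := hball E hE'
      have hx' := hioc x hx
      rw [norm_mul, norm_div, norm_mul, norm_div _ E, norm_one, Complex.norm_ofNat]
      calc 1 / (2 * ‖(1 - (V x + k) / E).sqrt‖) * (‖(V x + k) / E‖ / ‖E‖)
          ≤ 1 / (2 * (1 / 2)) * (1 / R) := by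
            have h1 := hne E hER x hx'
            have h2 := wb.norm_le k hk E hER x hx'
            have h3 : ‖(V x + k) / E‖ ≤ 1 := by linarith
            gcongr
        _ = 1 / R := by norm_num)
    (by simp)
    (Eventually.of_forall fun x hx E hE' => by
      have hER := hball E hE'
      have hx' := hioc x hx
      have hE0 : E ≠ 0 := norm_pos_iff.1 (hR.trans_le hER)
      have h1 : 1 - (V x + k) / E ∈ Complex.slitPlane :=
        one_sub_mem_slitPlane ((wb.norm_le k hk E hER x hx').trans_lt (by norm_num))
      have h2 : HasDerivAt (fun E => 1 - (V x + k) / E) ((V x + k) / E / E) E := by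
        refine (((hasDerivAt_const E (V x + k)).div (hasDerivAt_id E) hE0).const_sub 1).congr_deriv
          ?_
        simp only [id]
        field_simp
        ring
      exact HasDerivAt.comp (h₂ := Complex.sqrt) E (hasDerivAt_csqrt h1) h2)
  exact key.2.differentiableAt

/-- A branch of `√(-E)` near `E₀`. -/
noncomputable def energyRoot (E₀ E : ℂ) : ℂ := (-E₀).sqrt * (E / E₀).sqrt

theorem energyRoot_sq {E₀ : ℂ} (h : E₀ ≠ 0) (E : ℂ) : energyRoot E₀ E ^ 2 = -E := by
  rw [energyRoot, mul_pow, csqrt_sq, csqrt_sq]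
  field_simp

theorem norm_csqrt_div_sub_one_le {E₀ E : ℂ} (h : E₀ ≠ 0) (hE : ‖E - E₀‖ ≤ ‖E₀‖ / 8) :
    ‖E / E₀ - 1‖ ≤ 1 / 8 := by
  have h1 : E / E₀ - 1 = (E - E₀) / E₀ := by field_simp
  rw [h1, norm_div, div_le_iff₀ (norm_pos_iff.2 h)]
  linarith

theorem differentiableAt_energyRoot {E₀ E : ℂ} (h : E₀ ≠ 0) (hE : ‖E - E₀‖ ≤ ‖E₀‖ / 8) :
    DifferentiableAt ℂ (energyRoot E₀) E := by
  have h1 : E / E₀ ∈ Complex.slitPlane := by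
    have h2 : ‖1 - E / E₀‖ < 1 := by
      rw [norm_sub_rev]
      exact (norm_csqrt_div_sub_one_le h hE).trans_lt (by norm_num)
    simpa using one_sub_mem_slitPlane h2
  exact ((Complex.differentiableAt_sqrt h1).comp E (differentiableAt_id.div_const E₀)).const_mul _

/-- The action `∫ √(V + k - E)` over `[p, q]`, for a branch of the root near the energy `E₀`. -/
noncomputable def wkbAction (V : ℂ → ℂ) (k : ℂ) (p q : ℝ) (E₀ E : ℂ) : ℂ :=
  energyRoot E₀ E * wkbPhase V k p q E

theorem WKBBounds.differentiableAt_wkbAction (wb : WKBBounds V Δ R C) (hk : ‖k‖ ≤ Δ)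
    (hV : ContinuousOn (fun x : ℝ => V x) (Icc (-1) 1)) (hp : -1 ≤ p) (hpq : p ≤ q) (hq : q ≤ 1)
    {E₀ E : ℂ} (hE₀ : E₀ ≠ 0) (hE : ‖E - E₀‖ ≤ ‖E₀‖ / 8) (hER : R < ‖E‖) :
    DifferentiableAt ℂ (wkbAction V k p q E₀) E :=
  (differentiableAt_energyRoot hE₀ hE).mul (wb.differentiableAt_wkbPhase hk hV hp hpq hq hER)

/-- Let `σ = √(-E₀)` and write the integrands at `E` and `E'` as `s = σ g`, `s' = σ g'`. The
difference of their squares is `E - E' = t σ`, so `(s' - s)(g + g') = t`. As `g` and `g'` are close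
to `1`, `Re (s' - s) > 0`. One direction thus works for all three actions, which yields density of
the set where none has zero real part, and strict subharmonicity. -/
theorem WKBBounds.re_wkbAction_lt (wb : WKBBounds V Δ R C) (hk : ‖k‖ ≤ Δ)
    (hV : ContinuousOn (fun x : ℝ => V x) (Icc (-1) 1)) (hp : -1 ≤ p) (hpq : p < q) (hq : q ≤ 1)
    {E₀ E E' : ℂ} (hE₀ : E₀ ≠ 0) (hE : ‖E - E₀‖ ≤ ‖E₀‖ / 8) (hER : R ≤ ‖E‖)
    (hE' : ‖E' - E₀‖ ≤ ‖E₀‖ / 8) (hER' : R ≤ ‖E'‖) {t : ℝ} (ht : 0 < t)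
    (hEE' : E' = E - t * (-E₀).sqrt) :
    (wkbAction V k p q E₀ E).re < (wkbAction V k p q E₀ E').re := by
  have hsub : Icc p q ⊆ Icc (-1 : ℝ) 1 := Icc_subset_Icc hp hq
  have hσ0 : (-E₀).sqrt ≠ 0 := csqrt_ne_zero (neg_ne_zero.2 hE₀)
  set g : ℂ → ℝ → ℂ := fun E x => (E / E₀).sqrt * (1 - (V x + k) / E).sqrt with hg
  have hgre : ∀ E, ‖E - E₀‖ ≤ ‖E₀‖ / 8 → R ≤ ‖E‖ → ∀ x ∈ Icc (-1 : ℝ) 1, 0 < (g E x).re := by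
    intro E hE hER x hx
    have h1 := (_root_.norm_csqrt_sub_one_le (E / E₀)).trans (norm_csqrt_div_sub_one_le hE₀ hE)
    have h2 := wb.norm_csqrt_sub_one_le hk hER hx
    have h3 : g E x - 1 = ((E / E₀).sqrt - 1) * ((1 - (V x + k) / E).sqrt - 1) +
        ((E / E₀).sqrt - 1) + ((1 - (V x + k) / E).sqrt - 1) := by
      simp only [hg]
      ring
    have h4 : ‖g E x - 1‖ ≤ 1 / 8 * (1 / 8) + 1 / 8 + 1 / 8 := by
      rw [h3]
      refine (norm_add₃_le).trans ?_
      rw [norm_mul]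
      gcongr
    have h5 := (abs_le.1 (Complex.abs_re_le_norm (g E x - 1))).1
    simp only [Complex.sub_re, Complex.one_re] at h5
    linarith
  have hcont : ∀ E, R ≤ ‖E‖ → ContinuousOn (fun x => (-E₀).sqrt * g E x) (Icc p q) :=
    fun E hER => continuousOn_const.mul
      (continuousOn_const.mul ((wb.continuousOn_csqrt hk hV hER).mono hsub))
  have hre : ∀ E, R ≤ ‖E‖ → (wkbAction V k p q E₀ E).re =
      ∫ x in p..q, ((-E₀).sqrt * g E x).re := by
    intro E hER
    have h1 : wkbAction V k p q E₀ E = ∫ x in p..q, (-E₀).sqrt * g E x := by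
      rw [wkbAction, energyRoot, wkbPhase, ← intervalIntegral.integral_const_mul]
      simp only [hg, mul_assoc]
    rw [h1]
    exact (Complex.reCLM.intervalIntegral_comp_comm (ContinuousOn.intervalIntegrable (by
      rw [uIcc_of_le hpq.le]
      exact hcont E hER))).symm
  have hEne : ∀ E : ℂ, R ≤ ‖E‖ → E ≠ 0 := fun E h => norm_pos_iff.1 (wb.R_pos.trans_le h)
  have hlt : ∀ x ∈ Icc p q, ((-E₀).sqrt * g E x).re < ((-E₀).sqrt * g E' x).re := by
    intro x hx
    have hsq : ∀ E, R ≤ ‖E‖ → ((-E₀).sqrt * g E x) ^ 2 = V x + k - E := by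
      intro E hER
      have := hEne E hER
      simp only [hg]
      rw [mul_pow, mul_pow, csqrt_sq, csqrt_sq, csqrt_sq]
      field_simp
      ring
    have h1 : (-E₀).sqrt * ((g E' x - g E x) * (-E₀).sqrt * (g E' x + g E x)) =
        (-E₀).sqrt * t := by
      have := hsq E hER
      have := hsq E' hER'
      have h3 : E - E' = t * (-E₀).sqrt := by rw [hEE']; ring
      linear_combination hsq E' hER' - hsq E hER + h3
    have h2 := mul_left_cancel₀ hσ0 h1
    set d := (-E₀).sqrt * g E' x - (-E₀).sqrt * g E x with hd
    set w := g E' x + g E x with hw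
    have hwre : 0 < w.re := by
      rw [hw, Complex.add_re]
      exact add_pos (hgre E' hE' hER' x (hsub hx)) (hgre E hE hER x (hsub hx))
    have h3 : d * w = t := by
      rw [← h2]
      simp only [hd]
      ring
    have h4 := congrArg Complex.re h3
    have h5 := congrArg Complex.im h3
    simp only [Complex.mul_re, Complex.mul_im, Complex.ofReal_re, Complex.ofReal_im] at h4 h5
    have h6 : 0 < d.re := by
      have : d.re * (w.re ^ 2 + w.im ^ 2) = t * w.re := by
        linear_combination w.re * h4 + w.im * h5
      have h7 : 0 < t * w.re := mul_pos ht hwre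
      rw [← this] at h7
      exact pos_of_mul_pos_left h7 (by positivity)
    rw [hd, Complex.sub_re] at h6
    linarith
  rw [hre E hER, hre E' hER']
  refine intervalIntegral.integral_lt_integral_of_continuousOn_of_le_of_exists_lt hpq
    (Complex.continuous_re.comp_continuousOn (hcont E hER))
    (Complex.continuous_re.comp_continuousOn (hcont E' hER'))
    (fun x hx => (hlt x (Ioc_subset_Icc_self hx)).le) ⟨p, left_mem_Icc.2 hpq.le,
      hlt p (left_mem_Icc.2 hpq.le)⟩

theorem WKBBounds.actionVanishes_iff (wb : WKBBounds V Δ R C) (hk : ‖k‖ ≤ Δ)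
    (hV : ContinuousOn (fun x : ℝ => V x) (Icc (-1) 1)) (hp : -1 ≤ p) (hpq : p ≤ q) (hq : q ≤ 1)
    {E₀ : ℂ} (hE₀ : R ≤ ‖E₀‖) :
    ActionVanishes (fun x => V x + k) E₀ p q ↔ (wkbAction V k p q E₀ E₀).re = 0 := by
  have hsub : Icc p q ⊆ Icc (-1 : ℝ) 1 := Icc_subset_Icc hp hq
  have h0 : E₀ ≠ 0 := norm_pos_iff.1 (wb.R_pos.trans_le hE₀)
  rw [_root_.actionVanishes_iff
    (s := fun x : ℝ => energyRoot E₀ E₀ * (1 - (V x + k) / E₀).sqrt) hpq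
    (continuousOn_const.mul ((wb.continuousOn_csqrt hk hV hE₀).mono
      (Ioo_subset_Icc_self.trans hsub))), intervalIntegral.integral_const_mul]
  · rfl
  · intro x _
    rw [mul_pow, energyRoot_sq h0, csqrt_sq]
    field_simp
    ring
  · intro x hx
    refine mul_ne_zero (fun h => h0 ?_) (csqrt_ne_zero (Complex.slitPlane_ne_zero
      (one_sub_mem_slitPlane ((wb.norm_le k hk E₀ hE₀ x
        (hsub (Ioo_subset_Icc_self hx))).trans_lt (by norm_num)))))
    have := energyRoot_sq h0 E₀
    rw [h] at this
    simpa using this.symm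

end Phase

/-! ### Asymptotics of the shooting function for a potential with two jumps -/

/-- `u` and `v = u'` solve `-h² u'' + (V + k) u = E u` on `[p, q]`. -/
def SolvesOn (V : ℂ → ℂ) (k : ℂ) (p q h : ℝ) (E : ℂ) (u v : ℝ → ℂ) : Prop :=
  (∀ x ∈ Icc p q, HasDerivWithinAt u (v x) (Icc p q) x) ∧
  ∀ x ∈ Icc p q, HasDerivWithinAt v ((V x + k - E) / (h : ℂ) ^ 2 * u x) (Icc p q) x

/-- A family of solutions with Cauchy data `(0, 1)` at `-1` for the potential that equals `V + k₀`,
`V + k₁`, `V + k₂` on the intervals cut out by `β < β'`. -/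
def ShootingFamily (V : ℂ → ℂ) (k₀ k₁ k₂ : ℂ) (β β' : ℝ) (u v : ℝ → ℂ → ℝ → ℂ) : Prop :=
  ∀ h : ℝ, 0 < h → ∀ E : ℂ, u h E (-1) = 0 ∧ v h E (-1) = 1 ∧
    SolvesOn V k₀ (-1) β h E (u h E) (v h E) ∧ SolvesOn V k₁ β β' h E (u h E) (v h E) ∧
    SolvesOn V k₂ β' 1 h E (u h E) (v h E)

/-- The sum of the absolute values of the real parts of the actions of the three intervals. -/
noncomputable def totalGrowth (V : ℂ → ℂ) (k₀ k₁ k₂ : ℂ) (β β' : ℝ) (E₀ E : ℂ) : ℝ :=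
  |(wkbAction V k₀ (-1) β E₀ E).re| + |(wkbAction V k₁ β β' E₀ E).re| +
    |(wkbAction V k₂ β' 1 E₀ E).re|

section Asymptotics

variable {V : ℂ → ℂ} {Δ R C : ℝ} {k k₀ k₁ k₂ : ℂ} {β β' p q : ℝ} {u v : ℝ → ℂ → ℝ → ℂ} {E₀ E₁ : ℂ}

theorem eventually_pos_fst : ∀ᶠ i : ℝ × ℂ in 𝓝[>] 0 ×ˢ 𝓝 E₁, 0 < i.1 :=
  tendsto_fst.eventually (eventually_mem_nhdsWithin : ∀ᶠ h : ℝ in 𝓝[>] 0, h ∈ Ioi 0)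

theorem tendsto_norm_energyRoot_div (hE₀ : E₀ ≠ 0) (hE₁ : ‖E₁ - E₀‖ ≤ ‖E₀‖ / 8) :
    Tendsto (fun i : ℝ × ℂ => ‖energyRoot E₀ i.2 / (i.1 : ℂ)‖) (𝓝[>] 0 ×ˢ 𝓝 E₁) atTop := by
  have h1 : energyRoot E₀ E₁ ≠ 0 := by
    intro h
    have h2 := energyRoot_sq hE₀ E₁
    rw [h] at h2
    have h3 : E₁ = 0 := by simpa using h2.symm
    rw [h3, zero_sub, norm_neg] at hE₁
    have := norm_pos_iff.2 hE₀
    linarith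
  have h2 : Tendsto (fun i : ℝ × ℂ => ‖energyRoot E₀ i.2‖) (𝓝[>] 0 ×ˢ 𝓝 E₁)
      (𝓝 ‖energyRoot E₀ E₁‖) :=
    ((differentiableAt_energyRoot hE₀ hE₁).continuousAt.norm.tendsto).comp tendsto_snd
  have h3 : Tendsto (fun i : ℝ × ℂ => i.1⁻¹) (𝓝[>] 0 ×ˢ 𝓝 E₁) atTop :=
    tendsto_inv_nhdsGT_zero.comp tendsto_fst
  refine (h2.pos_mul_atTop (norm_pos_iff.2 h1) h3).congr' ?_
  filter_upwards [eventually_pos_fst] with i hi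
  rw [norm_div, Complex.norm_real, Real.norm_eq_abs, abs_of_pos hi, div_eq_mul_inv]

theorem re_energyRoot_div_mul {h : ℝ} (E₀ E : ℂ) (k : ℂ) (p q : ℝ) :
    (energyRoot E₀ E / (h : ℂ) * wkbPhase V k p q E).re = (wkbAction V k p q E₀ E).re / h := by
  rw [wkbAction, div_mul_eq_mul_div, Complex.div_ofReal_re]

theorem abs_re_energyRoot_div_mul {h : ℝ} (hh : 0 < h) (E₀ E : ℂ) (k : ℂ) (p q : ℝ) :
    |(energyRoot E₀ E / (h : ℂ) * wkbPhase V k p q E).re| =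
      |(wkbAction V k p q E₀ E).re| / h := by
  rw [re_energyRoot_div_mul, abs_div, abs_of_pos hh]

/-- Multiplying the solution by the large parameter `l = energyRoot E₀ E / h` makes its initial data
`u = 0`, `v / l = 1`, and brings the equation to the form `u'' = l² (1 - (V + k) / E) u`. -/
theorem SolvesOn.scaled {h : ℝ} (hh : h ≠ 0) (hE₀ : E₀ ≠ 0) {E : ℂ} (hE : E ≠ 0) {u v : ℝ → ℂ}
    (hs : SolvesOn V k p q h E u v) :
    (∀ x ∈ Icc p q, HasDerivWithinAt (fun x => energyRoot E₀ E / h * u x)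
      (energyRoot E₀ E / h * v x) (Icc p q) x) ∧
    ∀ x ∈ Icc p q, HasDerivWithinAt (fun x => energyRoot E₀ E / h * v x)
      ((energyRoot E₀ E / h) ^ 2 * (1 - (V x + k) / E) * (energyRoot E₀ E / h * u x))
      (Icc p q) x := by
  refine ⟨fun x hx => (hs.1 x hx).const_mul _, fun x hx =>
    ((hs.2 x hx).const_mul _).congr_deriv ?_⟩
  have hhC : (h : ℂ) ≠ 0 := by exact_mod_cast hh
  have h1 : (energyRoot E₀ E / h) ^ 2 * (1 - (V x + k) / E) = (V x + k - E) / (h : ℂ) ^ 2 := by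
    rw [div_pow, energyRoot_sq hE₀]
    field_simp
    ring
  rw [h1]
  ring

theorem eventually_scaled (hE₀ : E₀ ≠ 0) (hE₁ : E₁ ≠ 0)
    (hs : ∀ h : ℝ, 0 < h → ∀ E, SolvesOn V k p q h E (u h E) (v h E)) :
    (∀ᶠ i : ℝ × ℂ in 𝓝[>] 0 ×ˢ 𝓝 E₁, ∀ x ∈ Icc p q,
      HasDerivWithinAt (fun x => energyRoot E₀ i.2 / (i.1 : ℂ) * u i.1 i.2 x)
        (energyRoot E₀ i.2 / (i.1 : ℂ) * v i.1 i.2 x) (Icc p q) x) ∧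
    ∀ᶠ i : ℝ × ℂ in 𝓝[>] 0 ×ˢ 𝓝 E₁, ∀ x ∈ Icc p q,
      HasDerivWithinAt (fun x => energyRoot E₀ i.2 / (i.1 : ℂ) * v i.1 i.2 x)
        ((energyRoot E₀ i.2 / (i.1 : ℂ)) ^ 2 * (1 - (V x + k) / i.2) *
          (energyRoot E₀ i.2 / (i.1 : ℂ) * u i.1 i.2 x)) (Icc p q) x := by
  have hne : ∀ᶠ i : ℝ × ℂ in 𝓝[>] 0 ×ˢ 𝓝 E₁, i.2 ≠ 0 :=
    tendsto_snd.eventually (eventually_ne_nhds hE₁)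
  constructor
  · filter_upwards [eventually_pos_fst, hne] with i h1 h2
    exact ((hs i.1 h1 i.2).scaled h1.ne' hE₀ h2).1
  · filter_upwards [eventually_pos_fst, hne] with i h1 h2
    exact ((hs i.1 h1 i.2).scaled h1.ne' hE₀ h2).2

/-- Valid also at energies where an action has zero real part; it supplies the upper bound that
Harnack's inequality needs. -/
theorem WKBBounds.shooting_bounded (wb : WKBBounds V Δ R C)
    (hk₀ : ‖k₀‖ ≤ Δ) (hk₁ : ‖k₁‖ ≤ Δ) (hk₂ : ‖k₂‖ ≤ Δ)
    (hβ : -1 < β) (hββ' : β < β') (hβ' : β' < 1) (hE₀ : E₀ ≠ 0) (hE₁ : ‖E₁ - E₀‖ ≤ ‖E₀‖ / 8)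
    (hR : R < ‖E₁‖) (hs : ShootingFamily V k₀ k₁ k₂ β β' u v) :
    ∃ K, ∀ᶠ i : ℝ × ℂ in 𝓝[>] 0 ×ˢ 𝓝 E₁, ‖energyRoot E₀ i.2 / (i.1 : ℂ) * u i.1 i.2 1‖ ≤
      K * Real.exp (totalGrowth V k₀ k₁ k₂ β β' E₀ i.2 / i.1) := by
  have hE₁0 : E₁ ≠ 0 := norm_pos_iff.1 (wb.R_pos.trans hR)
  have hl := tendsto_norm_energyRoot_div hE₀ hE₁
  have hER : ∀ᶠ i : ℝ × ℂ in 𝓝[>] 0 ×ˢ 𝓝 E₁, R ≤ ‖i.2‖ := by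
    have h1 : Tendsto (fun i : ℝ × ℂ => ‖i.2‖) (𝓝[>] 0 ×ˢ 𝓝 E₁) (𝓝 ‖E₁‖) :=
      tendsto_snd.norm
    exact (h1.eventually (lt_mem_nhds hR)).mono fun i hi => hi.le
  obtain ⟨a0, b0⟩ := eventually_scaled (E₁ := E₁) hE₀ hE₁0 fun h hh E => (hs h hh E).2.2.1
  obtain ⟨a1, b1⟩ := eventually_scaled (E₁ := E₁) hE₀ hE₁0 fun h hh E => (hs h hh E).2.2.2.1
  obtain ⟨a2, b2⟩ := eventually_scaled (E₁ := E₁) hE₀ hE₁0 fun h hh E => (hs h hh E).2.2.2.2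
  have s0 := wb.bounded_step (Ψ := fun _ => 0) hk₀ le_rfl hβ.le (by linarith) hl hER a0 b0
    ⟨1, by
      filter_upwards [eventually_pos_fst, hl.eventually_ge_atTop 1] with i hi hl1
      have hl0 : energyRoot E₀ i.2 / (i.1 : ℂ) ≠ 0 := by
        intro h
        rw [h] at hl1
        norm_num at hl1
      rw [(hs i.1 hi i.2).1, (hs i.1 hi i.2).2.1]
      simp [div_self hl0]⟩
  have s1 := wb.bounded_step hk₁ hβ.le hββ'.le hβ'.le hl hER a1 b1 s0
  obtain ⟨K, hK⟩ := wb.bounded_step hk₂ (by linarith) hβ'.le le_rfl hl hER a2 b2 s1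
  refine ⟨K, ?_⟩
  filter_upwards [hK, eventually_pos_fst] with i hi hpos
  refine (le_add_of_nonneg_right (norm_nonneg _)).trans (hi.trans (le_of_eq ?_))
  rw [abs_re_energyRoot_div_mul hpos, abs_re_energyRoot_div_mul hpos, abs_re_energyRoot_div_mul hpos,
    totalGrowth, zero_add, add_div, add_div]

theorem WKBBounds.tendsto_re_phase (wb : WKBBounds V Δ R C) (hk : ‖k‖ ≤ Δ)
    (hV : ContinuousOn (fun x : ℝ => V x) (Icc (-1) 1)) (hp : -1 ≤ p) (hpq : p ≤ q) (hq : q ≤ 1)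
    (hE₀ : E₀ ≠ 0) (hE₁ : ‖E₁ - E₀‖ ≤ ‖E₀‖ / 8) (hR : R < ‖E₁‖)
    (hne : (wkbAction V k p q E₀ E₁).re ≠ 0) :
    Tendsto (fun i : ℝ × ℂ => (energyRoot E₀ i.2 / (i.1 : ℂ) * wkbPhase V k p q i.2).re)
      (𝓝[>] 0 ×ˢ 𝓝 E₁) atTop ∨
    Tendsto (fun i : ℝ × ℂ => (energyRoot E₀ i.2 / (i.1 : ℂ) * wkbPhase V k p q i.2).re)
      (𝓝[>] 0 ×ˢ 𝓝 E₁) atBot := by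
  simp only [re_energyRoot_div_mul]
  simp only [div_eq_mul_inv]
  have h2 : Tendsto (fun i : ℝ × ℂ => (wkbAction V k p q E₀ i.2).re) (𝓝[>] 0 ×ˢ 𝓝 E₁)
      (𝓝 (wkbAction V k p q E₀ E₁).re) :=
    ((Complex.continuous_re.continuousAt.comp
      (wb.differentiableAt_wkbAction hk hV hp hpq hq hE₀ hE₁ hR).continuousAt).tendsto).comp
      tendsto_snd
  have h3 : Tendsto (fun i : ℝ × ℂ => i.1⁻¹) (𝓝[>] 0 ×ˢ 𝓝 E₁) atTop :=
    tendsto_inv_nhdsGT_zero.comp tendsto_fst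
  rcases lt_or_gt_of_ne hne with h | h
  · exact Or.inr (h2.neg_mul_atTop h h3)
  · exact Or.inl (h2.pos_mul_atTop h h3)

/-- This is where the jumps must be nonzero: a pure mode on the left has a slope that is not
characteristic on the right, so it excites both modes there. -/
theorem jump_ne {a w₀ w₁ E U W : ℂ} (hE : E ≠ 0) (hw : w₀ ≠ w₁)
    (h : W ^ 2 = (1 - (a + w₀) / E) * U ^ 2) (hU : U ≠ 0) :
    W ^ 2 ≠ (1 - (a + w₁) / E) * U ^ 2 := by
  rw [h]
  intro h1
  have h2 := mul_right_cancel₀ (pow_ne_zero 2 hU) h1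
  field_simp at h2
  exact hw (by linear_combination -h2)

/-- The data `(0, 1)` at `-1` contain both modes. `WKBBounds.tendsto_step` leaves one at the end of
each interval, and `jump_ne` restores both at each jump; the last limit has `U ≠ 0`. -/
theorem WKBBounds.shooting_tendsto (wb : WKBBounds V Δ R C)
    (hk₀ : ‖k₀‖ ≤ Δ) (hk₁ : ‖k₁‖ ≤ Δ) (hk₂ : ‖k₂‖ ≤ Δ) (h01 : k₀ ≠ k₁) (h12 : k₁ ≠ k₂)
    (hV : ContinuousOn (fun x : ℝ => V x) (Icc (-1) 1))
    (hβ : -1 < β) (hββ' : β < β') (hβ' : β' < 1) (hE₀ : E₀ ≠ 0) (hE₁ : ‖E₁ - E₀‖ ≤ ‖E₀‖ / 8)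
    (hR : R < ‖E₁‖) (hs : ShootingFamily V k₀ k₁ k₂ β β' u v)
    (hA₀ : (wkbAction V k₀ (-1) β E₀ E₁).re ≠ 0) (hA₁ : (wkbAction V k₁ β β' E₀ E₁).re ≠ 0)
    (hA₂ : (wkbAction V k₂ β' 1 E₀ E₁).re ≠ 0) :
    ∃ L : ℝ, 0 < L ∧ Tendsto (fun i : ℝ × ℂ =>
      Real.exp (-(totalGrowth V k₀ k₁ k₂ β β' E₀ i.2 / i.1)) *
        ‖energyRoot E₀ i.2 / (i.1 : ℂ) * u i.1 i.2 1‖) (𝓝[>] 0 ×ˢ 𝓝 E₁) (𝓝 L) := by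
  have hE₁0 : E₁ ≠ 0 := norm_pos_iff.1 (wb.R_pos.trans hR)
  have hl := tendsto_norm_energyRoot_div hE₀ hE₁
  have hE : Tendsto (fun i : ℝ × ℂ => i.2) (𝓝[>] 0 ×ˢ 𝓝 E₁) (𝓝 E₁) := tendsto_snd
  obtain ⟨a0, b0⟩ := eventually_scaled (E₁ := E₁) hE₀ hE₁0 fun h hh E => (hs h hh E).2.2.1
  obtain ⟨a1, b1⟩ := eventually_scaled (E₁ := E₁) hE₀ hE₁0 fun h hh E => (hs h hh E).2.2.2.1
  obtain ⟨a2, b2⟩ := eventually_scaled (E₁ := E₁) hE₀ hE₁0 fun h hh E => (hs h hh E).2.2.2.2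
  obtain ⟨s0, U0, W0, n0, tU0, tW0, e0, z0⟩ := wb.tendsto_step (Ψ := fun _ => 0) hk₀ le_rfl hβ.le
    (by linarith) hl hR hE
    (wb.tendsto_re_phase hk₀ hV le_rfl hβ.le (by linarith) hE₀ hE₁ hR hA₀) a0 b0
    ⟨fun _ => 1, 0, 1, by simp, by
      refine tendsto_const_nhds.congr' ?_
      filter_upwards [eventually_pos_fst] with i hi
      simp [(hs i.1 hi i.2).1], by
      refine tendsto_const_nhds.congr' ?_
      filter_upwards [eventually_pos_fst, hl.eventually_ge_atTop 1] with i hi hl1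
      have hl0 : energyRoot E₀ i.2 / (i.1 : ℂ) ≠ 0 := by
        intro h
        rw [h] at hl1
        norm_num at hl1
      rw [(hs i.1 hi i.2).2.1]
      simp [div_self hl0], by simp⟩
  obtain ⟨s1, U1, W1, n1, tU1, tW1, e1, z1⟩ := wb.tendsto_step hk₁ hβ.le hββ'.le hβ'.le hl hR hE
    (wb.tendsto_re_phase hk₁ hV hβ.le hββ'.le hβ'.le hE₀ hE₁ hR hA₁) a1 b1
    ⟨s0, U0, W0, n0, tU0, tW0, jump_ne hE₁0 h01 e0 z0⟩
  obtain ⟨s2, U2, W2, n2, tU2, tW2, e2, z2⟩ := wb.tendsto_step hk₂ (by linarith) hβ'.le le_rfl hl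
    hR hE (wb.tendsto_re_phase hk₂ hV (by linarith) hβ'.le le_rfl hE₀ hE₁ hR hA₂) a2 b2
    ⟨s1, U1, W1, n1, tU1, tW1, jump_ne hE₁0 h12 e1 z1⟩
  refine ⟨‖U2‖, norm_pos_iff.2 z2, tU2.norm.congr' ?_⟩
  filter_upwards [n2, eventually_pos_fst] with i hi hpos
  rw [norm_mul, hi, abs_re_energyRoot_div_mul hpos, abs_re_energyRoot_div_mul hpos,
    abs_re_energyRoot_div_mul hpos, totalGrowth, zero_add, add_div, add_div]

end Asymptotics

/-! ### Harmonic functions: Harnack's inequality and limits on a dense set -/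

open InnerProductSpace in
/-- **Harnack's inequality**, upper bound. -/
theorem InnerProductSpace.HarmonicOnNhd.le_of_nonneg {f : ℂ → ℝ} {c w : ℂ} {R : ℝ}
    (hf : HarmonicOnNhd f (Metric.closedBall c R)) (h0 : ∀ z ∈ Metric.closedBall c R, 0 ≤ f z)
    (hw : w ∈ Metric.ball c R) : f w ≤ (R + ‖w - c‖) / (R - ‖w - c‖) * f c := by
  have hR : 0 < R := dist_nonneg.trans_lt hw
  have hw' : ‖w - c‖ < R := by rwa [← mem_ball_iff_norm]
  have hcont : ContinuousOn f (Metric.sphere c |R|) := by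
    rw [abs_of_pos hR]
    exact hf.continuousOn.mono Metric.sphere_subset_closedBall
  have hf' : HarmonicOnNhd f (Metric.closedBall c |R|) := by rwa [abs_of_pos hR]
  conv_lhs => rw [← hf.circleAverage_re_herglotzRieszKernel_smul hw]
  rw [← hf'.circleAverage_eq, ← smul_eq_mul, ← Real.circleAverage_smul]
  refine Real.circleAverage_mono (ContinuousOn.circleIntegrable' ?_)
    (hcont.const_smul _).circleIntegrable' fun z hz => ?_
  · refine ContinuousOn.smul ?_ hcont
    rw [abs_of_pos hR]
    have hne : ∀ z ∈ Metric.sphere c R, z - c - (w - c) ≠ 0 := fun z hz h => by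
      have h1 : z - c = w - c := sub_eq_zero.1 h
      rw [mem_sphere_iff_norm, h1] at hz
      exact hw'.ne hz
    refine Complex.continuous_re.comp_continuousOn ?_
    rw [herglotzRieszKernel_fun_def]
    exact ContinuousOn.div (by fun_prop) (by fun_prop) hne
  · rw [abs_of_pos hR] at hz
    simp only [Pi.smul_apply', Pi.smul_apply, smul_eq_mul, Function.comp_apply,
      herglotzRieszKernel_def]
    exact mul_le_mul_of_nonneg_right (re_herglotzRieszKernel_le hz hw)
      (h0 z (Metric.sphere_subset_closedBall hz))

open InnerProductSpace in
/-- If harmonic functions on a disk are bounded above and converge on a dense set to a continuous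
function, then the limit has the mean value property. -/
theorem circleAverage_eq_of_tendsto_on_dense {ι : Type*} {l : Filter ι} [l.NeBot]
    [l.IsCountablyGenerated] {U : ι → ℂ → ℝ} {Φ : ℂ → ℝ} {c : ℂ} {ρ M : ℝ} (hρ : 0 < ρ)
    {S : Set ℂ} (hS : ∀ z ∈ Metric.ball c (3 * ρ), z ∈ closure (S ∩ Metric.ball c (3 * ρ)))
    (hU : ∀ᶠ i in l, HarmonicOnNhd (U i) (Metric.ball c (8 * ρ)))
    (hM : ∀ᶠ i in l, ∀ z ∈ Metric.ball c (8 * ρ), U i z ≤ M)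
    (hΦ : ContinuousOn Φ (Metric.ball c (3 * ρ)))
    (hlim : ∀ z ∈ S ∩ Metric.ball c (3 * ρ), Tendsto (fun i => U i z) l (𝓝 (Φ z))) :
    Real.circleAverage Φ c ρ = Φ c := by
  have hsub : ∀ {w : ℂ} {r s : ℝ}, dist w c + r < s →
      Metric.closedBall w r ⊆ Metric.ball c s := fun {w r s} h z hz => by
    rw [Metric.mem_closedBall] at hz
    rw [Metric.mem_ball]
    linarith [dist_triangle z w c]
  -- A point of the dense set within `ρ` of the centre: convergence there is the only source of a
  -- lower bound.
  obtain ⟨E₁, ⟨hE₁S, hE₁b⟩, hE₁⟩ := Metric.mem_closure_iff.1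
    (hS c (Metric.mem_ball_self (by linarith))) ρ hρ
  rw [dist_comm] at hE₁
  -- the harmonic functions are uniformly bounded below
  obtain ⟨B, hB0, hB⟩ : ∃ B, 0 ≤ B ∧ ∀ᶠ i in l, ∀ w ∈ Metric.ball c (3 * ρ), M - U i w ≤ B := by
    have h1 : ∀ᶠ i in l, Φ E₁ - 1 < U i E₁ :=
      (hlim E₁ ⟨hE₁S, hE₁b⟩).eventually (lt_mem_nhds (by linarith))
    have key : ∀ᶠ i in l, ∀ w ∈ Metric.ball c (3 * ρ), M - U i w ≤ 5 * (M - Φ E₁ + 1) := by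
      filter_upwards [hU, hM, h1] with i hi hMi hi1 w hw
      rw [Metric.mem_ball] at hw
      have hs : Metric.closedBall E₁ (6 * ρ) ⊆ Metric.ball c (8 * ρ) := hsub (by linarith)
      have hwE : ‖w - E₁‖ < 4 * ρ := by
        rw [← dist_eq_norm]
        linarith [dist_triangle_right w E₁ c]
      have hh : HarmonicOnNhd (fun z => M - U i z) (Metric.closedBall E₁ (6 * ρ)) :=
        (harmonicOnNhd_const M).sub (hi.mono hs)
      have h2 := hh.le_of_nonneg (w := w) (fun z hz => sub_nonneg.2 (hMi z (hs hz)))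
        (by rw [mem_ball_iff_norm]; linarith)
      refine h2.trans ?_
      -- The Harnack quotient for radius `6ρ` and distance less than `4ρ` is at most `10 / 2`.
      have h3 : (6 * ρ + ‖w - E₁‖) / (6 * ρ - ‖w - E₁‖) ≤ 5 := by
        rw [div_le_iff₀ (by linarith)]
        linarith
      have h4 : 0 ≤ M - U i E₁ :=
        sub_nonneg.2 (hMi E₁ (hs (Metric.mem_closedBall_self (by linarith))))
      exact (mul_le_mul_of_nonneg_right h3 h4).trans (by linarith)
    exact ⟨|5 * (M - Φ E₁ + 1)|, abs_nonneg _, key.mono fun i hi w hw =>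
      (hi w hw).trans (le_abs_self _)⟩
  -- hence uniformly Lipschitz
  have hLip : ∀ᶠ i in l, ∀ z ∈ Metric.ball c (3 * ρ), ∀ w ∈ Metric.ball c (3 * ρ), dist w z < ρ →
      U i z - U i w ≤ 2 * B / ρ * dist w z := by
    filter_upwards [hU, hM, hB] with i hi hMi hBi z hz w hw hzw
    have hz' := hz
    rw [Metric.mem_ball] at hz'
    have hs : Metric.closedBall z (2 * ρ) ⊆ Metric.ball c (8 * ρ) := hsub (by linarith)
    have hh : HarmonicOnNhd (fun z => M - U i z) (Metric.closedBall z (2 * ρ)) :=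
      (harmonicOnNhd_const M).sub (hi.mono hs)
    have h2 := hh.le_of_nonneg (w := w) (fun z hz => sub_nonneg.2 (hMi z (hs hz)))
      (by rw [Metric.mem_ball]; linarith)
    rw [← dist_eq_norm] at h2
    set d := dist w z
    have hd : 0 ≤ d := dist_nonneg
    have h3 : (2 * ρ + d) / (2 * ρ - d) ≤ 1 + 2 * d / ρ := by
      rw [div_le_iff₀ (by linarith)]
      have h5 : 2 * d / ρ * ρ = 2 * d := by field_simp
      have h6 : 0 ≤ 2 * d / ρ := by positivity
      nlinarith
    have h4 : 0 ≤ M - U i z :=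
      sub_nonneg.2 (hMi z (hs (Metric.mem_closedBall_self (by linarith))))
    have h5 := h2.trans (mul_le_mul_of_nonneg_right h3 h4)
    have h6 : 2 * d / ρ * (M - U i z) ≤ 2 * d / ρ * B :=
      mul_le_mul_of_nonneg_left (hBi z hz) (by positivity)
    have h7 : 2 * B / ρ * d = 2 * d / ρ * B := by ring
    rw [h7]
    linarith
  -- Density and the uniform Lipschitz bound extend the convergence to every point, by continuity of
  -- `Φ`.
  have hlim' : ∀ z ∈ Metric.ball c (3 * ρ), Tendsto (fun i => U i z) l (𝓝 (Φ z)) := by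
    intro z hz
    rw [Metric.tendsto_nhds]
    intro ε hε
    have hΦz : ∀ᶠ w in 𝓝 z, |Φ w - Φ z| < ε / 3 := by
      have := (hΦ.continuousAt (Metric.isOpen_ball.mem_nhds hz)).eventually
        (Metric.ball_mem_nhds _ (by linarith : (0 : ℝ) < ε / 3))
      filter_upwards [this] with w hw
      rwa [← Real.dist_eq]
    have hL : ∀ᶠ w in 𝓝 z, 2 * B / ρ * dist w z < ε / 3 := by
      have : Tendsto (fun w => 2 * B / ρ * dist w z) (𝓝 z) (𝓝 (2 * B / ρ * dist z z)) :=
        (continuous_const.mul (continuous_id.dist continuous_const)).tendsto z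
      rw [dist_self, mul_zero] at this
      exact this.eventually (gt_mem_nhds (by linarith))
    obtain ⟨w, ⟨⟨hw1, hw2⟩, hw3⟩, hwS⟩ := (mem_closure_iff_nhds.1 (hS z hz) _
      ((hΦz.and hL).and (Metric.ball_mem_nhds z hρ)))
    filter_upwards [hLip, (hlim w hwS).eventually
      (Metric.ball_mem_nhds _ (by linarith : (0 : ℝ) < ε / 3))] with i hi hiw
    have h1 := hi z hz w hwS.2 hw3
    have h2 := hi w hwS.2 z hz (by rw [dist_comm]; exact hw3)
    rw [dist_comm z w] at h2
    replace hiw : |U i w - Φ w| < ε / 3 := by rwa [← Real.dist_eq]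
    rw [Real.dist_eq, abs_lt]
    rw [abs_lt] at hiw hw1
    constructor <;> linarith [hiw.1, hiw.2, hw1.1, hw1.2]
  have hcirc : ∀ θ, circleMap c ρ θ ∈ Metric.ball c (3 * ρ) := fun θ => by
    rw [mem_ball_iff_norm]
    have := circleMap_mem_sphere c hρ.le θ
    rw [mem_sphere_iff_norm] at this
    linarith
  have havg : Tendsto (fun i => Real.circleAverage (U i) c ρ) l (𝓝 (Real.circleAverage Φ c ρ)) := by
    simp only [Real.circleAverage_def]
    refine Tendsto.const_smul ?_ _
    refine intervalIntegral.tendsto_integral_filter_of_dominated_convergence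
      (fun _ => |M| + B) ?_ ?_ intervalIntegrable_const ?_
    · filter_upwards [hU] with i hi
      refine Continuous.aestronglyMeasurable ?_
      refine hi.continuousOn.comp_continuous (continuous_circleMap c ρ) fun θ => ?_
      exact Metric.ball_subset_ball (by linarith) (hcirc θ)
    · filter_upwards [hM, hB] with i hi hBi
      refine Eventually.of_forall fun θ _ => ?_
      have h1 := hi _ (Metric.ball_subset_ball (by linarith) (hcirc θ))
      have h2 := hBi _ (hcirc θ)
      rw [Real.norm_eq_abs, abs_le]
      constructor <;> linarith [neg_abs_le M, le_abs_self M]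
    · exact Eventually.of_forall fun θ _ => hlim' _ (hcirc θ)
  refine tendsto_nhds_unique (havg.congr' ?_) (hlim' c (Metric.mem_ball_self (by linarith)))
  filter_upwards [hU] with i hi
  refine InnerProductSpace.HarmonicOnNhd.circleAverage_eq (hi.mono ?_)
  rw [abs_of_pos hρ]
  exact Metric.closedBall_subset_ball (by linarith)

/-! ### Zeros of the shooting function -/

/-- A continuous function that increases strictly in some direction has a dense nonvanishing
set. -/
theorem eventually_ne_zero_of_lt {f : ℂ → ℝ} {z σ : ℂ} (hf : ContinuousAt f z)
    (hmono : ∀ᶠ t : ℝ in 𝓝[>] 0, f z < f (z - t * σ)) :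
    ∀ᶠ t : ℝ in 𝓝[>] 0, f (z - t * σ) ≠ 0 := by
  rcases le_or_gt 0 (f z) with h | h
  · exact hmono.mono fun t ht => (h.trans_lt ht).ne'
  · have h1 : Tendsto (fun t : ℝ => z - t * σ) (𝓝[>] 0) (𝓝 z) := by
      have : Tendsto (fun t : ℝ => z - t * σ) (𝓝 0) (𝓝 (z - (0 : ℝ) * σ)) :=
        (by fun_prop : Continuous fun t : ℝ => z - t * σ).tendsto 0
      simpa using this.mono_left nhdsWithin_le_nhds
    exact ((hf.tendsto.comp h1).eventually (gt_mem_nhds h)).mono fun t ht => ht.ne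

/-- The real part has the mean value property, so its absolute value is subharmonic. If it vanishes
at the centre, monotonicity along `σ` provides a point of the circle where it is positive, so the
average is positive. -/
theorem abs_re_le_circleAverage {A : ℂ → ℂ} {c σ : ℂ} {ρ s : ℝ} (hρ : 0 < ρ) (hs : ρ < s)
    (hA : DifferentiableOn ℂ A (Metric.ball c s)) (hσ : σ ≠ 0)
    (hmono : ∀ t : ℝ, 0 < t → c - t * σ ∈ Metric.ball c s → (A c).re < (A (c - t * σ)).re) :
    |(A c).re| ≤ Real.circleAverage (fun z => |(A z).re|) c ρ ∧
    ((A c).re = 0 → |(A c).re| < Real.circleAverage (fun z => |(A z).re|) c ρ) := by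
  have hcb : Metric.closedBall c ρ ⊆ Metric.ball c s := Metric.closedBall_subset_ball hs
  have hre : Real.circleAverage (fun z => (A z).re) c ρ = (A c).re := by
    refine InnerProductSpace.HarmonicOnNhd.circleAverage_eq fun z hz => ?_
    rw [abs_of_pos hρ] at hz
    exact (hA.analyticAt (Metric.isOpen_ball.mem_nhds (hcb hz))).harmonicAt_re
  constructor
  · conv_lhs => rw [← hre]
    exact Real.abs_circleAverage_le_circleAverage_abs
  intro h0
  rw [h0, abs_zero, Real.circleAverage_def, smul_eq_mul]
  refine mul_pos (by positivity) ?_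
  have hcont : Continuous fun θ => |(A (circleMap c ρ θ)).re| := by
    refine continuous_abs.comp (Complex.continuous_re.comp
      (hA.continuousOn.comp_continuous (continuous_circleMap c ρ) fun θ => hcb ?_))
    exact Metric.sphere_subset_closedBall (circleMap_mem_sphere c hρ.le θ)
  have hσ' := norm_pos_iff.2 hσ
  have hmem : c - (ρ / ‖σ‖ : ℝ) * σ ∈ Metric.sphere c ρ := by
    rw [mem_sphere_iff_norm, sub_sub_cancel_left, norm_neg, norm_mul, Complex.norm_real,
      Real.norm_eq_abs, abs_of_pos (by positivity)]
    field_simp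
  have hpos := hmono (ρ / ‖σ‖) (by positivity) (hcb (Metric.sphere_subset_closedBall hmem))
  rw [h0] at hpos
  rw [← abs_of_pos hρ, ← image_circleMap_Ioc] at hmem
  obtain ⟨θ, hθ, hθe⟩ := hmem
  refine intervalIntegral.integral_pos (by positivity) hcont.continuousOn
    (fun _ _ => abs_nonneg _) ⟨θ, Ioc_subset_Icc_self hθ, ?_⟩
  rw [abs_of_pos hρ] at hθe
  rw [hθe]
  exact abs_pos.2 hpos.ne'

section Zeros

variable {V : ℂ → ℂ} {Δ R C : ℝ} {k₀ k₁ k₂ : ℂ} {β β' : ℝ} {u v : ℝ → ℂ → ℝ → ℂ} {E₀ : ℂ}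

/-- If there were no zeros, `totalGrowth` would have the mean value property at `E₀` as a limit of
harmonic functions. It is a sum of three subharmonic functions, one strictly subharmonic at `E₀`. -/
theorem WKBBounds.exists_shooting_eq_zero (wb : WKBBounds V Δ R C)
    (hk₀ : ‖k₀‖ ≤ Δ) (hk₁ : ‖k₁‖ ≤ Δ) (hk₂ : ‖k₂‖ ≤ Δ) (h01 : k₀ ≠ k₁) (h12 : k₁ ≠ k₂)
    (hV : ContinuousOn (fun x : ℝ => V x) (Icc (-1) 1))
    (hβ : -1 < β) (hββ' : β < β') (hβ' : β' < 1) (hR : R < ‖E₀‖)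
    (hs : ShootingFamily V k₀ k₁ k₂ β β' u v)
    (hu : ∀ h : ℝ, 0 < h → Differentiable ℂ fun E => u h E 1)
    (hA : (wkbAction V k₀ (-1) β E₀ E₀).re = 0 ∨ (wkbAction V k₁ β β' E₀ E₀).re = 0 ∨
      (wkbAction V k₂ β' 1 E₀ E₀).re = 0) {r : ℝ} (hr : 0 < r) :
    ∃ h ∈ Ioo 0 r, ∃ E ∈ Metric.ball E₀ r, u h E 1 = 0 := by
  have hE₀ : E₀ ≠ 0 := norm_pos_iff.1 (wb.R_pos.trans hR)
  have hN := norm_pos_iff.2 hE₀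
  by_contra! hcon
  obtain ⟨K, hK⟩ := wb.shooting_bounded hk₀ hk₁ hk₂ hβ hββ' hβ' hE₀ (E₁ := E₀)
    (by rw [sub_self, norm_zero]; positivity) hR hs
  obtain ⟨P, hP, Q, hQ, hPQ⟩ := eventually_prod_iff.1 hK
  have hQ' : ∀ᶠ E in 𝓝 E₀, Q E ∧ R < ‖E‖ ∧ ‖E - E₀‖ ≤ ‖E₀‖ / 8 ∧ E ∈ Metric.ball E₀ r := by
    refine hQ.and (((continuous_norm.tendsto E₀).eventually (lt_mem_nhds hR)).and
      (Eventually.and ?_ (Metric.ball_mem_nhds _ hr)))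
    filter_upwards [Metric.closedBall_mem_nhds E₀ (show 0 < ‖E₀‖ / 8 by positivity)] with E hE
    rwa [mem_closedBall_iff_norm] at hE
  obtain ⟨s, hs0, hsQ⟩ := Metric.eventually_nhds_iff_ball.1 hQ'
  obtain ⟨ρ, hρ, hρs⟩ : ∃ ρ, 0 < ρ ∧ 8 * ρ < s := ⟨s / 16, by positivity, by linarith⟩
  have hb : ∀ {a : ℝ}, a ≤ 8 * ρ → Metric.ball E₀ a ⊆ Metric.ball E₀ s := fun h =>
    Metric.ball_subset_ball (h.trans hρs.le)
  set σ := (-E₀).sqrt with hσdef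
  have hσ : σ ≠ 0 := csqrt_ne_zero (neg_ne_zero.2 hE₀)
  have hd : ∀ {k : ℂ} {p q : ℝ}, ‖k‖ ≤ Δ → -1 ≤ p → p < q → q ≤ 1 →
      DifferentiableOn ℂ (wkbAction V k p q E₀) (Metric.ball E₀ s) := fun hk hp hpq hq E hE =>
    (wb.differentiableAt_wkbAction hk hV hp hpq.le hq hE₀ (hsQ E hE).2.2.1
      (hsQ E hE).2.1).differentiableWithinAt
  have hmono : ∀ {k : ℂ} {p q : ℝ}, ‖k‖ ≤ Δ → -1 ≤ p → p < q → q ≤ 1 →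
      ∀ E ∈ Metric.ball E₀ s, ∀ t : ℝ, 0 < t → E - t * σ ∈ Metric.ball E₀ s →
      (wkbAction V k p q E₀ E).re < (wkbAction V k p q E₀ (E - t * σ)).re :=
    fun hk hp hpq hq E hE t ht hEt => wb.re_wkbAction_lt hk hV hp hpq hq hE₀ (hsQ E hE).2.2.1
      (hsQ E hE).2.1.le (hsQ _ hEt).2.2.1 (hsQ _ hEt).2.1.le ht rfl
  have hray : ∀ E : ℂ, Tendsto (fun t : ℝ => E - t * σ) (𝓝[>] 0) (𝓝 E) := fun E => by
    have : Tendsto (fun t : ℝ => E - t * σ) (𝓝 0) (𝓝 (E - (0 : ℝ) * σ)) :=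
      (by fun_prop : Continuous fun t : ℝ => E - t * σ).tendsto 0
    simpa using this.mono_left nhdsWithin_le_nhds
  have hev : ∀ {k : ℂ} {p q : ℝ}, ‖k‖ ≤ Δ → -1 ≤ p → p < q → q ≤ 1 →
      ∀ E ∈ Metric.ball E₀ s, ∀ᶠ t : ℝ in 𝓝[>] 0, (wkbAction V k p q E₀ (E - t * σ)).re ≠ 0 := by
    intro k p q hk hp hpq hq E hE
    have hEn := Metric.isOpen_ball.mem_nhds hE
    refine eventually_ne_zero_of_lt (f := fun E => (wkbAction V k p q E₀ E).re)
      (Complex.continuous_re.continuousAt.comp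
        ((hd hk hp hpq hq).continuousOn.continuousAt hEn)) ?_
    filter_upwards [(hray E).eventually hEn, self_mem_nhdsWithin] with t h1 h2
    exact hmono hk hp hpq hq E hE t h2 h1
  have hβ1 : β < 1 := hββ'.trans hβ'
  have hβ'1 : -1 ≤ β' := (hβ.trans hββ').le
  set S : Set ℂ := {E | (wkbAction V k₀ (-1) β E₀ E).re ≠ 0 ∧ (wkbAction V k₁ β β' E₀ E).re ≠ 0 ∧
    (wkbAction V k₂ β' 1 E₀ E).re ≠ 0}
  have hS : ∀ z ∈ Metric.ball E₀ (3 * ρ), z ∈ closure (S ∩ Metric.ball E₀ (3 * ρ)) := by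
    intro z hz
    have hzs := hb (by linarith) hz
    refine mem_closure_of_tendsto (hray z) ?_
    filter_upwards [hev hk₀ le_rfl hβ hβ1.le z hzs, hev hk₁ hβ.le hββ' hβ'.le z hzs,
      hev hk₂ hβ'1 hβ' le_rfl z hzs, (hray z).eventually (Metric.isOpen_ball.mem_nhds hz)]
      with t h0 h1 h2 h3
    exact ⟨⟨h0, h1, h2⟩, h3⟩
  have hcont : ContinuousOn (totalGrowth V k₀ k₁ k₂ β β' E₀) (Metric.ball E₀ s) := by
    have h1 : ∀ {k : ℂ} {p q : ℝ}, ‖k‖ ≤ Δ → -1 ≤ p → p < q → q ≤ 1 →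
        ContinuousOn (fun E => |(wkbAction V k p q E₀ E).re|) (Metric.ball E₀ s) :=
      fun hk hp hpq hq => (Complex.continuous_re.comp_continuousOn
        (hd hk hp hpq hq).continuousOn).abs
    exact ((h1 hk₀ le_rfl hβ hβ1.le).add (h1 hk₁ hβ.le hββ' hβ'.le)).add
      (h1 hk₂ hβ'1 hβ' le_rfl)
  obtain ⟨B, hB⟩ : ∃ B, ∀ E ∈ Metric.closedBall E₀ (8 * ρ),
      totalGrowth V k₀ k₁ k₂ β β' E₀ E ≤ B := by
    obtain ⟨B, hB⟩ := (isCompact_closedBall E₀ (8 * ρ)).bddAbove_image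
      (hcont.mono (Metric.closedBall_subset_ball hρs))
    exact ⟨B, fun E hE => hB (mem_image_of_mem _ hE)⟩
  -- Harmonic in `E` since the argument is holomorphic and, by assumption, without zeros; the factor
  -- `h` turns `exp (Φ / h)` into `Φ`, and constant prefactors disappear in the limit.
  set U : ℝ → ℂ → ℝ := fun h E => h * Real.log ‖energyRoot E₀ E / (h : ℂ) * u h E 1‖
  have hne : ∀ h ∈ Ioo 0 r, ∀ E ∈ Metric.ball E₀ s, energyRoot E₀ E / (h : ℂ) * u h E 1 ≠ 0 := by
    intro h hh E hE
    have h1 : energyRoot E₀ E ≠ 0 := fun h0 => by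
      have h2 := energyRoot_sq hE₀ E
      rw [h0, zero_pow two_ne_zero] at h2
      have h3 := wb.R_pos.trans (hsQ E hE).2.1
      rw [neg_eq_zero.1 h2.symm, norm_zero] at h3
      exact h3.false
    exact mul_ne_zero (div_ne_zero h1 (by exact_mod_cast hh.1.ne'))
      (hcon h hh E (hsQ E hE).2.2.2)
  have hsmall : ∀ᶠ h : ℝ in 𝓝[>] 0, h ∈ Ioo 0 r := Ioo_mem_nhdsGT hr
  have hmain := circleAverage_eq_of_tendsto_on_dense (l := 𝓝[>] (0 : ℝ)) (U := U)
    (Φ := totalGrowth V k₀ k₁ k₂ β β' E₀) (M := B + r * |Real.log K|) hρ hS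
    (by
      filter_upwards [hsmall] with h hh E hE
      have hE' := hb le_rfl hE
      have hdiff : DifferentiableOn ℂ (fun E => energyRoot E₀ E / (h : ℂ) * u h E 1)
          (Metric.ball E₀ s) := fun z hz =>
        (((differentiableAt_energyRoot hE₀ (hsQ z hz).2.2.1).div_const _).mul
          (hu h hh.1 z)).differentiableWithinAt
      exact ((hdiff.analyticAt (Metric.isOpen_ball.mem_nhds hE')).harmonicAt_log_norm
        (hne h hh E hE')).const_smul (c := h))
    (by
      filter_upwards [hsmall, hP] with h hh hPh E hE
      have hE' := hb le_rfl hE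
      have h1 := hPQ hPh (hsQ E hE').1
      have h2 := norm_pos_iff.2 (hne h hh E hE')
      have hK0 : 0 < K := pos_of_mul_pos_left (h2.trans_le h1) (Real.exp_pos _).le
      have h3 := Real.log_le_log h2 h1
      rw [Real.log_mul hK0.ne' (Real.exp_ne_zero _), Real.log_exp] at h3
      have h4 : U h E ≤ h * Real.log K + totalGrowth V k₀ k₁ k₂ β β' E₀ E := by
        refine (mul_le_mul_of_nonneg_left h3 hh.1.le).trans (le_of_eq ?_)
        rw [mul_add, mul_div_cancel₀ _ hh.1.ne']
      have h5 : h * Real.log K ≤ r * |Real.log K| :=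
        (mul_le_mul_of_nonneg_left (le_abs_self _) hh.1.le).trans
          (mul_le_mul_of_nonneg_right hh.2.le (abs_nonneg _))
      linarith [hB E (Metric.ball_subset_closedBall hE)])
    (hcont.mono (hb (by linarith)))
    (by
      rintro E ⟨⟨hE0, hE1, hE2⟩, hEb⟩
      have hE' := hb (by linarith) hEb
      obtain ⟨L, hL, hlim⟩ := wb.shooting_tendsto hk₀ hk₁ hk₂ h01 h12 hV hβ hββ' hβ' hE₀
        (hsQ E hE').2.2.1 (hsQ E hE').2.1 hs hE0 hE1 hE2
      have h1 : Tendsto (fun h : ℝ => (h, E)) (𝓝[>] 0) (𝓝[>] 0 ×ˢ 𝓝 E) :=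
        tendsto_id.prodMk tendsto_const_nhds
      have h2 := (hlim.comp h1).log hL.ne'
      have h3 : Tendsto (fun h : ℝ => h) (𝓝[>] 0) (𝓝 0) :=
        tendsto_id.mono_left nhdsWithin_le_nhds
      have h4 := (h3.mul h2).add_const (totalGrowth V k₀ k₁ k₂ β β' E₀ E)
      rw [zero_mul, zero_add] at h4
      refine h4.congr' ?_
      filter_upwards [hsmall] with h hh
      have h5 := hne h hh E hE'
      have h6 := hh.1.ne'
      simp only [Function.comp_apply]
      rw [Real.log_mul (Real.exp_ne_zero _) (norm_ne_zero_iff.2 h5), Real.log_exp]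
      simp only [U]
      field_simp
      ring)
  have havg : ∀ {k : ℂ} {p q : ℝ}, ‖k‖ ≤ Δ → -1 ≤ p → p < q → q ≤ 1 →
      CircleIntegrable (fun E => |(wkbAction V k p q E₀ E).re|) E₀ ρ ∧
      |(wkbAction V k p q E₀ E₀).re| ≤
        Real.circleAverage (fun E => |(wkbAction V k p q E₀ E).re|) E₀ ρ ∧
      ((wkbAction V k p q E₀ E₀).re = 0 → |(wkbAction V k p q E₀ E₀).re| <
        Real.circleAverage (fun E => |(wkbAction V k p q E₀ E).re|) E₀ ρ) :=
    fun hk hp hpq hq => ⟨ContinuousOn.circleIntegrable hρ.le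
      ((Complex.continuous_re.comp_continuousOn ((hd hk hp hpq hq).continuousOn.mono
        (Metric.sphere_subset_closedBall.trans
          (Metric.closedBall_subset_ball (by linarith))))).abs),
      abs_re_le_circleAverage hρ (by linarith) (hd hk hp hpq hq) hσ
        (hmono hk hp hpq hq E₀ (Metric.mem_ball_self hs0))⟩
  obtain ⟨i0, a0, b0⟩ := havg hk₀ le_rfl hβ hβ1.le
  obtain ⟨i1, a1, b1⟩ := havg hk₁ hβ.le hββ' hβ'.le
  obtain ⟨i2, a2, b2⟩ := havg hk₂ hβ'1 hβ' le_rfl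
  have hsum : Real.circleAverage (totalGrowth V k₀ k₁ k₂ β β' E₀) E₀ ρ =
      Real.circleAverage (fun E => |(wkbAction V k₀ (-1) β E₀ E).re|) E₀ ρ +
      Real.circleAverage (fun E => |(wkbAction V k₁ β β' E₀ E).re|) E₀ ρ +
      Real.circleAverage (fun E => |(wkbAction V k₂ β' 1 E₀ E).re|) E₀ ρ := by
    rw [← Real.circleAverage_add i0 i1, ← Real.circleAverage_add (i0.add i1) i2]
    rfl
  rw [hsum, totalGrowth] at hmain
  rcases hA with h | h | h
  · linarith [b0 h]
  · linarith [b1 h]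
  · linarith [b2 h]

end Zeros

/-! ### The shooting family of a potential with two jumps -/

theorem hasDerivWithinAt_of_eq_add_integral {F g : ℝ → ℂ} {p q : ℝ} (hpq : p ≤ q)
    (hg : ContinuousOn g (Icc p q)) (hF : ∀ x ∈ Icc p q, F x = F p + ∫ s in p..x, g s)
    {x : ℝ} (hx : x ∈ Icc p q) : HasDerivWithinAt F (g x) (Icc p q) x := by
  set G : ℝ → ℂ := IccExtend hpq ((Icc p q).domRestrict g)
  have hGc : Continuous G := (continuousOn_iff_continuous_domRestrict.1 hg).Icc_extend'
  have hG : ∀ y ∈ Icc p q, G y = g y := fun y hy => IccExtend_of_mem hpq _ hy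
  have h1 := ((intervalIntegral.integral_hasDerivAt_right (hGc.intervalIntegrable p x)
    (hGc.stronglyMeasurableAtFilter _ _) hGc.continuousAt).const_add (F p)).hasDerivWithinAt
    (s := Icc p q)
  rw [hG x hx] at h1
  have h2 : ∀ y ∈ Icc p q, F y = F p + ∫ s in p..y, G s := fun y hy => by
    rw [hF y hy]
    congr 1
    refine intervalIntegral.integral_congr fun s hs => ?_
    rw [uIcc_of_le hy.1] at hs
    exact (hG s ⟨hs.1, hs.2.trans hy.2⟩).symm
  exact h1.congr h2 (h2 x hx)

section JumpPotential

variable {V : ℂ → ℂ} {β β' δ₁ δ₂ : ℝ}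

theorem jumpPotential_of_lt (h : β < β') {x : ℝ} (hx : x < β) :
    jumpPotential V β β' δ₁ δ₂ x = V x + 0 := by
  simp [jumpPotential, hx.le, (hx.trans h).le]

theorem jumpPotential_of_mem_Ioo {x : ℝ} (hx : x ∈ Ioo β β') :
    jumpPotential V β β' δ₁ δ₂ x = V x + Complex.I * δ₁ := by
  simp [jumpPotential, hx.1, hx.2.le]

theorem jumpPotential_of_gt (h : β < β') {x : ℝ} (hx : β' < x) :
    jumpPotential V β β' δ₁ δ₂ x = V x + (Complex.I * δ₁ + Complex.I * δ₂) := by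
  simp [jumpPotential, hx, h.trans hx, add_assoc]

theorem aestronglyMeasurable_jumpPotential (hV : ContinuousOn (fun x : ℝ => V x) (Icc (-1) 1)) :
    AEStronglyMeasurable (jumpPotential V β β' δ₁ δ₂) (volume.restrict (Icc (-1 : ℝ) 1)) := by
  have h1 : ∀ (c : ℂ) (b : ℝ), AEStronglyMeasurable
      (fun x : ℝ => c * (Ioi b).indicator (1 : ℝ → ℂ) x) (volume.restrict (Icc (-1 : ℝ) 1)) :=
    fun c b => ((measurable_one.indicator measurableSet_Ioi).const_mul c).aestronglyMeasurable
  exact ((hV.aestronglyMeasurable measurableSet_Icc).add (h1 _ _)).add (h1 _ _)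

theorem norm_jumpPotential_le {M : ℝ} (hM : ∀ x ∈ Icc (-1 : ℝ) 1, ‖V x‖ ≤ M) :
    ∀ x ∈ Icc (-1 : ℝ) 1, ‖jumpPotential V β β' δ₁ δ₂ x‖ ≤ M + |δ₁| + |δ₂| := by
  have h1 : ∀ (δ b x : ℝ), ‖Complex.I * δ * (Ioi b).indicator (1 : ℝ → ℂ) x‖ ≤ |δ| := by
    intro δ b x
    rw [norm_mul, norm_mul, Complex.norm_I, one_mul, Complex.norm_real, Real.norm_eq_abs]
    refine mul_le_of_le_one_right (abs_nonneg _) ?_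
    refine (norm_indicator_le_norm_self _ _).trans ?_
    simp
  intro x hx
  exact (norm_add₃_le).trans (add_le_add_three (hM x hx) (h1 _ _ _) (h1 _ _ _))

theorem exists_shootingFamily (hV : ContinuousOn (fun x : ℝ => V x) (Icc (-1) 1))
    (hβ : -1 < β) (hββ' : β < β') (hβ' : β' < 1) :
    ∃ u v : ℝ → ℂ → ℝ → ℂ,
      ShootingFamily V 0 (Complex.I * δ₁) (Complex.I * δ₁ + Complex.I * δ₂) β β' u v ∧
      (∀ h : ℝ, 0 < h → Differentiable ℂ fun E => u h E 1) ∧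
      ∀ h : ℝ, 0 < h → ∀ E,
        IsDirichletEigenvalue h (jumpPotential V β β' δ₁ δ₂) E ↔ u h E 1 = 0 := by
  obtain ⟨M, hM⟩ : ∃ M, ∀ x ∈ Icc (-1 : ℝ) 1, ‖V x‖ ≤ M :=
    isCompact_Icc.exists_bound_of_continuousOn hV
  have hW := aestronglyMeasurable_jumpPotential (β := β) (β' := β') (δ₁ := δ₁) (δ₂ := δ₂) hV
  have hWM := norm_jumpPotential_le (β := β) (β' := β') (δ₁ := δ₁) (δ₂ := δ₂) hM
  set W := jumpPotential V β β' δ₁ δ₂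
  choose! u v huc hvc hu hv hd he using fun (h : ℝ) (hh : 0 < h) =>
    exists_shooting_solution hW hWM hh.ne'
  refine ⟨u, v, fun h hh E => ?_, hd, he⟩
  have hint : ∀ p ∈ Icc (-1 : ℝ) 1, ∀ q ∈ Icc (-1 : ℝ) 1,
      IntervalIntegrable (fun s => (W s - E) / (h : ℂ) ^ 2 * u h E s) volume p q :=
    fun p hp q hq => intervalIntegrable_mul_of_bounded
      (Q := fun s => (W s - E) / (h : ℂ) ^ 2) (K := (M + |δ₁| + |δ₂| + ‖E‖) / ‖(h : ℂ) ^ 2‖)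
      (by
        simp only [div_eq_mul_inv]
        exact (hW.sub aestronglyMeasurable_const).mul_const _)
      (fun x hx => by
        rw [norm_div]
        have := (norm_sub_le (W x) E).trans (add_le_add_left (hWM x hx) _)
        gcongr) (huc h hh E) hp hq
  have hsolve : ∀ {k : ℂ} {p q : ℝ}, -1 ≤ p → p < q → q ≤ 1 → (∀ x ∈ Ioo p q, W x = V x + k) →
      SolvesOn V k p q h E (u h E) (v h E) := by
    intro k p q hp hpq hq hWk
    have hsub : Icc p q ⊆ Icc (-1 : ℝ) 1 := Icc_subset_Icc hp hq
    have hpm := hsub (left_mem_Icc.2 hpq.le)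
    refine ⟨fun x hx => hasDerivWithinAt_of_eq_add_integral hpq.le ((hvc h hh E).mono hsub)
      (fun y hy => ?_) hx, fun x hx => hasDerivWithinAt_of_eq_add_integral
        (g := fun x => (V x + k - E) / (h : ℂ) ^ 2 * u h E x) hpq.le ?_ (fun y hy => ?_) hx⟩
    · have hi : ∀ a ∈ Icc (-1 : ℝ) 1, ∀ b ∈ Icc (-1 : ℝ) 1,
          IntervalIntegrable (v h E) volume a b := fun a ha b hb =>
        ((hvc h hh E).mono (uIcc_subset_Icc ha hb)).intervalIntegrable
      rw [hu h hh E y (hsub hy), hu h hh E p hpm, intervalIntegral.integral_add_adjacent_intervals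
        (hi _ neg_one_mem_unit _ hpm) (hi _ hpm _ (hsub hy))]
    · exact ((((hV.mono hsub).add continuousOn_const).sub continuousOn_const).div_const _).mul
        ((huc h hh E).mono hsub)
    -- The integral equation ignores the values of the potential at the jumps, so the differential
    -- equation with the constant `k` holds up to the end points of each interval.
    · rw [hv h hh E y (hsub hy), hv h hh E p hpm, add_assoc]
      have h1 : ∫ s in p..y, (V s + k - E) / (h : ℂ) ^ 2 * u h E s =
          ∫ s in p..y, (W s - E) / (h : ℂ) ^ 2 * u h E s :=
        intervalIntegral_congr_Ioo hy.1 fun s hs => by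
          rw [hWk s ⟨hs.1, hs.2.trans_le hy.2⟩]
      rw [h1, intervalIntegral.integral_add_adjacent_intervals
        (hint _ neg_one_mem_unit _ hpm) (hint _ hpm _ (hsub hy))]
  refine ⟨by simp [hu h hh E _ neg_one_mem_unit], by simp [hv h hh E _ neg_one_mem_unit],
    hsolve le_rfl hβ (hββ'.trans hβ').le fun x hx => jumpPotential_of_lt hββ' hx.2,
    hsolve hβ.le hββ' hβ'.le fun x hx => jumpPotential_of_mem_Ioo hx,
    hsolve (hβ.trans hββ').le hβ' le_rfl fun x hx => jumpPotential_of_gt hββ' hx.1⟩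

/-! ### The limit spectrum -/

theorem WKBBounds.actionVanishes_iff_mem_limitSpectrum {Δ R C : ℝ} (wb : WKBBounds V Δ R C)
    (hV : ContinuousOn (fun x : ℝ => V x) (Icc (-1) 1))
    (hβ : -1 < β) (hββ' : β < β') (hβ' : β' < 1) (hδ₁ : δ₁ ≠ 0) (hδ₂ : δ₂ ≠ 0)
    (hΔ : |δ₁| + |δ₂| ≤ Δ) {E₀ : ℂ} (hE₀ : R < ‖E₀‖) :
    (ActionVanishes (jumpPotential V β β' δ₁ δ₂) E₀ (-1) β ∨
      ActionVanishes (jumpPotential V β β' δ₁ δ₂) E₀ β' 1 ∨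
      ActionVanishes (jumpPotential V β β' δ₁ δ₂) E₀ β β') ↔
    E₀ ∈ limitSpectrum (jumpPotential V β β' δ₁ δ₂) := by
  have hI : ∀ δ : ℝ, ‖Complex.I * δ‖ = |δ| := fun δ => by
    rw [norm_mul, Complex.norm_I, one_mul, Complex.norm_real, Real.norm_eq_abs]
  have hI0 : ∀ δ : ℝ, δ ≠ 0 → Complex.I * δ ≠ 0 := fun δ hδ =>
    mul_ne_zero Complex.I_ne_zero (by exact_mod_cast hδ)
  have a1 := abs_nonneg δ₁
  have a2 := abs_nonneg δ₂
  have hk₀ : ‖(0 : ℂ)‖ ≤ Δ := by rw [norm_zero]; linarith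
  have hk₁ : ‖Complex.I * δ₁‖ ≤ Δ := by rw [hI]; linarith
  have hk₂ : ‖Complex.I * δ₁ + Complex.I * δ₂‖ ≤ Δ :=
    (norm_add_le _ _).trans (by rw [hI, hI]; exact hΔ)
  have h01 : 0 ≠ Complex.I * δ₁ := (hI0 δ₁ hδ₁).symm
  have h12 : Complex.I * δ₁ ≠ Complex.I * δ₁ + Complex.I * δ₂ := by
    simpa using hδ₂
  have hE₀0 : E₀ ≠ 0 := norm_pos_iff.1 (wb.R_pos.trans hE₀)
  rw [actionVanishes_congr fun x hx => jumpPotential_of_lt hββ' hx.2,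
    actionVanishes_congr (p := β') fun x hx => jumpPotential_of_gt hββ' hx.1,
    actionVanishes_congr (p := β) fun x hx => jumpPotential_of_mem_Ioo hx,
    wb.actionVanishes_iff hk₀ hV le_rfl hβ.le (hββ'.trans hβ').le hE₀.le,
    wb.actionVanishes_iff hk₁ hV hβ.le hββ'.le hβ'.le hE₀.le,
    wb.actionVanishes_iff hk₂ hV (hβ.trans hββ').le hβ'.le le_rfl hE₀.le]
  obtain ⟨u, v, hs, hd, he⟩ := exists_shootingFamily (δ₁ := δ₁) (δ₂ := δ₂) hV hβ hββ' hβ'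
  constructor
  · intro hA
    have key : ∀ n : ℕ, ∃ h ∈ Ioo (0 : ℝ) (1 / (n + 1)), ∃ E ∈ Metric.ball E₀ (1 / (n + 1)),
        u h E 1 = 0 := fun n => wb.exists_shooting_eq_zero hk₀ hk₁ hk₂ h01 h12 hV hβ hββ' hβ' hE₀
      hs hd (by tauto) Nat.one_div_pos_of_nat
    choose h hh E hE hz using key
    refine ⟨h, E, fun n => (hh n).1, squeeze_zero (fun n => (hh n).1.le) (fun n => (hh n).2.le)
      tendsto_one_div_add_atTop_nhds_zero_nat, fun n => (he _ (hh n).1 _).2 (hz n), ?_⟩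
    exact tendsto_iff_dist_tendsto_zero.2 (squeeze_zero (fun n => dist_nonneg)
      (fun n => (Metric.mem_ball.1 (hE n)).le) tendsto_one_div_add_atTop_nhds_zero_nat)
  -- Were all three real parts nonzero, the normalised shooting function would tend to a positive
  -- limit, although it is zero along the sequence of eigenvalues.
  · rintro ⟨h, E, hh, hh0, heig, hE⟩
    by_contra! hne
    obtain ⟨L, hL, hlim⟩ := wb.shooting_tendsto hk₀ hk₁ hk₂ h01 h12 hV hβ hββ' hβ' hE₀0
      (by rw [sub_self, norm_zero]; positivity) hE₀ hs hne.1 hne.2.2 hne.2.1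
    have h1 : Tendsto h atTop (𝓝[>] 0) :=
      tendsto_nhdsWithin_iff.2 ⟨hh0, Eventually.of_forall hh⟩
    have h2 := hlim.comp (h1.prodMk hE)
    refine hL.ne (tendsto_nhds_unique (tendsto_const_nhds.congr fun n => ?_) h2)
    simp [(he _ (hh n) _).1 (heig n)]

/-- The action of the middle interval vanishes for some `b` in the range of `Im V + δ₁` there, hence
within `ε` of `c`. Taking `Δ = 2` covers all jumps of size at most one, so the energy threshold
depends on `V` only. -/
theorem WKBBounds.exists_mem_limitSpectrum_vertical {R C : ℝ} (wb : WKBBounds V 2 R C)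
    (hV : ContinuousOn (fun x : ℝ => V x) (Icc (-1) 1))
    (hβ : -1 < β) (hββ' : β < β') (hβ' : β' < 1) (hδ₁ : δ₁ ≠ 0) (hδ₂ : δ₂ ≠ 0)
    (hδ₁' : |δ₁| ≤ 1) (hδ₂' : |δ₂| ≤ 1) {a c ε : ℝ} (haR : R < a)
    (ha : ∀ x ∈ Icc (-1 : ℝ) 1, ‖V x‖ < a) (hδε : |δ₁| < ε / 2)
    (hc : ∀ x ∈ Icc β β', |(V x).im - c| < ε / 2) :
    ∃ E ∈ limitSpectrum (jumpPotential V β β' δ₁ δ₂), ‖E - (a + c * Complex.I)‖ < ε := by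
  have hsub : Icc β β' ⊆ Icc (-1 : ℝ) 1 := Icc_subset_Icc hβ.le hβ'.le
  -- Compactness replaces the pointwise strict bound by a uniform one below `ε / 2`, which keeps the
  -- final inequality strict.
  obtain ⟨T, hT, hTε, hcT⟩ : ∃ T, 0 ≤ T ∧ T < ε / 2 ∧ ∀ x ∈ Icc β β', |(V x).im - c| ≤ T := by
    obtain ⟨x₀, hx₀, hmax⟩ := isCompact_Icc.exists_isMaxOn (nonempty_Icc.2 hββ'.le)
      (((Complex.continuous_im.comp_continuousOn (hV.mono hsub)).sub
        (continuousOn_const (c := c))).abs)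
    exact ⟨_, abs_nonneg _, hc x₀ hx₀, hmax⟩
  have h1 := abs_le.1 (le_refl |δ₁|)
  obtain ⟨b, hb, hvan⟩ := exists_actionVanishes_vertical (p := β) (q := β')
    (f := fun x : ℝ => V x + Complex.I * δ₁) (a := a) (m := c - T - |δ₁|) (M := c + T + |δ₁|)
    hββ'.le ((hV.mono hsub).add continuousOn_const)
    (fun x hx => by
      have h2 := (Complex.re_le_norm (V x)).trans_lt (ha x (hsub hx))
      simpa using h2)
    (by linarith [abs_nonneg δ₁])
    (fun x hx => by
      have h2 := abs_le.1 (hcT x hx)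
      simp
      linarith)
    (fun x hx => by
      have h2 := abs_le.1 (hcT x hx)
      simp
      linarith)
  refine ⟨a + b * Complex.I, ?_, ?_⟩
  · rw [← wb.actionVanishes_iff_mem_limitSpectrum hV hβ hββ' hβ' hδ₁ hδ₂ (by linarith)]
    · exact Or.inr (Or.inr (hvan.congr fun x hx => (jumpPotential_of_mem_Ioo hx).symm))
    · have h2 := Complex.re_le_norm (a + b * Complex.I)
      simp only [Complex.add_re, Complex.ofReal_re, Complex.mul_re, Complex.I_re, mul_zero,
        Complex.ofReal_im, Complex.I_im, mul_one, sub_self, add_zero] at h2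
      linarith
  · have h2 : (a + b * Complex.I : ℂ) - (a + c * Complex.I) = ((b - c : ℝ) : ℂ) * Complex.I := by
      push_cast
      ring
    rw [h2, norm_mul, Complex.norm_I, mul_one, Complex.norm_real, Real.norm_eq_abs, abs_lt]
    constructor <;> linarith [hb.1, hb.2]

end JumpPotential

/-! ### Assembly of the main theorem -/

theorem mainTheorem13 (D : Set ℂ) (hDopen : IsOpen D) (hDconn : IsPreconnected D)
    (hD : ∀ x ∈ Icc (-1 : ℝ) 1, (x : ℂ) ∈ D)
    (V : ℂ → ℂ) (hV : DifferentiableOn ℂ V D) (hH1 : HypothesisH1 D V) :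
    (∀ β β' : ℝ, -1 < β → β < β' → β' < 1 → HypothesisH4 D V β β' →
      (∀ δ₁ δ₂ : ℝ, δ₁ ≠ 0 → δ₂ ≠ 0 → ∃ R : ℝ, ∀ E₀ : ℂ, R ≤ ‖E₀‖ →
        ((ActionVanishes (jumpPotential V β β' δ₁ δ₂) E₀ (-1) β ∨
          ActionVanishes (jumpPotential V β β' δ₁ δ₂) E₀ β' 1 ∨
          ActionVanishes (jumpPotential V β β' δ₁ δ₂) E₀ β β') ↔
        E₀ ∈ limitSpectrum (jumpPotential V β β' δ₁ δ₂))) ∧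
      (∀ δ₁ : ℝ, ∃ A C : ℝ, 0 < A ∧ ∀ a : ℝ, A ≤ a →
        (∃! b : ℝ, ActionVanishes (fun x : ℝ => V x + Complex.I * δ₁)
          (a + b * Complex.I) β β') ∧
        ∀ b : ℝ, ActionVanishes (fun x : ℝ => V x + Complex.I * δ₁)
            (a + b * Complex.I) β β' →
          |b - ((∫ x in β..β', V x).im / (β' - β) + δ₁)| ≤ C / a)) ∧
    ((∀ β β' : ℝ, -1 < β → β < β' → β' < 1 → HypothesisH4 D V β β') →
      ∃ R : ℝ,
        (∀ x ∈ Icc (-1 : ℝ) 1, ∀ ξ : ℝ, R ≤ |ξ| → ∀ ε > 0, ∃ η > 0,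
          ∀ β β' δ₁ δ₂ : ℝ, -1 < β → β < β' → β' < 1 → |β - x| < η → |β' - x| < η →
            δ₁ ≠ 0 → |δ₁| < η → δ₂ ≠ 0 → |δ₂| < η →
            ∃ E ∈ limitSpectrum (jumpPotential V β β' δ₁ δ₂),
              ‖E - ((ξ : ℂ) ^ 2 + Complex.I * (V x).im)‖ < ε) ∧
        (∀ z ∈ pseudospectrum V, R ≤ ‖z‖ → ∀ ε > 0,
          ∃ β β' δ₁ δ₂ : ℝ, -1 < β ∧ β < β' ∧ β' < 1 ∧ β' - β < ε ∧
            0 < δ₁ ∧ δ₁ < ε ∧ 0 < δ₂ ∧ δ₂ < ε ∧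
            ∃ E ∈ limitSpectrum (jumpPotential V β β' δ₁ δ₂), ‖E - z‖ < ε)) := by
  have hVc : ContinuousOn (fun x : ℝ => V x) (Icc (-1) 1) :=
    hV.continuousOn.comp Complex.continuous_ofReal.continuousOn hD
  obtain ⟨M, hM⟩ : ∃ M, ∀ x ∈ Icc (-1 : ℝ) 1, ‖V x‖ ≤ M :=
    isCompact_Icc.exists_bound_of_continuousOn hVc
  have hM0 : 0 ≤ M := (norm_nonneg _).trans (hM _ one_mem_unit)
  have hnear : ∀ x ∈ Icc (-1 : ℝ) 1, ∀ ε > 0, ∃ η > 0, ∀ y ∈ Icc (-1 : ℝ) 1, |y - x| < η →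
      |(V y).im - (V x).im| < ε := fun x hx ε hε => by
    obtain ⟨η, hη, h⟩ := Metric.continuousOn_iff.1 hVc x hx ε hε
    refine ⟨η, hη, fun y hy hyx => ?_⟩
    rw [← Complex.sub_im]
    refine (Complex.abs_im_le_norm _).trans_lt ?_
    rw [← dist_eq_norm]
    exact h y hy hyx
  refine ⟨fun β β' hβ hββ' hβ' _ => ⟨fun δ₁ δ₂ hδ₁ hδ₂ => ?_, fun δ₁ => ?_⟩, fun _ => ?_⟩
  · obtain ⟨R, C, wb⟩ := exists_wkbBounds hDopen hD hV (|δ₁| + |δ₂|)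
    exact ⟨R + 1, fun E₀ hE₀ => wb.actionVanishes_iff_mem_limitSpectrum hVc hβ hββ' hβ' hδ₁ hδ₂
      le_rfl (by linarith)⟩
  · have hsub : Icc β β' ⊆ Icc (-1 : ℝ) 1 := Icc_subset_Icc hβ.le hβ'.le
    have hf : ContinuousOn (fun x : ℝ => V x + Complex.I * δ₁) (Icc β β') :=
      (hVc.mono hsub).add continuousOn_const
    have hK : ∀ x ∈ Icc β β', ‖V x + Complex.I * δ₁‖ ≤ M + |δ₁| := fun x hx => by
      refine (norm_add_le _ _).trans (add_le_add (hM x (hsub hx)) (le_of_eq ?_))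
      rw [norm_mul, Complex.norm_I, one_mul, Complex.norm_real, Real.norm_eq_abs]
    have hK0 : 0 ≤ M + |δ₁| := add_nonneg hM0 (abs_nonneg _)
    refine ⟨M + |δ₁| + 1, 4 * (M + |δ₁|) ^ 2, by linarith, fun a ha => ⟨?_, fun b hb => ?_⟩⟩
    · exact existsUnique_actionVanishes_vertical hββ' hf fun x hx =>
        ((Complex.re_le_norm _).trans (hK x hx)).trans_lt (by linarith)
    · have h1 := abs_sub_average_le_of_actionVanishes hββ' hf hK (by linarith) hb
      have h2 : (∫ x in β..β', (V x + Complex.I * δ₁)).im / (β' - β) =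
          (∫ x in β..β', V x).im / (β' - β) + δ₁ := by
        have hi : IntervalIntegrable (fun x : ℝ => V x) volume β β' :=
          ((hVc.mono hsub).intervalIntegrable_of_Icc hββ'.le)
        rw [intervalIntegral.integral_add hi intervalIntegrable_const,
          intervalIntegral.integral_const, Complex.add_im, add_div]
        have h3 : β' - β ≠ 0 := (sub_pos.2 hββ').ne'
        simp
        field_simp
      rwa [h2] at h1
  · obtain ⟨R, C, wb⟩ := exists_wkbBounds hDopen hD hV 2
    have hR := wb.R_pos
    -- For (a): the threshold exceeds one, so `ξ²` exceeds both `R` and `M`. For (b): a point `ξ² +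
    -- V(x)` within `1` of `z` has real part at least `‖z‖ - 1 - 2M`, which exceeds `R + M`.
    refine ⟨R + 3 * M + 2, fun x hx ξ hξ ε hε => ?_, fun z hz hRz ε hε => ?_⟩
    · obtain ⟨η, hη, hηV⟩ := hnear x hx (ε / 2) (by linarith)
      refine ⟨min (min η 1) (ε / 2), by positivity, ?_⟩
      intro β β' δ₁ δ₂ hβ hββ' hβ' hβx hβ'x hδ₁ hδ₁' hδ₂ hδ₂'
      simp only [lt_min_iff] at hβx hβ'x hδ₁' hδ₂'
      have hξ2 : R + 3 * M + 2 ≤ ξ ^ 2 := by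
        rw [← sq_abs]
        nlinarith
      obtain ⟨E, hE, hEε⟩ := wb.exists_mem_limitSpectrum_vertical hVc hβ hββ' hβ' hδ₁ hδ₂
        hδ₁'.1.2.le hδ₂'.1.2.le (a := ξ ^ 2) (c := (V x).im) (ε := ε) (by linarith)
        (fun y hy => (hM y hy).trans_lt (by linarith)) hδ₁'.2
        (fun y hy => hηV y ⟨hβ.le.trans hy.1, hy.2.trans hβ'.le⟩ (by
          have h1 := abs_lt.1 hβx.1.1
          have h2 := abs_lt.1 hβ'x.1.1
          rw [abs_lt]
          constructor <;> linarith [hy.1, hy.2]))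
      refine ⟨E, hE, ?_⟩
      rw [mul_comm Complex.I]
      exact_mod_cast hEε
    · obtain ⟨w, ⟨x, ξ, hx, -, rfl⟩, hw⟩ := Metric.mem_closure_iff.1 hz (min (ε / 2) 1)
        (by positivity)
      obtain ⟨hw1, hw2⟩ := lt_min_iff.1 hw
      rw [dist_eq_norm] at hw1 hw2
      have hx' : x ∈ Icc (-1 : ℝ) 1 := Ioo_subset_Icc_self hx
      obtain ⟨η, hη, hηV⟩ := hnear x hx' (ε / 4) (by linarith)
      have hx1 : 0 < 1 - x := by linarith [hx.2]
      obtain ⟨τ, hτ, hτm⟩ := exists_between (show 0 < min (min η ε) (1 - x) by positivity)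
      obtain ⟨δ, hδ, hδm⟩ := exists_between (show 0 < min (ε / 4) 1 by positivity)
      simp only [lt_min_iff] at hτm hδm
      have hδa : |δ| = δ := abs_of_pos hδ
      have hVx := hM x hx'
      have hre : R + M < ξ ^ 2 + (V x).re := by
        have h1 : ‖z‖ ≤ ‖z - ((ξ : ℂ) ^ 2 + V x)‖ + (‖(ξ : ℂ) ^ 2‖ + ‖V x‖) := by
          have := norm_add_le (z - ((ξ : ℂ) ^ 2 + V x)) ((ξ : ℂ) ^ 2 + V x)
          rw [sub_add_cancel] at this
          exact this.trans (add_le_add_right (norm_add_le _ _) _)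
        rw [norm_pow, Complex.norm_real, Real.norm_eq_abs, sq_abs] at h1
        have h2 := (abs_le.1 (Complex.abs_re_le_norm (V x))).1
        linarith
      -- The jumps sit at `x` and slightly to its right, which stays inside the interval since `x <
      -- 1`; the vertical line passes through the point `ξ² + V(x)` approximating `z`.
      obtain ⟨E, hE, hEε⟩ := wb.exists_mem_limitSpectrum_vertical hVc (β := x) (β' := x + τ)
        (δ₁ := δ) (δ₂ := δ) hx.1 (by linarith) (by linarith) hδ.ne' hδ.ne'
        (by linarith) (by linarith) (a := ξ ^ 2 + (V x).re) (c := (V x).im) (ε := ε / 2)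
        (by linarith) (fun y hy => (hM y hy).trans_lt (by linarith)) (by linarith)
        (fun y hy => by
          have := hηV y ⟨hx.1.le.trans hy.1, by linarith [hy.2]⟩
            (by rw [abs_lt]; constructor <;> linarith [hy.1, hy.2])
          linarith)
      refine ⟨x, x + τ, δ, δ, hx.1, by linarith, by linarith, by linarith, hδ, by linarith, hδ,
        by linarith, E, hE, ?_⟩
      have h3 : (((ξ ^ 2 + (V x).re : ℝ) : ℂ) + (V x).im * Complex.I) = (ξ : ℂ) ^ 2 + V x := by
        push_cast
        rw [add_assoc, Complex.re_add_im]
      rw [h3] at hEε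
      have h4 := norm_sub_le_norm_sub_add_norm_sub E ((ξ : ℂ) ^ 2 + V x) z
      rw [norm_sub_rev z] at hw1
      linarith
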